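/- Let $n\ge 2$. For $f\in L^2(\mathbb{R}^n)$ let $\hat f(\xi)=\int_{\mathbb{R}^n} e^{-i\langle x,\xi\rangle}f(x)\,dx$ (extended to $L^2$ by Plancherel), and let $$S_tf(x)=\lim_{R\to\infty}(2\pi)^{-n}\int_{\|\xi\|\le R}e^{i\langle x,\xi\rangle}e^{it\|\xi\|^2}\hat f(\xi)\,d\xi$$ be the solution of $i\,\partial_t u=\Delta u$, $u(\cdot,0)=f$, which is said to be defined at $(x,t)$ if this limit exists. For $\beta\ge0$ let $$\dot H^\beta(\mathbb{R}^n)=\Big\{f\in L^2(\mathbb{R}^n):\int\|\xi\|^{2\beta}|\hat f(\xi)|^2\,d\xi<\infty\Big\},\qquad H^\beta(\mathbb{R}^n)=\Big\{f\in L^2(\mathbb{R}^n):\int(1+\|\xi\|^2)^{\beta}|\hat f(\xi)|^2\,d\xi<\infty\Big\}.$$ **Theorem.** Let $C_7\ge 0$, let $J\subseteq\mathbb{R}$ be a set of times (for instance $J=\mathbb{R}$ or $J=[0,\infty)$), and for every $x\in\mathbb{R}^n$ let $\gamma_x:\mathbb{R}\to\mathbb{R}^n$. Suppose that for every $s_0\in[0,\infty)$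 there is a neighbourhood $V\subset[0,\infty)\times\mathbb{R}$ of $(s_0,0)$ such that $$\|\gamma_x(t)\|=s+C_7|t|^{1/2}\qquad\text{for all } (s,t)\in V \text{ with } t\in J \text{ and all } x \text{ with } \|x\|=s.$$ Then for every radial $f\in\dot H^{1/4}(\mathbb{R}^n)$, and hence for every radial $f\in H^\beta(\mathbb{R}^n)$ with $\beta\ge 1/4$, writing $f(x)=f_0(\|x\|)$ for almost every $x$, the following hold. 1. For almost every $s\in[0,\infty)$ and all $x$ with $\|x\|=s$: $S_tf(\gamma_x(t))$ is defined for all $t\in J\setminus\{0\}$ sufficiently close to $0$, and $S_tf(\gamma_x(t))\to f_0(s)$ as $t\to0$, $t\in J\setminus\{0\}$. 2. For almost every $x\in\mathbb{R}^n$: $S_tf(\gamma_x(t))$ is defined for all $t\in J\setminus\{0\}$ sufficiently close to $0$, and $S_tf(\gamma_x(t))\to f(x)$ as $t\to0$, $t\in J\setminus\{0\}$. -/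

import Mathlib

open MeasureTheory Filter Topology
open scoped FourierTransform SchwartzMap

noncomputable section

/-- Frequency-truncated Schrödinger propagation of `f ∈ L²(ℝⁿ)`:
`∫_{|ξ| ≤ R} exp(2πi⟨ξ, x⟩) exp(4π² i t |ξ|²) (𝓕 f)(ξ) dξ`, where `𝓕` is the Fourier–Plancherel
transform `(𝓕 f)(ξ) = ∫ exp(-2πi⟨ξ, x⟩) f(x) dx`. (With the angular frequency `η = 2πξ` the
multiplier is `exp(i t |η|²)`, the one of the equation `i ∂ₜ u = Δ u`.) The integrand is
integrable for every `f ∈ L²`, every `R`, `t` and `x`. -/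
def schrodingerTrunc {n : ℕ} (f : Lp ℂ 2 (volume : Measure (EuclideanSpace ℝ (Fin n))))
    (R t : ℝ) (x : EuclideanSpace ℝ (Fin n)) : ℂ :=
  ∫ ξ in Metric.closedBall (0 : EuclideanSpace ℝ (Fin n)) R,
    Complex.exp (2 * Real.pi * Complex.I * (inner ℝ ξ x : ℝ)) *
      Complex.exp (4 * Real.pi ^ 2 * Complex.I * (t : ℂ) * (‖ξ‖ : ℂ) ^ 2) *
      (𝓕 f : Lp ℂ 2 (volume : Measure (EuclideanSpace ℝ (Fin n)))) ξ

/-- The solution `S_t f (x)` of `i ∂ₜ u = Δ u`, `u(0, ·) = f`, at the point `x` and time `t`, as the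
limit of the integrals over the frequency balls `|ξ| ≤ R`, `R → ∞`. It is meaningful at `(x, t)`
only if the limit exists, see `SchrodingerConvergesAt`. -/
def schrodinger {n : ℕ} (f : Lp ℂ 2 (volume : Measure (EuclideanSpace ℝ (Fin n))))
    (t : ℝ) (x : EuclideanSpace ℝ (Fin n)) : ℂ :=
  limUnder atTop (fun R : ℝ => schrodingerTrunc f R t x)

/-- The limit defining `schrodinger f t x` exists. -/
def SchrodingerConvergesAt {n : ℕ} (f : Lp ℂ 2 (volume : Measure (EuclideanSpace ℝ (Fin n))))
    (t : ℝ) (x : EuclideanSpace ℝ (Fin n)) : Prop :=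
  ∃ u : ℂ, Tendsto (fun R : ℝ => schrodingerTrunc f R t x) atTop (𝓝 u)

/-- `f ∈ L²(ℝⁿ)` belongs to the homogeneous Sobolev space of order `β`:
`∫ |2πξ|^(2β) |(𝓕 f)(ξ)|² dξ < ∞`. -/
def MemHomogeneousSobolev {n : ℕ} (β : ℝ)
    (f : Lp ℂ 2 (volume : Measure (EuclideanSpace ℝ (Fin n)))) : Prop :=
  ∫⁻ ξ : EuclideanSpace ℝ (Fin n), ENNReal.ofReal ((2 * Real.pi * ‖ξ‖) ^ (2 * β) *
    ‖(𝓕 f : Lp ℂ 2 (volume : Measure (EuclideanSpace ℝ (Fin n)))) ξ‖ ^ 2) < ⊤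

/-- `f ∈ L²(ℝⁿ)` belongs to the inhomogeneous Sobolev space `H^β(ℝⁿ)`. -/
def MemInhomogeneousSobolev {n : ℕ} (β : ℝ)
    (f : Lp ℂ 2 (volume : Measure (EuclideanSpace ℝ (Fin n)))) : Prop :=
  TemperedDistribution.MemSobolev β 2 (f : 𝓢'(EuclideanSpace ℝ (Fin n), ℂ))

/-- The norm condition `‖γ_x(t)‖ = s + C |t|^{1/2}`, `s = ‖x‖`, for the family of curves `γ`, for
times in `J`, near every `(s₀, 0)`: the neighbourhoods are those of `(s₀, 0)` in `[0, ∞) × ℝ`. -/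
def CurveNormCondition {n : ℕ} (C : ℝ) (J : Set ℝ)
    (γ : EuclideanSpace ℝ (Fin n) → ℝ → EuclideanSpace ℝ (Fin n)) : Prop :=
  ∀ s₀ : ℝ, 0 ≤ s₀ → ∃ V ∈ 𝓝[Set.Ici (0 : ℝ) ×ˢ (Set.univ : Set ℝ)] ((s₀, 0) : ℝ × ℝ),
    ∀ (x : EuclideanSpace ℝ (Fin n)) (t : ℝ), t ∈ J → (‖x‖, t) ∈ V →
      ‖γ x t‖ = ‖x‖ + C * |t| ^ (1 / 2 : ℝ)

/-- `S_t f (c(t)) → a` as `t → 0`, `t ∈ J \ {0}`; in particular `S_t f (c(t))` is defined for all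
such `t` close to `0`. -/
def SchrodingerTendstoAlong {n : ℕ} (f : Lp ℂ 2 (volume : Measure (EuclideanSpace ℝ (Fin n))))
    (J : Set ℝ) (c : ℝ → EuclideanSpace ℝ (Fin n)) (a : ℂ) : Prop :=
  (∀ᶠ t in 𝓝[J \ {0}] (0 : ℝ), SchrodingerConvergesAt f t (c t)) ∧
    Tendsto (fun t : ℝ => schrodinger f t (c t)) (𝓝[J \ {0}] (0 : ℝ)) (𝓝 a)

end

/-!
The Fourier transform of a radial function is invariant under linear isometries, so averaging over
the directions of the frequency turns the solution into a superposition of radial waves: with `P`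
the radial profile of the Fourier transform of the unit sphere (`sphereProfile`),
`schrodingerTrunc f R (εσ²) x` depends on `x` only through `‖x‖`, and at a point with
`‖x‖ = s + Cσ` it equals the integral `radialPropagator` of
`P(2π(s + Cσ)‖ξ‖) exp(4π²iεσ²‖ξ‖²) 𝓕f(ξ)`, up to a constant factor
(`schrodingerTrunc_eq_radialPropagator`). On the curve `t ↦ γ x t` with `‖x‖ = s` one has
`‖γ x t‖ = s + C√|t|`, so that `σ = √|t|` and `ε = ±1` describe all times near `0`.

The profile solves Bessel's equation, because the Laplacian of the Fourier transform of a measure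
on the unit sphere is its negative (`sphereProfileDeriv₂_eq`). Hence it is
`u^{-(n-1)/2}` times a plane wave up to a relative error `O(1/u)` (`exists_asymptotic_of_bessel`).
The error is handled by the Cauchy–Schwarz inequality. For the two plane waves the radius `R` and
the time `σ` are replaced by arbitrary measurable functions of `s`, and the resulting operator on
`L²` is estimated by the `TT*` method and Schur's test (`integral_sq_norm_integral_mul_le`). With a
quarter of a derivative on `f`, the kernel of `TT*` is the one-dimensional integral of
`ρ^{-1/2} exp(i(Aρ + Bρ²))` with `|A| = 2π|D + C(σ - σ')|`, `|B| = 4π²|σ² - σ'²|` and `D = s - s'`.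
It is `O(|D|^{-1/2})` (`norm_curve_kernel_le`): the integral is `O(|A|^{-1/2})` uniformly in `B` and
`O(|B|^{-1/4})` uniformly in `A`; either `|A|` is comparable to `|D|`, or `C|σ - σ'| ≥ |D|/2` and
then `|σ² - σ'²| ≥ |σ - σ'|²` bounds `|B|` below by a multiple of `D²`. As `|D|^{-1/2}` is locally
integrable, Schur's test applies.

All measurable selections being controlled by the same constant, so is the supremum over `R` and
`σ` (`lintegral_iSup_le_of_selection`), and the contribution of the frequencies beyond `N` tends to
zero with `N`. For almost every `s` the truncated integrals therefore converge uniformly along the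
curve, to a limit which is continuous up to time `0` (`ae_exists_limit_radialPropagator`). At time
`0` the truncated integrals converge to `f` in `L²`, so the limit there is `f₀(s)`. Null sets of
distances and null sets of points correspond by polar coordinates (`ae_norm_iff`).
-/

noncomputable section

/-! ### Oscillatory integrals with quadratic phase -/

/-- The oscillating factor `exp(i(Aρ + Bρ²))`. -/
def quadPhase (A B ρ : ℝ) : ℂ := Complex.exp (((A * ρ + B * ρ ^ 2 : ℝ) : ℂ) * Complex.I)

lemma norm_quadPhase (A B ρ : ℝ) : ‖quadPhase A B ρ‖ = 1 :=
  Complex.norm_exp_ofReal_mul_I _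

lemma continuous_quadPhase (A B : ℝ) : Continuous (quadPhase A B) := by
  unfold quadPhase; fun_prop

lemma hasDerivAt_quadPhase (A B ρ : ℝ) :
    HasDerivAt (quadPhase A B) (quadPhase A B ρ * (((A + 2 * B * ρ : ℝ) : ℂ) * Complex.I)) ρ := by
  have h : HasDerivAt (fun ρ : ℝ => A * ρ + B * ρ ^ 2) (A + 2 * B * ρ) ρ := by
    have := ((hasDerivAt_id ρ).const_mul A).add (((hasDerivAt_id ρ).pow 2).const_mul B)
    refine this.congr_deriv ?_
    norm_num; ring
  exact (h.ofReal_comp.mul_const Complex.I).cexp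

/-- Bounds for the integrals over the intervals on each side of a point `m` add up to a bound for all
intervals. -/
lemma norm_integral_le_add_of_split {G : ℝ → ℂ} {m X Y P : ℝ} (hX : 0 ≤ X) (hY : 0 ≤ Y)
    (hG : ∀ p q, P ≤ p → p ≤ q → IntervalIntegrable G volume p q)
    (h1 : ∀ p q, P ≤ p → p ≤ q → q ≤ m → ‖∫ ρ in p..q, G ρ‖ ≤ X)
    (h2 : ∀ p q, P ≤ p → m ≤ p → p ≤ q → ‖∫ ρ in p..q, G ρ‖ ≤ Y) {p q : ℝ} (hp : P ≤ p)
    (hpq : p ≤ q) : ‖∫ ρ in p..q, G ρ‖ ≤ X + Y := by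
  rcases le_total q m with hq | hq
  · linarith [h1 p q hp hpq hq]
  rcases le_total m p with hm | hm
  · linarith [h2 p q hp hm hpq]
  rw [← intervalIntegral.integral_add_adjacent_intervals (hG p m hp hm) (hG m q (hp.trans hm) hq)]
  exact (norm_add_le _ _).trans
    (add_le_add (h1 p m hp hm le_rfl) (h2 m q (hp.trans hm) le_rfl hq))

/-- First derivative test, by one integration by parts. -/
lemma norm_integral_quadPhase_le_of_deriv {A B p q l : ℝ} (hpq : p ≤ q) (hl : 0 < l)
    (h : ∀ ρ ∈ Set.Icc p q, l ≤ |A + 2 * B * ρ|) :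
    ‖∫ ρ in p..q, quadPhase A B ρ‖ ≤ 4 / l := by
  have hne : ∀ ρ ∈ Set.Icc p q, A + 2 * B * ρ ≠ 0 := fun ρ hρ h0 => by
    have := h ρ hρ; rw [h0, abs_zero] at this; linarith
  have hinv : ∀ ρ ∈ Set.Icc p q, |(A + 2 * B * ρ)⁻¹| ≤ 1 / l := fun ρ hρ => by
    rw [abs_inv, inv_eq_one_div]; exact one_div_le_one_div_of_le hl (h ρ hρ)
  have hder : ∀ ρ ∈ Set.uIcc p q, HasDerivAt (fun ρ : ℝ => (A + 2 * B * ρ)⁻¹)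
      (-(2 * B) / (A + 2 * B * ρ) ^ 2) ρ := fun ρ hρ => by
    rw [Set.uIcc_of_le hpq] at hρ
    have h1 : HasDerivAt (fun ρ : ℝ => A + 2 * B * ρ) (2 * B) ρ := by
      simpa using ((hasDerivAt_id ρ).const_mul (2 * B)).const_add A
    exact h1.inv (hne ρ hρ)
  have hcont : ContinuousOn (fun ρ : ℝ => -(2 * B) / (A + 2 * B * ρ) ^ 2) (Set.uIcc p q) := by
    rw [Set.uIcc_of_le hpq]
    exact continuousOn_const.div (by fun_prop) fun ρ hρ => pow_ne_zero 2 (hne ρ hρ)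
  have hder' : ∀ ρ ∈ Set.uIcc p q, HasDerivAt (fun ρ : ℝ => -Complex.I * ((A + 2 * B * ρ)⁻¹ : ℝ))
      (-Complex.I * ((-(2 * B) / (A + 2 * B * ρ) ^ 2 : ℝ) : ℂ)) ρ := fun ρ hρ =>
    ((hder ρ hρ).ofReal_comp).const_mul _
  have ibp := intervalIntegral.integral_mul_deriv_eq_deriv_mul hder'
    (fun ρ _ => hasDerivAt_quadPhase A B ρ)
    (ContinuousOn.intervalIntegrable (by fun_prop))
    (ContinuousOn.intervalIntegrable
      ((continuous_quadPhase A B).mul (by fun_prop)).continuousOn)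
  have hlhs : ∫ ρ in p..q, (-Complex.I * ((A + 2 * B * ρ)⁻¹ : ℝ)) *
      (quadPhase A B ρ * (((A + 2 * B * ρ : ℝ) : ℂ) * Complex.I)) =
      ∫ ρ in p..q, quadPhase A B ρ := by
    refine intervalIntegral.integral_congr fun ρ hρ => ?_
    rw [Set.uIcc_of_le hpq] at hρ
    have hc : ((A + 2 * B * ρ : ℝ) : ℂ) ≠ 0 := by exact_mod_cast hne ρ hρ
    simp only [Complex.ofReal_inv]
    field_simp
    simp
  rw [hlhs] at ibp
  rw [ibp]
  have hp := hinv p ⟨le_rfl, hpq⟩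
  have hq := hinv q ⟨hpq, le_rfl⟩
  -- the derivative of `1 / φ'` has constant sign, so its integral in norm telescopes
  have hvar : ‖∫ ρ in p..q, (-Complex.I * ((-(2 * B) / (A + 2 * B * ρ) ^ 2 : ℝ) : ℂ)) *
      quadPhase A B ρ‖ ≤ 2 / l := by
    refine (intervalIntegral.norm_integral_le_integral_norm hpq).trans ?_
    have hftc := intervalIntegral.integral_eq_sub_of_hasDerivAt hder hcont.intervalIntegrable
    have hn : ∀ ρ : ℝ, ‖(-Complex.I * ((-(2 * B) / (A + 2 * B * ρ) ^ 2 : ℝ) : ℂ)) *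
        quadPhase A B ρ‖ = |2 * B| / (A + 2 * B * ρ) ^ 2 := fun ρ => by
      rw [norm_mul, norm_quadPhase, norm_mul, norm_neg, Complex.norm_I, Complex.norm_real,
        Real.norm_eq_abs, abs_div, abs_neg, abs_of_nonneg (sq_nonneg (A + 2 * B * ρ))]
      ring
    simp_rw [hn]
    rcases abs_cases (2 * B) with ⟨hB, _⟩ | ⟨hB, _⟩
    · have : ∫ ρ in p..q, |2 * B| / (A + 2 * B * ρ) ^ 2 =
          -∫ ρ in p..q, -(2 * B) / (A + 2 * B * ρ) ^ 2 := by
        rw [← intervalIntegral.integral_neg, hB]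
        congr 1; ext ρ; ring
      rw [this, hftc]
      have h2 : 2 / l = 1 / l + 1 / l := by ring
      linarith [neg_abs_le (A + 2 * B * q)⁻¹, le_abs_self (A + 2 * B * p)⁻¹]
    · have : ∫ ρ in p..q, |2 * B| / (A + 2 * B * ρ) ^ 2 =
          ∫ ρ in p..q, -(2 * B) / (A + 2 * B * ρ) ^ 2 := by rw [hB]
      rw [this, hftc]
      have h2 : 2 / l = 1 / l + 1 / l := by ring
      linarith [neg_abs_le (A + 2 * B * p)⁻¹, le_abs_self (A + 2 * B * q)⁻¹]
  have hb : ∀ ρ : ℝ, ‖-Complex.I * ((A + 2 * B * ρ)⁻¹ : ℝ) * quadPhase A B ρ‖ =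
      |(A + 2 * B * ρ)⁻¹| := fun ρ => by
    rw [norm_mul, norm_quadPhase, norm_mul, norm_neg, Complex.norm_I, Complex.norm_real,
      Real.norm_eq_abs]
    ring
  have h4 : 4 / l = 1 / l + 1 / l + 2 / l := by ring
  refine (norm_sub_le _ _).trans ?_
  rw [h4]
  refine add_le_add ((norm_sub_le _ _).trans (add_le_add ?_ ?_)) hvar
  · rw [hb]; exact hq
  · rw [hb]; exact hp

lemma norm_integral_quadPhase_le_length {A B p q : ℝ} (hpq : p ≤ q) :
    ‖∫ ρ in p..q, quadPhase A B ρ‖ ≤ q - p := by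
  have := intervalIntegral.norm_integral_le_of_norm_le_const (a := p) (b := q) (C := 1)
    (f := quadPhase A B) fun ρ _ => (norm_quadPhase A B ρ).le
  rwa [one_mul, abs_of_nonneg (by linarith)] at this

/-- On one side of the stationary point `-A / (2B)`: the integral over an interval of length
`|B|^{-1/2}` is estimated trivially, and beyond it the derivative of the phase is at least
`2|B|^{1/2}`. -/
lemma norm_integral_quadPhase_le_right {A B : ℝ} (hB : B ≠ 0) {p q : ℝ} (hp : -A / (2 * B) ≤ p)
    (hpq : p ≤ q) : ‖∫ ρ in p..q, quadPhase A B ρ‖ ≤ 3 / √|B| := by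
  have hb : 0 < √|B| := Real.sqrt_pos.2 (abs_pos.2 hB)
  have hbb : √|B| * √|B| = |B| := Real.mul_self_sqrt (abs_nonneg B)
  have h3 : 3 / √|B| = 1 / √|B| + 2 / √|B| := by ring
  rw [h3]
  refine norm_integral_le_add_of_split (m := -A / (2 * B) + 1 / √|B|) (P := -A / (2 * B))
    (by positivity) (by positivity)
    (fun _ _ _ _ => (continuous_quadPhase A B).intervalIntegrable _ _) ?_ ?_ hp hpq
  · intro p q hp hpq hq
    exact (norm_integral_quadPhase_le_length hpq).trans (by linarith)
  · intro p q _ hm hpq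
    have h24 : 2 / √|B| = 4 / (2 * √|B|) := by field_simp; norm_num
    rw [h24]
    refine norm_integral_quadPhase_le_of_deriv hpq (by positivity) fun ρ hρ => ?_
    have e : A + 2 * B * ρ = 2 * B * (ρ - -A / (2 * B)) := by field_simp; ring
    rw [e, abs_mul, abs_mul, abs_two, mul_assoc]
    refine mul_le_mul_of_nonneg_left ?_ two_pos.le
    have h1 : 1 / √|B| ≤ |ρ - -A / (2 * B)| := (by linarith [hρ.1] : _ ≤ _).trans (le_abs_self _)
    calc √|B| = |B| * (1 / √|B|) := by nth_rw 2 [← hbb]; field_simp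
      _ ≤ _ := mul_le_mul_of_nonneg_left h1 (abs_nonneg B)

/-- Second derivative test: a bound uniform in `A`, from both sides of the stationary point. -/
lemma norm_integral_quadPhase_le {A B : ℝ} (hB : B ≠ 0) {p q : ℝ} (hpq : p ≤ q) :
    ‖∫ ρ in p..q, quadPhase A B ρ‖ ≤ 6 / √|B| := by
  have h6 : 6 / √|B| = 3 / √|B| + 3 / √|B| := by ring
  rw [h6]
  refine norm_integral_le_add_of_split (m := -A / (2 * B)) (P := p)
    (by positivity) (by positivity)
    (fun _ _ _ _ => (continuous_quadPhase A B).intervalIntegrable _ _) ?_ ?_ le_rfl hpq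
  · intro p q _ hpq hq
    -- reflect at the origin
    have e : ∫ ρ in p..q, quadPhase A B ρ = ∫ ρ in (-q)..(-p), quadPhase (-A) B ρ := by
      rw [← intervalIntegral.integral_comp_neg]
      refine intervalIntegral.integral_congr fun ρ _ => ?_
      simp [quadPhase]
    rw [e]
    refine norm_integral_quadPhase_le_right hB ?_ (by linarith)
    have : - -A / (2 * B) = -(-A / (2 * B)) := by ring
    linarith
  · intro p q _ hm hpq
    exact norm_integral_quadPhase_le_right hB hm hpq

/-- A bound for all partial integrals of `f` gives a bound for the integral of `f` against the
decreasing weight `ρ^{-1/2}`. -/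
lemma norm_integral_rpow_mul_le {f : ℝ → ℂ} (hf : Continuous f) {p q M : ℝ} (hp : 0 < p)
    (hpq : p ≤ q) (hM : ∀ x, p ≤ x → x ≤ q → ‖∫ ρ in p..x, f ρ‖ ≤ M) :
    ‖∫ ρ in p..q, ((ρ ^ (-(1 / 2) : ℝ) : ℝ) : ℂ) * f ρ‖ ≤ M * p ^ (-(1 / 2) : ℝ) := by
  have hM0 : 0 ≤ M := (norm_nonneg _).trans (hM p le_rfl hpq)
  have hpos : ∀ ρ ∈ Set.uIcc p q, 0 < ρ := fun ρ hρ => by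
    rw [Set.uIcc_of_le hpq] at hρ; linarith [hρ.1]
  have hd : ∀ ρ ∈ Set.uIcc p q, HasDerivAt (fun ρ : ℝ => ρ ^ (-(1 / 2) : ℝ))
      (-(1 / 2) * ρ ^ (-(1 / 2) - 1 : ℝ)) ρ := fun ρ hρ =>
    Real.hasDerivAt_rpow_const (Or.inl (hpos ρ hρ).ne')
  have hc : ContinuousOn (fun ρ : ℝ => -(1 / 2) * ρ ^ (-(1 / 2) - 1 : ℝ)) (Set.uIcc p q) :=
    continuousOn_const.mul
      (continuousOn_id.rpow_const fun ρ hρ => Or.inl (hpos ρ hρ).ne')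
  have hF : ∀ ρ : ℝ, HasDerivAt (fun x => ∫ ρ in p..x, f ρ) (f ρ) ρ := fun ρ =>
    intervalIntegral.integral_hasDerivAt_right (hf.intervalIntegrable _ _)
      (hf.stronglyMeasurableAtFilter _ _) hf.continuousAt
  have ibp := intervalIntegral.integral_mul_deriv_eq_deriv_mul
    (fun ρ hρ => (hd ρ hρ).ofReal_comp) (fun ρ _ => hF ρ)
    (ContinuousOn.intervalIntegrable (Complex.continuous_ofReal.comp_continuousOn hc))
    (hf.intervalIntegrable p q)
  rw [ibp, intervalIntegral.integral_same, mul_zero, sub_zero]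
  have hftc := intervalIntegral.integral_eq_sub_of_hasDerivAt hd hc.intervalIntegrable
  have h1 : ‖((q ^ (-(1 / 2) : ℝ) : ℝ) : ℂ) * ∫ ρ in p..q, f ρ‖ ≤ M * q ^ (-(1 / 2) : ℝ) := by
    rw [norm_mul, Complex.norm_real, Real.norm_of_nonneg (Real.rpow_nonneg (by linarith) _),
      mul_comm]
    exact mul_le_mul_of_nonneg_right (hM q hpq le_rfl) (Real.rpow_nonneg (by linarith) _)
  have h2 : ‖∫ x in p..q, ((-(1 / 2) * x ^ (-(1 / 2) - 1 : ℝ) : ℝ) : ℂ) * ∫ ρ in p..x, f ρ‖ ≤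
      M * p ^ (-(1 / 2) : ℝ) - M * q ^ (-(1 / 2) : ℝ) := by
    have e : M * p ^ (-(1 / 2) : ℝ) - M * q ^ (-(1 / 2) : ℝ) =
        ∫ x in p..q, -M * (-(1 / 2) * x ^ (-(1 / 2) - 1 : ℝ)) := by
      rw [intervalIntegral.integral_const_mul, hftc]; ring
    rw [e]
    refine intervalIntegral.norm_integral_le_of_norm_le hpq ?_
      ((continuousOn_const.mul hc).intervalIntegrable)
    refine Eventually.of_forall fun x hx => ?_
    have hx0 : 0 < x := by linarith [hx.1]
    have hx1 : 0 ≤ x ^ (-(1 / 2) - 1 : ℝ) := Real.rpow_nonneg hx0.le _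
    rw [norm_mul, Complex.norm_real, Real.norm_eq_abs, abs_mul, abs_of_nonneg hx1, abs_neg,
      abs_of_pos (by norm_num : (0 : ℝ) < 1 / 2)]
    have := mul_le_mul_of_nonneg_left (hM x hx.1.le hx.2)
      (by positivity : 0 ≤ 1 / 2 * x ^ (-(1 / 2) - 1 : ℝ))
    linarith
  exact (norm_sub_le _ _).trans (by linarith)

lemma norm_integral_rpow_mul_quadPhase_le_rpow {A B p q : ℝ} (hp : 0 < p) (hpq : p ≤ q) :
    ‖∫ ρ in p..q, ((ρ ^ (-(1 / 2) : ℝ) : ℝ) : ℂ) * quadPhase A B ρ‖ ≤ 2 * √q := by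
  refine (intervalIntegral.norm_integral_le_integral_norm hpq).trans ?_
  have e : ∫ ρ in p..q, ‖((ρ ^ (-(1 / 2) : ℝ) : ℝ) : ℂ) * quadPhase A B ρ‖ =
      ∫ ρ in p..q, ρ ^ (-(1 / 2) : ℝ) := by
    refine intervalIntegral.integral_congr fun ρ hρ => ?_
    rw [Set.uIcc_of_le hpq] at hρ
    show ‖((ρ ^ (-(1 / 2) : ℝ) : ℝ) : ℂ) * quadPhase A B ρ‖ = ρ ^ (-(1 / 2) : ℝ)
    rw [norm_mul, norm_quadPhase, Complex.norm_real, mul_one,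
      Real.norm_of_nonneg (Real.rpow_nonneg (by linarith [hρ.1]) _)]
  rw [e, integral_rpow (Or.inl (by norm_num))]
  have h12 : (-(1 / 2) + 1 : ℝ) = 1 / 2 := by norm_num
  rw [h12, ← Real.sqrt_eq_rpow, ← Real.sqrt_eq_rpow]
  have := Real.sqrt_nonneg p
  linarith

lemma intervalIntegrable_rpow_mul_quadPhase {A B p q : ℝ} (hp : 0 < p) (hpq : p ≤ q) :
    IntervalIntegrable (fun ρ => ((ρ ^ (-(1 / 2) : ℝ) : ℝ) : ℂ) * quadPhase A B ρ) volume p q := by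
  refine ContinuousOn.intervalIntegrable (ContinuousOn.mul ?_ (continuous_quadPhase A B).continuousOn)
  refine Complex.continuous_ofReal.comp_continuousOn (continuousOn_id.rpow_const fun ρ hρ => ?_)
  rw [Set.uIcc_of_le hpq] at hρ
  exact Or.inl (by simp only [id]; linarith [hρ.1])

lemma rpow_neg_half_le {p m : ℝ} (hm : 0 < m) (h : m ≤ p) : p ^ (-(1 / 2) : ℝ) ≤ 1 / √m := by
  rw [Real.rpow_neg (by linarith), ← Real.sqrt_eq_rpow, ← one_div]
  exact one_div_le_one_div_of_le (Real.sqrt_pos.2 hm) (Real.sqrt_le_sqrt h)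

/-- The second derivative test for the weight `ρ^{-1/2}`, uniformly in the linear coefficient. -/
lemma norm_integral_rpow_mul_quadPhase_le_second {A B p q : ℝ} (hB : B ≠ 0) (hp : 0 < p)
    (hpq : p ≤ q) :
    ‖∫ ρ in p..q, ((ρ ^ (-(1 / 2) : ℝ) : ℝ) : ℂ) * quadPhase A B ρ‖ ≤ 8 / √(√|B|) := by
  have hb : 0 < √|B| := Real.sqrt_pos.2 (abs_pos.2 hB)
  have hb' : 0 < √(√|B|) := Real.sqrt_pos.2 hb
  have hbb : √(√|B|) * √(√|B|) = √|B| := Real.mul_self_sqrt hb.le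
  have e8 : 8 / √(√|B|) = 2 / √(√|B|) + 6 / √(√|B|) := by ring
  rw [e8]
  -- up to `|B|^{-1/2}` the weight alone has integral `2|B|^{-1/4}`
  refine norm_integral_le_add_of_split (m := 1 / √|B|) (P := p) (by positivity) (by positivity)
    (fun r s hr hrs => intervalIntegrable_rpow_mul_quadPhase (by linarith) hrs) ?_ ?_ le_rfl hpq
  · intro r s hr hrs hs
    refine (norm_integral_rpow_mul_quadPhase_le_rpow (by linarith) hrs).trans ?_
    have : √s ≤ 1 / √(√|B|) := by
      have := Real.sqrt_le_sqrt hs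
      rwa [Real.sqrt_div zero_le_one, Real.sqrt_one] at this
    calc 2 * √s ≤ 2 * (1 / √(√|B|)) := by linarith
      _ = _ := by ring
  · intro r s hr hm hrs
    refine (norm_integral_rpow_mul_le (continuous_quadPhase A B) (by linarith) hrs
      fun x hx _ => norm_integral_quadPhase_le hB hx).trans ?_
    have h1 := rpow_neg_half_le (by positivity : 0 < 1 / √|B|) hm
    rw [Real.sqrt_div zero_le_one, Real.sqrt_one, one_div_one_div] at h1
    calc 6 / √|B| * r ^ (-(1 / 2) : ℝ) ≤ 6 / √|B| * √(√|B|) :=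
          mul_le_mul_of_nonneg_left h1 (by positivity)
      _ = _ := by nth_rw 1 [← hbb]; field_simp

/-- The first derivative test for the weight `ρ^{-1/2}`, uniformly in the quadratic coefficient:
near a stationary point the second derivative is at least of the size needed. -/
lemma norm_integral_rpow_mul_quadPhase_le_first {A B p q : ℝ} (hA : A ≠ 0) (hp : 0 < p)
    (hpq : p ≤ q) :
    ‖∫ ρ in p..q, ((ρ ^ (-(1 / 2) : ℝ) : ℝ) : ℂ) * quadPhase A B ρ‖ ≤ 22 / √|A| := by
  have ha0 : 0 < |A| := abs_pos.2 hA
  have ha : 0 < √|A| := Real.sqrt_pos.2 ha0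
  have haa : √|A| * √|A| = |A| := Real.mul_self_sqrt ha0.le
  have hint : ∀ r s, p ≤ r → r ≤ s → IntervalIntegrable
      (fun ρ => ((ρ ^ (-(1 / 2) : ℝ) : ℝ) : ℂ) * quadPhase A B ρ) volume r s :=
    fun r s hr hrs => intervalIntegrable_rpow_mul_quadPhase (by linarith) hrs
  have e22 : 22 / √|A| = 2 / √|A| + 20 / √|A| := by ring
  rw [e22]
  -- up to `|A|⁻¹` the weight alone has integral `2|A|^{-1/2}`
  refine norm_integral_le_add_of_split (m := 1 / |A|) (P := p) (by positivity) (by positivity)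
    hint ?_ ?_ le_rfl hpq
  · intro r s hr hrs hs
    refine (norm_integral_rpow_mul_quadPhase_le_rpow (by linarith) hrs).trans ?_
    have : √s ≤ 1 / √|A| := by
      have := Real.sqrt_le_sqrt hs
      rwa [Real.sqrt_div zero_le_one, Real.sqrt_one] at this
    calc 2 * √s ≤ 2 * (1 / √|A|) := by linarith
      _ = _ := by ring
  · intro r s hr hm hrs
    have h1 := rpow_neg_half_le (by positivity : 0 < 1 / |A|) hm
    rw [Real.sqrt_div zero_le_one, Real.sqrt_one, one_div_one_div] at h1
    -- the part where the derivative of the phase is at least `|A| / 2`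
    have far : ∀ a b, r ≤ a → a ≤ b → 4 * |B| * b ≤ |A| →
        ‖∫ ρ in a..b, ((ρ ^ (-(1 / 2) : ℝ) : ℝ) : ℂ) * quadPhase A B ρ‖ ≤ 8 / √|A| := by
      intro a b hra hab hb
      refine (norm_integral_rpow_mul_le (M := 4 / (|A| / 2)) (continuous_quadPhase A B)
        (by linarith) hab fun x hx hxb => norm_integral_quadPhase_le_of_deriv hx (by positivity)
          fun ρ hρ => ?_).trans ?_
      · have h0 : 0 ≤ ρ := by linarith [hρ.1]
        have h2 : |2 * B * ρ| = 2 * |B| * ρ := by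
          rw [abs_mul, abs_mul, abs_two, abs_of_nonneg h0]
        have h3 : |B| * ρ ≤ |B| * b :=
          mul_le_mul_of_nonneg_left (hρ.2.trans hxb) (abs_nonneg B)
        have h4 := abs_sub_abs_le_abs_sub A (-(2 * B * ρ))
        rw [abs_neg, sub_neg_eq_add, h2] at h4
        linarith
      · have h5 : a ^ (-(1 / 2) : ℝ) ≤ √|A| := by
          refine (Real.rpow_le_rpow_of_nonpos (by linarith) hra (by norm_num)).trans h1
        calc 4 / (|A| / 2) * a ^ (-(1 / 2) : ℝ) ≤ 4 / (|A| / 2) * √|A| :=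
              mul_le_mul_of_nonneg_left h5 (by positivity)
          _ = _ := by nth_rw 1 [← haa]; field_simp; norm_num
    rcases eq_or_ne B 0 with hB | hB
    · refine (far r s le_rfl hrs (by rw [hB]; simp)).trans ?_
      gcongr; norm_num
    have hb0 : 0 < |B| := abs_pos.2 hB
    have hb : 0 < √|B| := Real.sqrt_pos.2 hb0
    have e20 : 20 / √|A| = 8 / √|A| + 12 / √|A| := by ring
    rw [e20]
    -- beyond `|A| / (4|B|)` the weight is at most `2|B|^{1/2}|A|^{-1/2}`, which compensates the
    -- bound `O(|B|^{-1/2})` of the second derivative test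
    refine norm_integral_le_add_of_split (m := |A| / (4 * |B|)) (P := r) (by positivity)
      (by positivity) (fun a b ha hab => hint a b (hr.trans ha) hab) ?_ ?_ le_rfl hrs
    · intro a b hra hab hb'
      rw [le_div_iff₀ (by positivity)] at hb'
      exact far a b hra hab (by linarith)
    · intro a b hra hma hab
      refine (norm_integral_rpow_mul_le (continuous_quadPhase A B) (by linarith) hab
        fun x hx _ => norm_integral_quadPhase_le hB hx).trans ?_
      have h6 := rpow_neg_half_le (by positivity : 0 < |A| / (4 * |B|)) hma
      have h4 : √(4 * |B|) = 2 * √|B| := by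
        rw [Real.sqrt_mul (by norm_num), show (4 : ℝ) = 2 ^ 2 by norm_num,
          Real.sqrt_sq (by norm_num)]
      rw [Real.sqrt_div ha0.le, one_div_div, h4] at h6
      calc 6 / √|B| * a ^ (-(1 / 2) : ℝ) ≤ 6 / √|B| * (2 * √|B| / √|A|) :=
            mul_le_mul_of_nonneg_left h6 (by positivity)
        _ = _ := by field_simp; norm_num

/-- The kernel bound of the `TT*` argument along the curves `s + Cσ` at times `±σ²`. If `Cσ - Cσ'`
does not cancel `D = s - s'`, the linear coefficient is comparable to `D`; otherwise
`|σ² - σ'²| ≥ |σ - σ'|²` bounds the quadratic coefficient below by a multiple of `D²`. -/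
lemma norm_curve_kernel_le {C D a b A B p q : ℝ} (hC : 0 ≤ C) (hD : D ≠ 0) (ha : 0 ≤ a)
    (hb : 0 ≤ b) (hA : |A| = 2 * Real.pi * |D + C * (a - b)|)
    (hB : |B| = 4 * Real.pi ^ 2 * |a ^ 2 - b ^ 2|) (hp : 0 < p) (hpq : p ≤ q) :
    ‖∫ ρ in p..q, ((ρ ^ (-(1 / 2) : ℝ) : ℝ) : ℂ) * quadPhase A B ρ‖ ≤
      (22 + 8 * √(2 * C)) / √|D| := by
  have hD0 : 0 < |D| := abs_pos.2 hD
  have hsD : 0 < √|D| := Real.sqrt_pos.2 hD0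
  have hpi := Real.pi_gt_three
  rw [add_div]
  by_cases h : |D| / 2 ≤ |D + C * (a - b)|
  · have h1 : |D| ≤ |A| := by
      rw [hA]; nlinarith
    have hA0 : A ≠ 0 := abs_pos.1 (by linarith)
    refine (norm_integral_rpow_mul_quadPhase_le_first hA0 hp hpq).trans ?_
    have : 22 / √|A| ≤ 22 / √|D| := by
      gcongr
    have : 0 ≤ 8 * √(2 * C) / √|D| := by positivity
    linarith
  · push Not at h
    have h1 : |D| / 2 < C * |a - b| := by
      have h2 := abs_sub_abs_le_abs_sub D (-(C * (a - b)))
      rw [abs_neg, sub_neg_eq_add, abs_mul, abs_of_nonneg hC] at h2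
      linarith
    have hC0 : 0 < C := by
      rcases hC.eq_or_lt with h0 | h0
      · rw [← h0] at h1; linarith
      · exact h0
    have h3 : (|D| / (2 * C)) ^ 2 ≤ |B| := by
      have h4 : |D| / (2 * C) ≤ |a - b| := by
        rw [div_le_iff₀ (by positivity)]; linarith
      have h5 : |a - b| ≤ a + b := by
        rw [abs_le]; constructor <;> linarith
      have h6 : |a ^ 2 - b ^ 2| = |a - b| * (a + b) := by
        rw [sq_sub_sq, abs_mul, abs_of_nonneg (add_nonneg ha hb), mul_comm]
      have h7 : (|D| / (2 * C)) ^ 2 ≤ |a - b| ^ 2 := by gcongr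
      have h8 : |a - b| ^ 2 ≤ |a - b| * (a + b) := by
        rw [sq]; exact mul_le_mul_of_nonneg_left h5 (abs_nonneg _)
      rw [hB, h6]
      have h9 : 0 ≤ |a - b| * (a + b) := by positivity
      have h10 : 1 ≤ 4 * Real.pi ^ 2 := by nlinarith
      exact (h7.trans h8).trans (le_mul_of_one_le_left h9 h10)
    have hq : 0 < |D| / (2 * C) := by positivity
    have hB0 : B ≠ 0 := abs_pos.1 (lt_of_lt_of_le (by positivity) h3)
    refine (norm_integral_rpow_mul_quadPhase_le_second hB0 hp hpq).trans ?_
    have h4 : |D| / (2 * C) ≤ √|B| := by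
      rw [← Real.sqrt_sq hq.le]; exact Real.sqrt_le_sqrt h3
    have h5 : √|D| / √(2 * C) ≤ √(√|B|) := by
      rw [← Real.sqrt_div (abs_nonneg D)]; exact Real.sqrt_le_sqrt h4
    have h6 : 8 / √(√|B|) ≤ 8 * √(2 * C) / √|D| := by
      have h7 : 0 < √(2 * C) := Real.sqrt_pos.2 (by positivity)
      calc 8 / √(√|B|) ≤ 8 / (√|D| / √(2 * C)) := by gcongr
        _ = _ := by field_simp
    have : 0 ≤ 22 / √|D| := by positivity
    linarith

/-! ### The Fourier transform of the sphere -/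

section Sphere

variable {E : Type*} [NormedAddCommGroup E] [InnerProductSpace ℝ E]

lemma exists_linearIsometryEquiv_apply_eq {x y : E} (h : ‖x‖ = ‖y‖) :
    ∃ A : E ≃ₗᵢ[ℝ] E, A x = y :=
  ⟨_, Submodule.reflection_sub h⟩

lemma abs_inner_le_of_norm_eq_one {θ : E} (v : E) (hθ : ‖θ‖ = 1) :
    |(inner ℝ θ v : ℝ)| ≤ ‖v‖ := by
  have := abs_real_inner_le_norm θ v
  rwa [hθ, one_mul] at this

variable [FiniteDimensional ℝ E] [MeasurableSpace E] [BorelSpace E]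

variable (E) in
/-- A rotation invariant finite measure carried by the unit sphere: the image of Lebesgue measure
on the unit ball under `x ↦ x / ‖x‖`. -/
def unitSphereMeasure : Measure E :=
  (volume.restrict (Metric.ball (0 : E) 1)).map fun x => ‖x‖⁻¹ • x

lemma measurable_normalize : Measurable fun x : E => ‖x‖⁻¹ • x :=
  measurable_norm.inv.smul measurable_id

instance : IsFiniteMeasure (unitSphereMeasure E) := by
  have : IsFiniteMeasure (volume.restrict (Metric.ball (0 : E) 1)) :=
    ⟨by rw [Measure.restrict_apply_univ]; exact measure_ball_lt_top⟩
  unfold unitSphereMeasure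
  infer_instance

lemma ae_norm_eq_one [Nontrivial E] : ∀ᵐ θ ∂(unitSphereMeasure E), ‖θ‖ = 1 := by
  unfold unitSphereMeasure
  rw [ae_map_iff measurable_normalize.aemeasurable
    (measurableSet_eq_fun measurable_norm measurable_const)]
  refine ae_restrict_of_ae ?_
  filter_upwards [Measure.ae_ne volume (0 : E)] with x hx
  rw [norm_smul, norm_inv, norm_norm, inv_mul_cancel₀ (norm_ne_zero_iff.2 hx)]

lemma unitSphereMeasure_univ_ne_zero : (unitSphereMeasure E).real Set.univ ≠ 0 := by
  unfold unitSphereMeasure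
  rw [measureReal_def, Measure.map_apply measurable_normalize MeasurableSet.univ,
    Set.preimage_univ, Measure.restrict_apply_univ]
  exact (ENNReal.toReal_pos (Metric.measure_ball_pos _ _ one_pos).ne'
    measure_ball_lt_top.ne).ne'

lemma measurePreserving_unitSphereMeasure (A : E ≃ₗᵢ[ℝ] E) :
    MeasurePreserving A (unitSphereMeasure E) (unitSphereMeasure E) := by
  refine ⟨A.continuous.measurable, ?_⟩
  have hb : MeasurePreserving A (volume.restrict (Metric.ball (0 : E) 1))
      (volume.restrict (Metric.ball (0 : E) 1)) := by
    have := A.measurePreserving.restrict_preimage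
      (Metric.isOpen_ball (x := (0 : E)) (ε := 1)).measurableSet
    have e : A ⁻¹' Metric.ball (0 : E) 1 = Metric.ball 0 1 := by ext x; simp
    rwa [e] at this
  unfold unitSphereMeasure
  rw [Measure.map_map A.continuous.measurable measurable_normalize]
  nth_rw 2 [← hb.map_eq]
  rw [Measure.map_map measurable_normalize A.continuous.measurable]
  congr 1
  ext x
  simp

/-- The Fourier transform of the rotation invariant measure on the unit sphere, with angular
frequency. It is real since the measure is symmetric, see `integral_exp_inner_unitSphereMeasure`. -/
def sphereCos (x : E) : ℝ := ∫ θ, Real.cos (inner ℝ θ x) ∂(unitSphereMeasure E)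

lemma sphereCos_eq_of_norm_eq {x y : E} (h : ‖x‖ = ‖y‖) : sphereCos x = sphereCos y := by
  obtain ⟨A, rfl⟩ := exists_linearIsometryEquiv_apply_eq h
  unfold sphereCos
  rw [← (measurePreserving_unitSphereMeasure A).integral_comp A.toHomeomorph.measurableEmbedding
    fun θ => Real.cos (inner ℝ θ (A x))]
  simp only [LinearIsometryEquiv.inner_map_map]

/-- Differentiation of `∫ c(θ) h(⟪θ, x⟫) dσ(θ)` in the direction `v`. -/
lemma hasDerivAt_integral_sphere [Nontrivial E] {c : E → ℝ} (hc : Continuous c) {M : ℝ}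
    (hM : ∀ θ, ‖θ‖ = 1 → |c θ| ≤ M) {h h' : ℝ → ℝ} (hh : ∀ t, HasDerivAt h (h' t) t)
    (hb : ∀ t, |h t| ≤ 1) (hb' : ∀ t, |h' t| ≤ 1) (hc' : Continuous h') (x v : E) (y : ℝ) :
    HasDerivAt (fun y : ℝ => ∫ θ, c θ * h (inner ℝ θ (x + y • v)) ∂(unitSphereMeasure E))
      (∫ θ, c θ * inner ℝ θ v * h' (inner ℝ θ (x + y • v)) ∂(unitSphereMeasure E)) y := by
  have hcont : Continuous h := continuous_iff_continuousAt.2 fun t => (hh t).continuousAt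
  refine (hasDerivAt_integral_of_dominated_loc_of_deriv_le (μ := unitSphereMeasure E)
    (F := fun y θ => c θ * h (inner ℝ θ (x + y • v)))
    (F' := fun y θ => c θ * inner ℝ θ v * h' (inner ℝ θ (x + y • v))) (bound := fun _ => M * ‖v‖)
    (Metric.ball_mem_nhds y one_pos) (Eventually.of_forall fun y => ?_) ?_ ?_ ?_
    (integrable_const _) (Eventually.of_forall fun θ y _ => ?_)).2
  · exact Continuous.aestronglyMeasurable (by fun_prop)
  · refine Integrable.of_bound (C := M) (Continuous.aestronglyMeasurable (by fun_prop)) ?_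
    filter_upwards [ae_norm_eq_one] with θ hθ
    rw [Real.norm_eq_abs, abs_mul]
    calc _ ≤ M * 1 := mul_le_mul (hM θ hθ) (hb _) (abs_nonneg _)
          ((abs_nonneg _).trans (hM θ hθ))
      _ = M := mul_one M
  · exact Continuous.aestronglyMeasurable (by fun_prop)
  · filter_upwards [ae_norm_eq_one] with θ hθ y _
    have h0 : 0 ≤ M := (abs_nonneg _).trans (hM θ hθ)
    have h1 := abs_inner_le_of_norm_eq_one v hθ
    rw [Real.norm_eq_abs, abs_mul, abs_mul]
    calc _ ≤ M * ‖v‖ * 1 := mul_le_mul (mul_le_mul (hM θ hθ) h1 (abs_nonneg _) h0) (hb' _)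
          (abs_nonneg _) (by positivity)
      _ = _ := mul_one _
  · have h1 : HasDerivAt (fun y : ℝ => (inner ℝ θ (x + y • v) : ℝ)) (inner ℝ θ v) y := by
      simp only [inner_add_right, inner_smul_right]
      simpa using ((hasDerivAt_id y).mul_const (inner ℝ θ v : ℝ)).const_add (inner ℝ θ x : ℝ)
    have := ((hh _).comp y h1).const_mul (c θ)
    refine this.congr_deriv ?_
    ring

lemma hasDerivAt_integral_cos_sphere [Nontrivial E] {c : E → ℝ} (hc : Continuous c) {M : ℝ}
    (hM : ∀ θ, ‖θ‖ = 1 → |c θ| ≤ M) (x v : E) (y : ℝ) :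
    HasDerivAt (fun y : ℝ => ∫ θ, c θ * Real.cos (inner ℝ θ (x + y • v)) ∂(unitSphereMeasure E))
      (-∫ θ, c θ * inner ℝ θ v * Real.sin (inner ℝ θ (x + y • v)) ∂(unitSphereMeasure E)) y := by
  have := hasDerivAt_integral_sphere hc hM Real.hasDerivAt_cos Real.abs_cos_le_one
    (fun t => by rw [abs_neg]; exact Real.abs_sin_le_one t) (by fun_prop) x v y
  simpa only [mul_neg, integral_neg] using this

lemma hasDerivAt_integral_sin_sphere [Nontrivial E] {c : E → ℝ} (hc : Continuous c) {M : ℝ}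
    (hM : ∀ θ, ‖θ‖ = 1 → |c θ| ≤ M) (x v : E) (y : ℝ) :
    HasDerivAt (fun y : ℝ => ∫ θ, c θ * Real.sin (inner ℝ θ (x + y • v)) ∂(unitSphereMeasure E))
      (∫ θ, c θ * inner ℝ θ v * Real.cos (inner ℝ θ (x + y • v)) ∂(unitSphereMeasure E)) y :=
  hasDerivAt_integral_sphere hc hM Real.hasDerivAt_sin Real.abs_sin_le_one Real.abs_cos_le_one
    Real.continuous_cos x v y

lemma hasDerivAt_sphereCos_line [Nontrivial E] (x v : E) (y : ℝ) :
    HasDerivAt (fun y : ℝ => sphereCos (x + y • v))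
      (-∫ θ, inner ℝ θ v * Real.sin (inner ℝ θ (x + y • v)) ∂(unitSphereMeasure E)) y := by
  have := hasDerivAt_integral_cos_sphere (E := E) (c := fun _ => 1) continuous_const (M := 1)
    (by simp) x v y
  simp only [one_mul] at this
  exact this

lemma hasDerivAt_sphereCos_line_two [Nontrivial E] (x v : E) (y : ℝ) :
    HasDerivAt (fun y : ℝ => -∫ θ, inner ℝ θ v * Real.sin (inner ℝ θ (x + y • v))
        ∂(unitSphereMeasure E))
      (-∫ θ, inner ℝ θ v ^ 2 * Real.cos (inner ℝ θ (x + y • v)) ∂(unitSphereMeasure E)) y := by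
  have := (hasDerivAt_integral_sin_sphere (E := E) (c := fun θ => inner ℝ θ v) (by fun_prop)
    (M := ‖v‖) (fun θ hθ => abs_inner_le_of_norm_eq_one v hθ) x v y).fun_neg
  simp only [← sq] at this
  exact this

/-- The radial profile of `sphereCos`, along the unit vector `e`; a multiple of
`u^{-(n-2)/2} J_{(n-2)/2}(u)` in dimension `n`. -/
def sphereProfile (e : E) (u : ℝ) : ℝ := sphereCos (u • e)

/-- The first derivative of `sphereProfile`. -/
def sphereProfileDeriv (e : E) (u : ℝ) : ℝ :=
  -∫ θ, inner ℝ θ e * Real.sin (inner ℝ θ (u • e)) ∂(unitSphereMeasure E)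

/-- The second derivative of `sphereProfile`. -/
def sphereProfileDeriv₂ (e : E) (u : ℝ) : ℝ :=
  -∫ θ, inner ℝ θ e ^ 2 * Real.cos (inner ℝ θ (u • e)) ∂(unitSphereMeasure E)

lemma sphereCos_eq_sphereProfile {e : E} (he : ‖e‖ = 1) (x : E) :
    sphereCos x = sphereProfile e ‖x‖ :=
  sphereCos_eq_of_norm_eq (by rw [norm_smul, he, norm_norm, mul_one])

lemma hasDerivAt_sphereProfile [Nontrivial E] (e : E) (u : ℝ) :
    HasDerivAt (sphereProfile e) (sphereProfileDeriv e u) u := by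
  have := hasDerivAt_sphereCos_line (0 : E) e u
  simp only [zero_add] at this
  exact this

lemma hasDerivAt_sphereProfileDeriv [Nontrivial E] (e : E) (u : ℝ) :
    HasDerivAt (sphereProfileDeriv e) (sphereProfileDeriv₂ e u) u := by
  have := hasDerivAt_sphereCos_line_two (0 : E) e u
  simp only [zero_add] at this
  exact this

/-- The second derivative of the radial function `sphereCos` in a direction tangent to the
sphere through `u e`, from `sphereCos (u e + y v) = sphereProfile e (√(u² + y²))`. -/
lemma integral_inner_sq_mul_cos_of_orthogonal [Nontrivial E] {e v : E} (he : ‖e‖ = 1)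
    (hv : ‖v‖ = 1) (hev : inner ℝ e v = (0 : ℝ)) {u : ℝ} (hu : 0 < u) :
    ∫ θ, inner ℝ θ v ^ 2 * Real.cos (inner ℝ θ (u • e)) ∂(unitSphereMeasure E) =
      -(sphereProfileDeriv e u / u) := by
  have hpos : ∀ y : ℝ, 0 < u ^ 2 + y ^ 2 := fun y => by positivity
  have hnorm : ∀ y : ℝ, ‖u • e + y • v‖ = √(u ^ 2 + y ^ 2) := fun y => by
    rw [← Real.sqrt_sq (norm_nonneg _), norm_add_sq_real, norm_smul, norm_smul, he, hv,
      inner_smul_left, inner_smul_right, hev]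
    simp
  have hsqrt : ∀ y : ℝ, HasDerivAt (fun y : ℝ => √(u ^ 2 + y ^ 2)) (y / √(u ^ 2 + y ^ 2)) y :=
    fun y => by
      have h1 : HasDerivAt (fun y : ℝ => u ^ 2 + y ^ 2) (2 * y) y := by
        simpa using ((hasDerivAt_id y).pow 2).const_add (u ^ 2)
      refine (h1.sqrt (hpos y).ne').congr_deriv ?_
      rw [mul_div_mul_left _ _ two_ne_zero]
  have h1 : (fun y : ℝ => sphereCos (u • e + y • v)) =
      fun y : ℝ => sphereProfile e (√(u ^ 2 + y ^ 2)) := by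
    ext y
    rw [sphereCos_eq_sphereProfile he, hnorm]
  have h2 : ∀ y : ℝ,
      -∫ θ, inner ℝ θ v * Real.sin (inner ℝ θ (u • e + y • v)) ∂(unitSphereMeasure E) =
      y * (sphereProfileDeriv e (√(u ^ 2 + y ^ 2)) / √(u ^ 2 + y ^ 2)) := fun y => by
    have a := hasDerivAt_sphereCos_line (u • e) v y
    rw [h1] at a
    rw [a.unique ((hasDerivAt_sphereProfile e _).comp y (hsqrt y))]
    ring
  have h3 := hasDerivAt_sphereCos_line_two (u • e) v 0
  rw [funext h2] at h3
  have h4 := (hasDerivAt_id (0 : ℝ)).mul (((hasDerivAt_sphereProfileDeriv e _).comp (0 : ℝ)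
    (hsqrt 0)).div (hsqrt 0) (Real.sqrt_pos.2 (hpos 0)).ne')
  have h5 := h3.unique h4
  simp only [zero_smul, add_zero, id, one_mul, zero_mul, Function.comp, Pi.div_apply, ne_eq, OfNat.ofNat_ne_zero,
    not_false_eq_true, zero_pow, Real.sqrt_sq hu.le] at h5
  linarith

/-- Bessel's equation for the radial profile: the Laplacian of the Fourier transform of a measure
on the unit sphere is its negative. -/
lemma sphereProfileDeriv₂_eq [Nontrivial E] {ι : Type*} [Fintype ι] (b : OrthonormalBasis ι ℝ E)
    (i : ι) {u : ℝ} (hu : 0 < u) :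
    sphereProfileDeriv₂ (b i) u = -sphereProfile (b i) u -
      ((Fintype.card ι : ℝ) - 1) / u * sphereProfileDeriv (b i) u := by
  classical
  have hint : ∀ j, Integrable (fun θ => inner ℝ θ (b j) ^ 2 * Real.cos (inner ℝ θ (u • b i)))
      (unitSphereMeasure E) := fun j => by
    refine Integrable.of_bound (C := 1) (Continuous.aestronglyMeasurable (by fun_prop)) ?_
    filter_upwards [ae_norm_eq_one] with θ hθ
    have h1 := abs_inner_le_of_norm_eq_one (b j) hθ
    rw [b.norm_eq_one] at h1
    rw [Real.norm_eq_abs, abs_mul, abs_pow]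
    calc _ ≤ (1 : ℝ) ^ 2 * 1 := by
          gcongr
          exact Real.abs_cos_le_one _
      _ = 1 := by norm_num
  have h1 : sphereProfile (b i) u = ∑ j, ∫ θ, inner ℝ θ (b j) ^ 2 *
      Real.cos (inner ℝ θ (u • b i)) ∂(unitSphereMeasure E) := by
    rw [← integral_finsetSum _ fun j _ => hint j]
    refine integral_congr_ae ?_
    filter_upwards [ae_norm_eq_one] with θ hθ
    have h2 := b.sum_sq_norm_inner_left θ
    rw [hθ, one_pow] at h2
    rw [← Finset.sum_mul]
    have h3 : ∑ j, (inner ℝ θ (b j) : ℝ) ^ 2 = 1 := by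
      rw [← h2]
      exact Finset.sum_congr rfl fun j _ => by rw [Real.norm_eq_abs, sq_abs]
    rw [h3, one_mul]
  rw [← Finset.add_sum_erase _ _ (Finset.mem_univ i)] at h1
  have h4 : ∀ j ∈ Finset.univ.erase i, ∫ θ, inner ℝ θ (b j) ^ 2 *
      Real.cos (inner ℝ θ (u • b i)) ∂(unitSphereMeasure E) =
      -(sphereProfileDeriv (b i) u / u) := fun j hj =>
    integral_inner_sq_mul_cos_of_orthogonal (b.norm_eq_one i) (b.norm_eq_one j)
      (b.inner_eq_zero (Finset.ne_of_mem_erase hj).symm) hu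
  rw [Finset.sum_congr rfl h4, Finset.sum_const, Finset.card_erase_of_mem (Finset.mem_univ i),
    Finset.card_univ, nsmul_eq_mul, Nat.cast_sub (Fintype.card_pos_iff.2 ⟨i⟩)] at h1
  rw [h1]
  simp only [sphereProfileDeriv₂]
  push_cast
  ring

end Sphere

/-! ### Asymptotics of solutions of Bessel's equation -/

/-- A solution of `K'' + (d/u) K' + K = 0` is `u^{-d/2}` times a plane wave, up to a relative error
`O(1/u)`: `w = u^{d/2} K` solves `w'' + w = q w / u²`, it is bounded by an energy estimate, and
`e^{-iu}(w' + iw)` has derivative `O(u^{-2})`. -/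
lemma exists_asymptotic_of_bessel {d : ℝ} {K K1 K2 : ℝ → ℝ}
    (h1 : ∀ u, 0 < u → HasDerivAt K (K1 u) u) (h2 : ∀ u, 0 < u → HasDerivAt K1 (K2 u) u)
    (hK : ∀ u, 0 < u → K2 u = -K u - d / u * K1 u) :
    ∃ (z : ℂ) (c : ℝ), 0 ≤ c ∧ ∀ u, 1 ≤ u →
      |K u - u ^ (-(d / 2)) * (Complex.exp (u * Complex.I) * z).im| ≤ c * u ^ (-(d / 2) - 1) := by
  set k := d / 2 with hk
  have hd : d = 2 * k := by rw [hk]; ring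
  set q := k * (k - 1) with hq
  set w : ℝ → ℝ := fun u => u ^ k * K u with hw
  set w1 : ℝ → ℝ := fun u => k * u ^ (k - 1) * K u + u ^ k * K1 u with hw1
  have dw : ∀ u, 0 < u → HasDerivAt w (w1 u) u := fun u hu =>
    (Real.hasDerivAt_rpow_const (Or.inl hu.ne')).mul (h1 u hu)
  have dw1 : ∀ u, 0 < u → HasDerivAt w1 (-w u + q * w u / u ^ 2) u := fun u hu => by
    have a := (((Real.hasDerivAt_rpow_const (p := k - 1) (Or.inl hu.ne')).const_mul k).mul
      (h1 u hu)).add ((Real.hasDerivAt_rpow_const (p := k) (Or.inl hu.ne')).mul (h2 u hu))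
    refine a.congr_deriv ?_
    have e1 : u ^ (k - 1) = u ^ k / u := Real.rpow_sub_one hu.ne' k
    have e2 : u ^ (k - 1 - 1) = u ^ k / u / u := by rw [Real.rpow_sub_one hu.ne', e1]
    simp only [hw, hq]
    rw [hK u hu, e2, e1, hd]
    field_simp
    ring
  -- the energy `w² + w'²` is multiplied by `exp(|q|/u)` to become decreasing
  obtain ⟨M, hM0, hM⟩ : ∃ M : ℝ, 0 ≤ M ∧ ∀ u, 1 ≤ u → |w u| ≤ M := by
    set F : ℝ → ℝ := fun u => (w u ^ 2 + w1 u ^ 2) * Real.exp (|q| / u) with hF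
    have dF : ∀ u, 0 < u → HasDerivAt F
        ((2 * w u * w1 u + 2 * w1 u * (-w u + q * w u / u ^ 2)) * Real.exp (|q| / u) +
          (w u ^ 2 + w1 u ^ 2) * (Real.exp (|q| / u) * (-|q| / u ^ 2))) u := fun u hu => by
      have a := ((dw u hu).pow 2).add ((dw1 u hu).pow 2)
      have b : HasDerivAt (fun u : ℝ => |q| / u) (-|q| / u ^ 2) u := by
        have := (hasDerivAt_inv hu.ne').const_mul |q|
        refine this.congr_deriv ?_
        field_simp
      refine (a.mul b.exp).congr_deriv ?_
      simp
    have hanti : AntitoneOn F (Set.Ici 1) := by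
      refine antitoneOn_of_deriv_nonpos (convex_Ici 1)
        (fun u hu => (dF u (by linarith [hu.out])).continuousAt.continuousWithinAt) ?_ ?_
      · intro u hu
        rw [interior_Ici] at hu
        exact (dF u (by linarith [hu.out])).differentiableAt.differentiableWithinAt
      · intro u hu
        rw [interior_Ici] at hu
        have hu0 : 0 < u := by linarith [hu.out]
        rw [(dF u hu0).deriv]
        have e : (2 * w u * w1 u + 2 * w1 u * (-w u + q * w u / u ^ 2)) * Real.exp (|q| / u) +
          (w u ^ 2 + w1 u ^ 2) * (Real.exp (|q| / u) * (-|q| / u ^ 2)) =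
          (q * (2 * w u * w1 u) - |q| * (w u ^ 2 + w1 u ^ 2)) *
            (Real.exp (|q| / u) / u ^ 2) := by
          field_simp; ring
        rw [e]
        refine mul_nonpos_of_nonpos_of_nonneg ?_ (by positivity)
        have h3 : |2 * w u * w1 u| ≤ w u ^ 2 + w1 u ^ 2 := by
          rw [abs_le]; constructor <;> nlinarith [sq_nonneg (w u + w1 u), sq_nonneg (w u - w1 u)]
        have h4 : q * (2 * w u * w1 u) ≤ |q| * |2 * w u * w1 u| := by
          rw [← abs_mul]; exact le_abs_self _
        have := mul_le_mul_of_nonneg_left h3 (abs_nonneg q)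
        linarith
    refine ⟨√(F 1), Real.sqrt_nonneg _, fun u hu => Real.abs_le_sqrt ?_⟩
    have a := hanti (Set.mem_Ici.2 le_rfl) (Set.mem_Ici.2 hu) hu
    refine le_trans ?_ a
    have b : 1 ≤ Real.exp (|q| / u) := Real.one_le_exp (by positivity)
    have c : 0 ≤ w u ^ 2 + w1 u ^ 2 := by positivity
    calc w u ^ 2 ≤ (w u ^ 2 + w1 u ^ 2) * 1 := by nlinarith [sq_nonneg (w1 u)]
      _ ≤ F u := mul_le_mul_of_nonneg_left b c
  -- variation of constants: `A` converges at infinity with rate `O(1/u)`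
  set A : ℝ → ℂ := fun u => Complex.exp (-(u * Complex.I)) * ((w1 u : ℂ) + w u * Complex.I) with hA
  have dA : ∀ u : ℝ, 0 < u → HasDerivAt A (Complex.exp (-(u * Complex.I)) *
      ((q * w u / u ^ 2 : ℝ) : ℂ)) u := fun u hu => by
    have a : HasDerivAt (fun u : ℝ => -((u : ℂ) * Complex.I)) (-Complex.I) u := by
      simpa using ((hasDerivAt_id u).ofReal_comp.mul_const Complex.I).fun_neg
    have b := a.cexp.mul ((dw1 u hu).ofReal_comp.add
      ((dw u hu).ofReal_comp.mul_const Complex.I))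
    refine b.congr_deriv ?_
    simp only [Pi.add_apply]
    push_cast
    linear_combination (-Complex.exp (-(u * Complex.I)) * w u) * Complex.I_sq
  set c := |q| * M with hc
  have hc0 : 0 ≤ c := by positivity
  have hdist : ∀ u v, 1 ≤ u → u ≤ v → ‖A v - A u‖ ≤ c / u - c / v := fun u v hu huv => by
    refine image_norm_le_of_norm_deriv_right_le_deriv_boundary' (f := fun v => A v - A u)
      (f' := fun x => Complex.exp (-(x * Complex.I)) * ((q * w x / x ^ 2 : ℝ) : ℂ))
      (a := u) (b := v) (B := fun v => c / u - c / v) (B' := fun v => c / v ^ 2) ?_ ?_ ?_ ?_ ?_ ?_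
      ⟨huv, le_rfl⟩
    · exact fun x hx => ((dA x (by linarith [hx.1])).continuousAt.sub
        continuousAt_const).continuousWithinAt
    · exact fun x hx => ((dA x (by linarith [hx.1])).sub_const _).hasDerivWithinAt
    · simp
    · have : ∀ x ∈ Set.Icc u v, x ≠ 0 := fun x hx => by linarith [hx.1]
      exact continuousOn_const.sub (continuousOn_const.div continuousOn_id this)
    · intro x hx
      have hx0 : x ≠ 0 := by linarith [hx.1]
      have := ((hasDerivAt_inv hx0).const_mul c).const_sub (c / u)
      refine HasDerivAt.hasDerivWithinAt (this.congr_deriv ?_)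
      field_simp
    · intro x hx
      have hx1 : 1 ≤ x := hu.trans hx.1
      rw [norm_mul, ← neg_mul, ← Complex.ofReal_neg, Complex.norm_exp_ofReal_mul_I, one_mul,
        Complex.norm_real, Real.norm_eq_abs, abs_div, abs_mul, abs_of_nonneg (sq_nonneg x)]
      have := mul_le_mul_of_nonneg_left (hM x hx1) (abs_nonneg q)
      gcongr
  obtain ⟨z, hz⟩ : ∃ z, Tendsto (fun k : ℕ => A (k + 1)) atTop (𝓝 z) := by
    refine cauchySeq_tendsto_of_complete
      (cauchySeq_of_le_tendsto_0' (fun k : ℕ => c / ((k : ℝ) + 1)) ?_ ?_)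
    · intro m k hmk
      have hmk' : (m : ℝ) ≤ k := by exact_mod_cast hmk
      rw [dist_comm, dist_eq_norm]
      refine (hdist _ _ (by linarith [(Nat.cast_nonneg m : (0 : ℝ) ≤ m)])
        (by linarith)).trans ?_
      have : 0 ≤ c / ((k : ℝ) + 1) := by positivity
      linarith
    · exact tendsto_const_nhds.div_atTop
        (tendsto_natCast_atTop_atTop.atTop_add tendsto_const_nhds)
  have hzA : ∀ u, 1 ≤ u → ‖z - A u‖ ≤ c / u := fun u hu => by
    refine le_of_tendsto (hz.sub_const (A u)).norm ?_
    filter_upwards [eventually_ge_atTop ⌈u⌉₊] with k hk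
    have hk' : u ≤ (k : ℝ) + 1 := (Nat.le_ceil u).trans
      ((Nat.cast_le.2 hk).trans (by linarith))
    refine (hdist u _ hu hk').trans ?_
    have : 0 ≤ c / ((k : ℝ) + 1) := by positivity
    linarith
  refine ⟨z, c, hc0, fun u hu => ?_⟩
  have hu0 : 0 < u := by linarith
  have hwA : w u = (Complex.exp (u * Complex.I) * A u).im := by
    rw [hA]
    simp only
    rw [← mul_assoc, ← Complex.exp_add, add_neg_cancel, Complex.exp_zero, one_mul]
    simp
  have hKw : K u = u ^ (-k) * w u := by
    rw [hw]
    simp only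
    rw [← mul_assoc, ← Real.rpow_add hu0, neg_add_cancel, Real.rpow_zero, one_mul]
  rw [hKw, ← mul_sub, hwA, ← Complex.sub_im, ← mul_sub, abs_mul,
    abs_of_nonneg (Real.rpow_nonneg hu0.le _), Real.rpow_sub_one hu0.ne']
  have h3 : |(Complex.exp (u * Complex.I) * (A u - z)).im| ≤ c / u := by
    refine (Complex.abs_im_le_norm _).trans ?_
    rw [norm_mul, Complex.norm_exp_ofReal_mul_I, one_mul, norm_sub_rev]
    exact hzA u hu
  calc u ^ (-k) * |(Complex.exp (u * Complex.I) * (A u - z)).im| ≤ u ^ (-k) * (c / u) :=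
        mul_le_mul_of_nonneg_left h3 (Real.rpow_nonneg hu0.le _)
    _ = _ := by ring

/-! ### The `TT*` argument -/

section TTStar

variable {X Y : Type*} [MeasurableSpace X] [MeasurableSpace Y]
    {μ : Measure X} {ν : Measure Y} [IsFiniteMeasure μ] [IsFiniteMeasure ν]

/-- Schur's test for a nonnegative symmetric kernel. -/
lemma integral_mul_mul_le_of_schur {H : X → X → ℝ} (hsymm : ∀ x x', H x x' = H x' x)
    (hH0 : ∀ x x', 0 ≤ H x x') {B : ℝ} (hHi : Integrable (Function.uncurry H) (μ.prod μ))
    (hB : ∀ᵐ x ∂μ, ∫ x', H x x' ∂μ ≤ B) {φ : X → ℝ} (hφm : AEStronglyMeasurable φ μ) {L : ℝ}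
    (hφ0 : ∀ x, 0 ≤ φ x) (hφ : ∀ x, φ x ≤ L) :
    Integrable (fun p : X × X => φ p.1 * φ p.2 * H p.1 p.2) (μ.prod μ) ∧
      ∫ p, φ p.1 * φ p.2 * H p.1 p.2 ∂(μ.prod μ) ≤ B * ∫ x, φ x ^ 2 ∂μ := by
  have hφ2 : Integrable (fun x => φ x ^ 2) μ :=
    Integrable.of_bound (C := L ^ 2) (hφm.pow 2) (Eventually.of_forall fun x => by
      rw [Real.norm_of_nonneg (by positivity)]
      exact pow_le_pow_left₀ (hφ0 x) (hφ x) 2)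
  have h1 : Integrable (fun p : X × X => φ p.1 ^ 2 * H p.1 p.2) (μ.prod μ) :=
    hHi.bdd_mul (c := L ^ 2) (hφm.comp_fst.pow 2) (Eventually.of_forall fun p => by
      rw [Real.norm_of_nonneg (sq_nonneg _)]
      exact pow_le_pow_left₀ (hφ0 _) (hφ _) 2)
  have h2 : Integrable (fun p : X × X => φ p.2 ^ 2 * H p.1 p.2) (μ.prod μ) :=
    hHi.bdd_mul (c := L ^ 2) (hφm.comp_snd.pow 2) (Eventually.of_forall fun p => by
      rw [Real.norm_of_nonneg (sq_nonneg _)]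
      exact pow_le_pow_left₀ (hφ0 _) (hφ _) 2)
  have h3 : Integrable (fun p : X × X => φ p.1 * φ p.2 * H p.1 p.2) (μ.prod μ) :=
    hHi.bdd_mul (c := L * L) (hφm.comp_fst.mul hφm.comp_snd) (Eventually.of_forall fun p => by
      rw [Real.norm_of_nonneg (mul_nonneg (hφ0 _) (hφ0 _))]
      exact mul_le_mul (hφ _) (hφ _) (hφ0 _) ((hφ0 p.1).trans (hφ _)))
  refine ⟨h3, ?_⟩
  have e2 : ∫ p : X × X, φ p.2 ^ 2 * H p.1 p.2 ∂(μ.prod μ) =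
      ∫ p : X × X, φ p.1 ^ 2 * H p.1 p.2 ∂(μ.prod μ) := by
    rw [← integral_prod_swap]
    simp only [Prod.fst_swap, Prod.snd_swap]
    refine integral_congr_ae (Eventually.of_forall fun p => ?_)
    show φ p.1 ^ 2 * H p.2 p.1 = φ p.1 ^ 2 * H p.1 p.2
    rw [hsymm p.2 p.1]
  have e1 : ∫ p : X × X, φ p.1 ^ 2 * H p.1 p.2 ∂(μ.prod μ) ≤ B * ∫ x, φ x ^ 2 ∂μ := by
    rw [integral_prod _ h1, ← integral_const_mul]
    refine integral_mono_ae h1.integral_prod_left (hφ2.const_mul B) ?_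
    filter_upwards [hB] with x hx
    rw [integral_const_mul, mul_comm]
    exact mul_le_mul_of_nonneg_right hx (sq_nonneg _)
  calc ∫ p, φ p.1 * φ p.2 * H p.1 p.2 ∂(μ.prod μ)
      ≤ ∫ p : X × X, (1 / 2 * (φ p.1 ^ 2 * H p.1 p.2) + 1 / 2 * (φ p.2 ^ 2 * H p.1 p.2))
        ∂(μ.prod μ) := by
        refine integral_mono h3 ((h1.const_mul _).add (h2.const_mul _)) fun p => ?_
        simp only
        have := mul_le_mul_of_nonneg_right (two_mul_le_add_sq (φ p.1) (φ p.2)) (hH0 p.1 p.2)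
        linarith
    _ = ∫ p : X × X, φ p.1 ^ 2 * H p.1 p.2 ∂(μ.prod μ) := by
        rw [integral_add (h1.const_mul _) (h2.const_mul _), integral_const_mul,
          integral_const_mul, e2]
        ring
    _ ≤ _ := e1

/-- The `TT*` method with Schur's test: an integral operator with bounded kernel `k` on finite
measure spaces is bounded on `L²` by the square root of the Schur bound of `k k*`. -/
lemma integral_sq_norm_integral_mul_le {k : X → Y → ℂ}
    (hk : Measurable (Function.uncurry k)) {M : ℝ} (hM0 : 0 ≤ M) (hM : ∀ x y, ‖k x y‖ ≤ M)
    {H : X → X → ℝ} (hsymm : ∀ x x', H x x' = H x' x)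
    (hH0 : ∀ x x', 0 ≤ H x x') {B : ℝ}
    (hB0 : 0 < B) (hHi : Integrable (Function.uncurry H) (μ.prod μ))
    (hB : ∀ᵐ x ∂μ, ∫ x', H x x' ∂μ ≤ B)
    (hH : ∀ᵐ p ∂(μ.prod μ), ‖∫ y, k p.1 y * (starRingEnd ℂ) (k p.2 y) ∂ν‖ ≤ H p.1 p.2)
    {g : Y → ℂ} (hg : MemLp g 2 ν) :
    Integrable (fun x => ‖∫ y, k x y * g y ∂ν‖ ^ 2) μ ∧
      ∫ x, ‖∫ y, k x y * g y ∂ν‖ ^ 2 ∂μ ≤ B * ∫ y, ‖g y‖ ^ 2 ∂ν := by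
  have hg1 : Integrable g ν := hg.integrable (by norm_num)
  set Φ : X → ℂ := fun x => ∫ y, k x y * g y ∂ν with hΦ
  set L := ∫ y, M * ‖g y‖ ∂ν with hL
  have hL0 : 0 ≤ L := integral_nonneg fun y => by positivity
  have hΦb : ∀ x, ‖Φ x‖ ≤ L := fun x =>
    norm_integral_le_of_norm_le (hg1.norm.const_mul M) (Eventually.of_forall fun y => by
      rw [norm_mul]; exact mul_le_mul_of_nonneg_right (hM x y) (norm_nonneg _))
  have hkg : AEStronglyMeasurable (fun p : X × Y => k p.1 p.2 * g p.2) (μ.prod ν) :=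
    hk.aestronglyMeasurable.mul hg1.aestronglyMeasurable.comp_snd
  have hΦm : AEStronglyMeasurable Φ μ := hkg.integral_prod_right'
  have hΦc : AEStronglyMeasurable (fun x => (starRingEnd ℂ) (Φ x)) μ :=
    Complex.continuous_conj.comp_aestronglyMeasurable hΦm
  have hcΦ : ∀ x, ‖(starRingEnd ℂ) (Φ x)‖ ≤ L := fun x => by
    rw [RCLike.norm_conj]; exact hΦb x
  have hΦ2 : Integrable (fun x => ‖Φ x‖ ^ 2) μ :=
    Integrable.of_bound (C := L ^ 2) (hΦm.norm.pow 2) (Eventually.of_forall fun x => by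
      rw [Real.norm_of_nonneg (by positivity)]
      exact pow_le_pow_left₀ (norm_nonneg _) (hΦb x) 2)
  refine ⟨hΦ2, ?_⟩
  set W : Y → ℂ := fun y => ∫ x, (starRingEnd ℂ) (Φ x) * k x y ∂μ with hW
  set N := ∫ x, ‖Φ x‖ ^ 2 ∂μ with hN
  have hkx : ∀ y, Measurable fun x => k x y := fun y => hk.comp (measurable_id.prodMk measurable_const)
  have hWb : ∀ y, ‖W y‖ ≤ L * M * μ.real Set.univ := fun y => by
    refine norm_integral_le_of_norm_le_const (Eventually.of_forall fun x => ?_)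
    rw [norm_mul]
    exact mul_le_mul (hcΦ x) (hM x y) (norm_nonneg _) hL0
  have hWm : AEStronglyMeasurable W ν :=
    ((hΦc.comp_fst (ν := ν)).mul hk.aestronglyMeasurable).prod_swap.integral_prod_right'
  have hW2 : Integrable (fun y => ‖W y‖ ^ 2) ν :=
    Integrable.of_bound (C := (L * M * μ.real Set.univ) ^ 2) (hWm.norm.pow 2)
      (Eventually.of_forall fun x => by
        rw [Real.norm_of_nonneg (by positivity)]
        exact pow_le_pow_left₀ (norm_nonneg _) (hWb x) 2)
  have hg2 : Integrable (fun y => ‖g y‖ ^ 2) ν := hg.integrable_norm_pow (by norm_num)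
  have hWg : Integrable (fun y => W y * g y) ν :=
    hg1.bdd_mul hWm (Eventually.of_forall hWb)
  -- duality: `W` is the conjugate of the adjoint operator applied to `Φ = Tg`
  have step1 : (N : ℂ) = ∫ y, W y * g y ∂ν := by
    have hint : Integrable (Function.uncurry fun x y => (starRingEnd ℂ) (Φ x) * (k x y * g y))
        (μ.prod ν) := by
      refine ((hg1.norm.comp_snd μ).const_mul (L * M)).mono' (hΦc.comp_fst.mul hkg)
        (Eventually.of_forall fun p => ?_)
      simp only [Function.uncurry]
      rw [norm_mul, norm_mul, mul_assoc]
      exact mul_le_mul (hcΦ _) (mul_le_mul_of_nonneg_right (hM _ _) (norm_nonneg _))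
        (by positivity) hL0
    calc (N : ℂ) = ∫ x, (starRingEnd ℂ) (Φ x) * Φ x ∂μ := by
          rw [hN, ← integral_complex_ofReal]
          refine integral_congr_ae (Eventually.of_forall fun x => ?_)
          simp only
          rw [mul_comm, Complex.mul_conj, Complex.normSq_eq_norm_sq]
      _ = ∫ x, ∫ y, (starRingEnd ℂ) (Φ x) * (k x y * g y) ∂ν ∂μ := by
          simp_rw [integral_const_mul]; rfl
      _ = ∫ y, ∫ x, (starRingEnd ℂ) (Φ x) * (k x y * g y) ∂μ ∂ν := integral_integral_swap hint
      _ = _ := by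
          refine integral_congr_ae (Eventually.of_forall fun y => ?_)
          simp only [hW]
          rw [← integral_mul_const]
          simp only [mul_assoc]
  -- the norm of the adjoint, by Schur's test for `TT*`
  have step2 : ∫ y, ‖W y‖ ^ 2 ∂ν ≤ B * N := by
    obtain ⟨hI, hle⟩ := integral_mul_mul_le_of_schur hsymm hH0 hHi hB hΦm.norm
      (fun x => norm_nonneg (Φ x)) hΦb
    set F : X × X → Y → ℂ := fun p y => ((starRingEnd ℂ) (Φ p.1) * k p.1 y) *
      (Φ p.2 * (starRingEnd ℂ) (k p.2 y)) with hF
    have hk1 : Measurable fun q : (X × X) × Y => k q.1.1 q.2 :=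
      hk.comp (measurable_fst.fst.prodMk measurable_snd)
    have hk2 : Measurable fun q : (X × X) × Y => k q.1.2 q.2 :=
      hk.comp (measurable_fst.snd.prodMk measurable_snd)
    have hFi : Integrable (Function.uncurry F) ((μ.prod μ).prod ν) := by
      refine Integrable.of_bound (C := (L * M) * (L * M)) ?_ (Eventually.of_forall fun q => ?_)
      · exact ((hΦc.comp_fst.comp_fst).mul hk1.aestronglyMeasurable).mul
          ((hΦm.comp_snd.comp_fst).mul
            (Complex.continuous_conj.comp_aestronglyMeasurable hk2.aestronglyMeasurable))
      · simp only [Function.uncurry, hF]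
        rw [norm_mul, norm_mul, norm_mul, RCLike.norm_conj (k _ _)]
        have a := mul_le_mul (hcΦ q.1.1) (hM q.1.1 q.2) (norm_nonneg _) hL0
        have b := mul_le_mul (hΦb q.1.2) (hM q.1.2 q.2) (norm_nonneg _) hL0
        exact mul_le_mul a b (by positivity) (by positivity)
    have e : ((∫ y, ‖W y‖ ^ 2 ∂ν : ℝ) : ℂ) = ∫ p, ∫ y, F p y ∂ν ∂(μ.prod μ) := by
      rw [integral_integral_swap hFi, ← integral_complex_ofReal]
      refine integral_congr_ae (Eventually.of_forall fun y => ?_)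
      simp only [hF]
      rw [integral_prod_mul (fun x => (starRingEnd ℂ) (Φ x) * k x y)
        (fun x => Φ x * (starRingEnd ℂ) (k x y))]
      have e3 : ∫ x, Φ x * (starRingEnd ℂ) (k x y) ∂μ = (starRingEnd ℂ) (W y) := by
        rw [hW, ← integral_conj]
        refine integral_congr_ae (Eventually.of_forall fun x => ?_)
        simp
      rw [e3, Complex.mul_conj, Complex.normSq_eq_norm_sq]
    have e4 : ∫ y, ‖W y‖ ^ 2 ∂ν = ‖∫ p, ∫ y, F p y ∂ν ∂(μ.prod μ)‖ := by
      rw [← e, Complex.norm_real, Real.norm_of_nonneg (integral_nonneg fun y => sq_nonneg _)]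
    rw [e4]
    refine (norm_integral_le_of_norm_le hI ?_).trans hle
    filter_upwards [hH] with p hp
    have e5 : ∫ y, F p y ∂ν = ((starRingEnd ℂ) (Φ p.1) * Φ p.2) *
        ∫ y, k p.1 y * (starRingEnd ℂ) (k p.2 y) ∂ν := by
      rw [← integral_const_mul]
      refine integral_congr_ae (Eventually.of_forall fun y => ?_)
      simp only [hF]; ring
    rw [e5, norm_mul, norm_mul, RCLike.norm_conj]
    exact mul_le_mul_of_nonneg_left hp (by positivity)
  -- Young's inequality with the weight for which the adjoint contributes `N / 2`
  have step3 : N ≤ ∫ y, (1 / (2 * B) * ‖W y‖ ^ 2 + B / 2 * ‖g y‖ ^ 2) ∂ν := by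
    have hN0 : 0 ≤ N := integral_nonneg fun x => by positivity
    have : N = ‖∫ y, W y * g y ∂ν‖ := by
      rw [← step1, Complex.norm_real, Real.norm_of_nonneg hN0]
    rw [this]
    refine norm_integral_le_of_norm_le ((hW2.const_mul _).add (hg2.const_mul _))
      (Eventually.of_forall fun y => ?_)
    rw [norm_mul]
    have h := two_mul_le_add_sq ‖W y‖ (B * ‖g y‖)
    have h1 : ‖W y‖ * ‖g y‖ = 1 / (2 * B) * (2 * ‖W y‖ * (B * ‖g y‖)) := by field_simp
    have h2 : 1 / (2 * B) * ‖W y‖ ^ 2 + B / 2 * ‖g y‖ ^ 2 =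
        1 / (2 * B) * (‖W y‖ ^ 2 + (B * ‖g y‖) ^ 2) := by field_simp
    rw [h1, h2]
    exact mul_le_mul_of_nonneg_left h (by positivity)
  rw [integral_add (hW2.const_mul _) (hg2.const_mul _), integral_const_mul,
    integral_const_mul] at step3
  have h4 : 1 / (2 * B) * ∫ y, ‖W y‖ ^ 2 ∂ν ≤ 1 / (2 * B) * (B * N) :=
    mul_le_mul_of_nonneg_left step2 (by positivity)
  have h5 : 1 / (2 * B) * (B * N) = N / 2 := by field_simp
  linarith

end TTStar

/-! ### Maximal estimates along measurable selections -/

/-- The kernel `c |u|^{-1/2}`, cut off at `|u| ≤ l`. -/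
def fracKernel (c l u : ℝ) : ℝ := if |u| ≤ l then c / √|u| else 0

lemma fracKernel_nonneg {c : ℝ} (hc : 0 ≤ c) (l u : ℝ) : 0 ≤ fracKernel c l u := by
  unfold fracKernel; split_ifs <;> positivity

lemma integrable_fracKernel (c l : ℝ) : Integrable (fracKernel c l) := by
  set F : ℝ → ℝ := fun y => if y ≤ l then c / √y else 0 with hF
  have e : fracKernel c l = fun u : ℝ => F ‖u‖ := by
    ext u; simp [fracKernel, hF, Real.norm_eq_abs]
  rw [e, integrable_fun_norm_addHaar]
  simp only [Module.finrank_self, Nat.sub_self, pow_zero, one_smul]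
  have h1 : IntegrableOn (fun y : ℝ => c * y ^ (-(1 / 2) : ℝ)) (Set.Ioc 0 (max l 0)) := by
    have := (intervalIntegral.intervalIntegrable_rpow' (a := 0) (b := max l 0)
      (r := -(1 / 2)) (by norm_num)).const_mul c
    rwa [intervalIntegrable_iff_integrableOn_Ioc_of_le (le_max_right _ _)] at this
  have h2 : IntegrableOn F (Set.Ioc 0 (max l 0)) := by
    rcases le_total l 0 with hl | hl
    · rw [max_eq_right hl]; simp
    refine h1.congr_fun (fun y hy => ?_) measurableSet_Ioc
    rw [max_eq_left hl] at hy
    simp only [hF, hy.2, if_true]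
    rw [Real.rpow_neg hy.1.le, ← Real.sqrt_eq_rpow]; rfl
  have h3 : IntegrableOn F (Set.Ioi (max l 0)) := by
    refine IntegrableOn.congr_fun (f := fun _ => (0 : ℝ)) integrableOn_zero (fun y hy => ?_)
      measurableSet_Ioi
    have : ¬ y ≤ l := not_le.2 (lt_of_le_of_lt (le_max_left _ _) hy)
    simp [hF, this]
  rw [← Set.Ioc_union_Ioi_eq_Ioi (le_max_right l 0)]
  exact h2.union h3

section Selection

variable {E : Type*} [NormedAddCommGroup E]

variable (E) in
/-- The frequency annulus `N < ‖ξ‖ ≤ R`. -/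
def annulus (N R : ℝ) : Set E := {ξ | N < ‖ξ‖ ∧ ‖ξ‖ ≤ R}

lemma annulus_subset_closedBall (N R : ℝ) : annulus E N R ⊆ Metric.closedBall 0 R :=
  fun ξ hξ => by simpa using hξ.2

lemma measurableSet_annulus [MeasurableSpace E] [BorelSpace E] (N R : ℝ) :
    MeasurableSet (annulus E N R) :=
  (measurableSet_lt measurable_const measurable_norm).inter
    (measurableSet_le measurable_norm measurable_const)

variable [InnerProductSpace ℝ E] [FiniteDimensional ℝ E] [MeasurableSpace E] [BorelSpace E]

lemma volume_annulus_lt_top (N R : ℝ) : volume (annulus E N R) < ⊤ :=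
  (measure_mono (annulus_subset_closedBall N R)).trans_lt measure_closedBall_lt_top

/-- Polar coordinates for the kernel of `TT*`: the Jacobian turns the weight into `ρ^{-1/2}`. -/
lemma norm_integral_annulus_quadPhase_le [Nontrivial E] {C D a b A B N R : ℝ} (hN : 0 < N)
    (hC : 0 ≤ C) (hD : D ≠ 0) (ha : 0 ≤ a)
    (hb : 0 ≤ b) (hA : |A| = 2 * Real.pi * |D + C * (a - b)|)
    (hB : |B| = 4 * Real.pi ^ 2 * |a ^ 2 - b ^ 2|) :
    ‖∫ ξ in annulus E N R, ((‖ξ‖ ^ (-((Module.finrank ℝ E : ℝ) - 1 / 2)) : ℝ) : ℂ) *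
      quadPhase A B ‖ξ‖‖ ≤
      Module.finrank ℝ E * volume.real (Metric.ball (0 : E) 1) * (22 + 8 * √(2 * C)) / √|D| := by
  set n := Module.finrank ℝ E with hn
  have hn0 : 0 < n := Module.finrank_pos
  set f : ℝ → ℂ := (Set.Ioc N R).indicator fun ρ =>
    ((ρ ^ (-((n : ℝ) - 1 / 2)) : ℝ) : ℂ) * quadPhase A B ρ with hf
  have e1 : ∫ ξ in annulus E N R, ((‖ξ‖ ^ (-((n : ℝ) - 1 / 2)) : ℝ) : ℂ) *
      quadPhase A B ‖ξ‖ = ∫ ξ : E, f ‖ξ‖ := by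
    rw [← integral_indicator (measurableSet_annulus N R)]
    refine integral_congr_ae (Eventually.of_forall fun ξ => ?_)
    simp only [hf]
    by_cases hc : N < ‖ξ‖ ∧ ‖ξ‖ ≤ R
    · rw [Set.indicator_of_mem (show ξ ∈ annulus E N R from hc),
        Set.indicator_of_mem (show ‖ξ‖ ∈ Set.Ioc N R from hc)]
    · rw [Set.indicator_of_notMem (show ξ ∉ annulus E N R from hc),
        Set.indicator_of_notMem (show ‖ξ‖ ∉ Set.Ioc N R from hc)]
  have e2 : ∫ y in Set.Ioi (0 : ℝ), y ^ (n - 1) • f y = ∫ ρ in Set.Ioc N R,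
      ((ρ ^ (-(1 / 2) : ℝ) : ℝ) : ℂ) * quadPhase A B ρ := by
    rw [← integral_indicator measurableSet_Ioi, ← integral_indicator measurableSet_Ioc]
    refine integral_congr_ae (Eventually.of_forall fun y => ?_)
    by_cases hy : y ∈ Set.Ioc N R
    · have hy0 : 0 < y := hN.trans hy.1
      simp only [hf, Set.indicator_of_mem hy, Set.indicator_of_mem (Set.mem_Ioi.2 hy0)]
      rw [Complex.real_smul, ← mul_assoc, ← Complex.ofReal_mul, ← Real.rpow_natCast,
        ← Real.rpow_add hy0, Nat.cast_sub (by omega)]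
      congr 3; push_cast; ring
    · have hfy : f y = 0 := Set.indicator_of_notMem hy _
      rw [Set.indicator_of_notMem hy]
      simp only [Set.indicator, hfy, smul_zero, ite_self]
  rw [e1, integral_fun_norm_addHaar, ← hn, e2, nsmul_eq_mul, norm_mul, norm_smul,
    Real.norm_of_nonneg measureReal_nonneg, Complex.norm_natCast]
  have hK : ‖∫ ρ in Set.Ioc N R, ((ρ ^ (-(1 / 2) : ℝ) : ℝ) : ℂ) * quadPhase A B ρ‖ ≤
      (22 + 8 * √(2 * C)) / √|D| := by
    rcases le_total N R with h | h
    · rw [← intervalIntegral.integral_of_le h]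
      exact norm_curve_kernel_le hC hD ha hb hA hB hN h
    · rw [Set.Ioc_eq_empty (not_lt.2 h)]
      simp only [setIntegral_empty, norm_zero]
      positivity
  calc _ ≤ (n : ℝ) * (volume.real (Metric.ball (0 : E) 1) * ((22 + 8 * √(2 * C)) / √|D|)) := by
        gcongr
    _ = _ := by ring

/-- The maximal estimate for one of the two oscillating parts of the radial Schrödinger
propagator: the radius `R` and the time `εσ²` are measurable functions of the position `s`. -/
lemma exists_integral_sq_selection_le [Nontrivial E] {C : ℝ} (hC : 0 ≤ C) (a b : ℝ) :
    ∃ c : ℝ, 0 ≤ c ∧ ∀ (N Rmax : ℝ) (R σ : ℝ → ℝ) (η ε : ℝ) (g : E → ℂ), 0 < N → |η| = 1 →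
      |ε| = 1 → Measurable R → Measurable σ → (∀ s, R s ≤ Rmax) → (∀ s, 0 ≤ σ s) →
      MemLp (fun ξ => ((‖ξ‖ ^ (1 / 4 : ℝ) : ℝ) : ℂ) * g ξ) 2 (volume.restrict (annulus E N Rmax)) →
      IntegrableOn (fun s => ‖∫ ξ in annulus E N (R s),
        ((‖ξ‖ ^ (-(((Module.finrank ℝ E : ℝ) - 1) / 2)) : ℝ) : ℂ) *
        quadPhase (η * (2 * Real.pi * (s + C * σ s))) (ε * (4 * Real.pi ^ 2 * σ s ^ 2)) ‖ξ‖ *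
        g ξ‖ ^ 2) (Set.Icc a b) ∧
      ∫ s in Set.Icc a b, ‖∫ ξ in annulus E N (R s),
        ((‖ξ‖ ^ (-(((Module.finrank ℝ E : ℝ) - 1) / 2)) : ℝ) : ℂ) *
        quadPhase (η * (2 * Real.pi * (s + C * σ s))) (ε * (4 * Real.pi ^ 2 * σ s ^ 2)) ‖ξ‖ *
        g ξ‖ ^ 2
      ≤ c * ∫ ξ in annulus E N Rmax, ‖((‖ξ‖ ^ (1 / 4 : ℝ) : ℝ) : ℂ) * g ξ‖ ^ 2 := by
  set n := Module.finrank ℝ E with hn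
  set c₀ := (n : ℝ) * volume.real (Metric.ball (0 : E) 1) * (22 + 8 * √(2 * C)) with hc₀
  have hc₀0 : 0 ≤ c₀ := by positivity
  set h := fracKernel c₀ (b - a) with hh
  have hhi : Integrable h := integrable_fracKernel _ _
  have hh0 : ∀ u, 0 ≤ h u := fracKernel_nonneg hc₀0 _
  have hI0 : 0 ≤ ∫ u, h u := integral_nonneg hh0
  -- Schur's test needs a positive bound, also when `h` vanishes
  refine ⟨(∫ u, h u) + 1, by positivity, ?_⟩
  intro N Rmax R σ η ε g hN hη hε hR hσ hRm hσ0 hg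
  have hfin : IsFiniteMeasure (volume.restrict (annulus E N Rmax)) :=
    ⟨by rw [Measure.restrict_apply_univ]; exact volume_annulus_lt_top N Rmax⟩
  -- a factor `‖ξ‖^{1/4}` of the amplitude is put on `g`, so that `‖ξ‖^δ` remains in the kernel
  set δ := -(((n : ℝ) - 1) / 2) - 1 / 4 with hδ
  have hδ0 : δ ≤ 0 := by
    have : (1 : ℝ) ≤ n := by exact_mod_cast (Module.finrank_pos : 0 < Module.finrank ℝ E)
    rw [hδ]; linarith
  set Q : ℝ → E → ℂ := fun s ξ => quadPhase (η * (2 * Real.pi * (s + C * σ s)))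
    (ε * (4 * Real.pi ^ 2 * σ s ^ 2)) ‖ξ‖ with hQ
  set k : ℝ → E → ℂ := fun s ξ => if N < ‖ξ‖ ∧ ‖ξ‖ ≤ R s then ((‖ξ‖ ^ δ : ℝ) : ℂ) * Q s ξ else 0
    with hk
  have hkm : Measurable (Function.uncurry k) := by
    refine Measurable.ite ?_ ?_ measurable_const
    · exact (measurableSet_lt measurable_const measurable_snd.norm).inter
        (measurableSet_le measurable_snd.norm (hR.comp measurable_fst))
    · simp only [hQ, quadPhase]
      fun_prop
  have hkM : ∀ s ξ, ‖k s ξ‖ ≤ N ^ δ := fun s ξ => by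
    simp only [hk]
    split_ifs with hc
    · rw [norm_mul, hQ, norm_quadPhase, mul_one, Complex.norm_real,
        Real.norm_of_nonneg (Real.rpow_nonneg (norm_nonneg _) _)]
      exact Real.rpow_le_rpow_of_nonpos hN hc.1.le hδ0
    · rw [norm_zero]; exact Real.rpow_nonneg hN.le _
  have hprod : Integrable (Function.uncurry fun x x' : ℝ => h (x - x'))
      ((volume.restrict (Set.Icc a b)).prod (volume.restrict (Set.Icc a b))) := by
    have hm : AEStronglyMeasurable (Function.uncurry fun x x' : ℝ => h (x - x'))
        ((volume.restrict (Set.Icc a b)).prod (volume.restrict (Set.Icc a b))) := by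
      have : Measurable h := by
        rw [hh]; unfold fracKernel
        exact Measurable.ite (measurableSet_le measurable_norm measurable_const)
          (by fun_prop) measurable_const
      exact (this.comp (measurable_fst.sub measurable_snd)).aestronglyMeasurable
    rw [integrable_prod_iff hm]
    refine ⟨Eventually.of_forall fun x => (hhi.comp_sub_left x).restrict, ?_⟩
    refine Integrable.of_bound (C := ∫ u, h u) hm.norm.integral_prod_right'
      (Eventually.of_forall fun x => ?_)
    rw [Real.norm_of_nonneg (integral_nonneg fun _ => norm_nonneg _)]
    simp only [Function.uncurry, Real.norm_of_nonneg (hh0 _)]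
    rw [← integral_sub_left_eq_self h volume x]
    exact setIntegral_le_integral (hhi.comp_sub_left x) (Eventually.of_forall fun _ => hh0 _)
  have key := integral_sq_norm_integral_mul_le (μ := volume.restrict (Set.Icc a b))
    (ν := volume.restrict (annulus E N Rmax)) hkm (Real.rpow_nonneg hN.le δ) hkM
    (H := fun x x' => h (x - x')) (B := (∫ u, h u) + 1) (fun x x' => by
      simp only [hh, fracKernel, abs_sub_comm]) (fun _ _ => hh0 _) (by positivity) hprod ?_ ?_ hg
  · have e : (fun s => ‖∫ ξ in annulus E N (R s), ((‖ξ‖ ^ (-(((n : ℝ) - 1) / 2)) : ℝ) : ℂ) *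
        quadPhase (η * (2 * Real.pi * (s + C * σ s))) (ε * (4 * Real.pi ^ 2 * σ s ^ 2)) ‖ξ‖ *
        g ξ‖ ^ 2) = fun s => ‖∫ ξ in annulus E N Rmax,
          k s ξ * (((‖ξ‖ ^ (1 / 4 : ℝ) : ℝ) : ℂ) * g ξ)‖ ^ 2 := ?_
    · rw [e]; exact key
    ext s
    congr 2
    have hsub : annulus E N (R s) ⊆ annulus E N Rmax := fun ξ hξ => ⟨hξ.1, hξ.2.trans (hRm s)⟩
    rw [← Set.inter_eq_self_of_subset_right hsub, ← setIntegral_indicator (measurableSet_annulus _ _)]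
    refine setIntegral_congr_fun (measurableSet_annulus _ _) fun ξ hξ => ?_
    have hξ0 : 0 < ‖ξ‖ := hN.trans hξ.1
    by_cases hc : ξ ∈ annulus E N (R s)
    · have hc' : N < ‖ξ‖ ∧ ‖ξ‖ ≤ R s := hc
      simp only [hk, Set.indicator_of_mem hc, if_pos hc', hQ]
      have : ‖ξ‖ ^ (-(((n : ℝ) - 1) / 2)) = ‖ξ‖ ^ δ * ‖ξ‖ ^ (1 / 4 : ℝ) := by
        rw [← Real.rpow_add hξ0, hδ]; congr 1; ring
      rw [this]; push_cast; ring
    · have hc' : ¬ (N < ‖ξ‖ ∧ ‖ξ‖ ≤ R s) := hc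
      simp only [hk, Set.indicator_of_notMem hc, if_neg hc', zero_mul]
  · refine Eventually.of_forall fun x => ?_
    have : ∫ x' in Set.Icc a b, h (x - x') ≤ ∫ u, h u := by
      rw [← integral_sub_left_eq_self h volume x]
      exact setIntegral_le_integral (hhi.comp_sub_left x) (Eventually.of_forall fun _ => hh0 _)
    linarith
  · -- the kernel of `TT*` off the diagonal
    have hne : ∀ᵐ p : ℝ × ℝ ∂((volume.restrict (Set.Icc a b)).prod
        (volume.restrict (Set.Icc a b))), p.1 ≠ p.2 := by
      refine (Measure.ae_prod_iff_ae_ae (p := fun p : ℝ × ℝ => p.1 ≠ p.2)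
        (measurableSet_eq_fun measurable_fst measurable_snd).compl).2 ?_
      refine Eventually.of_forall fun x => ae_restrict_of_ae ?_
      filter_upwards [Measure.ae_ne volume x] with y hy using hy.symm
    have hmem : ∀ᵐ p : ℝ × ℝ ∂((volume.restrict (Set.Icc a b)).prod
        (volume.restrict (Set.Icc a b))), p ∈ Set.Icc a b ×ˢ Set.Icc a b := by
      rw [Measure.prod_restrict]
      exact ae_restrict_mem (measurableSet_Icc.prod measurableSet_Icc)
    filter_upwards [hne, hmem] with p hp hp'
    have hD : p.1 - p.2 ≠ 0 := sub_ne_zero.2 hp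
    have hle : |p.1 - p.2| ≤ b - a := by
      rw [abs_le]; constructor <;> linarith [hp'.1.1, hp'.1.2, hp'.2.1, hp'.2.2]
    simp only [hh, fracKernel, if_pos hle]
    have hA := norm_integral_annulus_quadPhase_le (E := E) (R := min (R p.1) (R p.2))
      (A := η * (2 * Real.pi * (p.1 - p.2 + C * (σ p.1 - σ p.2))))
      (B := ε * (4 * Real.pi ^ 2 * (σ p.1 ^ 2 - σ p.2 ^ 2))) hN hC hD (hσ0 p.1) (hσ0 p.2)
      (by rw [abs_mul, hη, one_mul, abs_mul, abs_of_pos Real.two_pi_pos])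
      (by rw [abs_mul, hε, one_mul, abs_mul, abs_of_nonneg (by positivity)])
    refine le_of_eq_of_le ?_ hA
    congr 1
    have hsub : annulus E N (min (R p.1) (R p.2)) ⊆ annulus E N Rmax :=
      fun ξ hξ => ⟨hξ.1, hξ.2.trans ((min_le_left _ _).trans (hRm _))⟩
    rw [← Set.inter_eq_self_of_subset_right hsub, ← setIntegral_indicator (measurableSet_annulus _ _)]
    refine setIntegral_congr_fun (measurableSet_annulus _ _) fun ξ hξ => ?_
    have hξ0 : 0 < ‖ξ‖ := hN.trans hξ.1
    by_cases hc : ξ ∈ annulus E N (min (R p.1) (R p.2))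
    · have h1 : N < ‖ξ‖ ∧ ‖ξ‖ ≤ R p.1 := ⟨hc.1, hc.2.trans (min_le_left _ _)⟩
      have h2 : N < ‖ξ‖ ∧ ‖ξ‖ ≤ R p.2 := ⟨hc.1, hc.2.trans (min_le_right _ _)⟩
      simp only [hk, Set.indicator_of_mem hc, if_pos h1, if_pos h2, hQ, quadPhase, map_mul,
        Complex.conj_ofReal, ← Complex.exp_conj, Complex.conj_I]
      have : ‖ξ‖ ^ (-((n : ℝ) - 1 / 2)) = ‖ξ‖ ^ δ * ‖ξ‖ ^ δ := by
        rw [← Real.rpow_add hξ0, hδ]; congr 1; ring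
      rw [this, mul_mul_mul_comm, ← Complex.exp_add, Complex.ofReal_mul]
      congr 2
      push_cast; ring
    · have hc' : ¬ ((N < ‖ξ‖ ∧ ‖ξ‖ ≤ R p.1) ∧ (N < ‖ξ‖ ∧ ‖ξ‖ ≤ R p.2)) := fun hc' =>
        hc ⟨hc'.1.1, le_min hc'.1.2 hc'.2.2⟩
      rw [Set.indicator_of_notMem hc]
      rcases not_and_or.1 hc' with h1 | h1
      · simp only [hk, if_neg h1, zero_mul]
      · simp only [hk, if_neg h1, map_zero, mul_zero]

end Selection

/-! ### Suprema over countable families and the Cauchy–Schwarz inequality -/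

/-- The index of a largest among finitely many measurable functions can be chosen measurably. -/
lemma exists_measurable_argmax {X : Type*} [MeasurableSpace X] {F : ℕ → X → ENNReal}
    (hF : ∀ i, Measurable (F i)) (m : ℕ) :
    ∃ j : X → ℕ, Measurable j ∧ (∀ x, j x ≤ m) ∧ Measurable (fun x => F (j x) x) ∧
      ∀ x, ∀ i ≤ m, F i x ≤ F (j x) x := by
  induction m with
  | zero =>
    refine ⟨fun _ => 0, measurable_const, fun _ => le_rfl, hF 0, fun x i hi => ?_⟩
    rw [Nat.le_zero.1 hi]
  | succ m ih =>
    obtain ⟨j, hj, hjm, hFj, hmax⟩ := ih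
    have hset : MeasurableSet {x | F (j x) x < F (m + 1) x} := measurableSet_lt hFj (hF _)
    classical
    refine ⟨fun x => if F (j x) x < F (m + 1) x then m + 1 else j x,
      Measurable.ite hset measurable_const hj, fun x => ?_, ?_, fun x i hi => ?_⟩
    · simp only; split_ifs
      · exact le_rfl
      · exact (hjm x).trans (Nat.le_succ m)
    · have e : (fun x => F (if F (j x) x < F (m + 1) x then m + 1 else j x) x) =
          fun x => if F (j x) x < F (m + 1) x then F (m + 1) x else F (j x) x := by
        ext x; split_ifs <;> rfl
      rw [e]
      exact Measurable.ite hset (hF _) hFj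
    · simp only
      rcases Nat.le_succ_iff.1 hi with hi | hi
      · split_ifs with h
        · exact (hmax x i hi).trans h.le
        · exact hmax x i hi
      · subst hi
        split_ifs with h
        · exact le_rfl
        · exact not_lt.1 h

/-- A bound for all measurable selections from a countable family bounds its supremum. -/
lemma lintegral_iSup_le_of_selection {X : Type*} [MeasurableSpace X] {μ : Measure X}
    {F : ℕ → X → ENNReal} (hF : ∀ i, Measurable (F i)) {T : ENNReal}
    (h : ∀ (m : ℕ) (j : X → ℕ), Measurable j → (∀ x, j x ≤ m) → ∫⁻ x, F (j x) x ∂μ ≤ T) :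
    ∫⁻ x, ⨆ i, F i x ∂μ ≤ T := by
  choose j hj hjm hFj hmax using exists_measurable_argmax hF
  have e : (fun x => ⨆ i, F i x) = fun x => ⨆ m, F (j m x) x := by
    ext x
    refine le_antisymm (iSup_le fun i => ?_) (iSup_le fun m => le_iSup (fun i => F i x) _)
    exact (hmax i x i le_rfl).trans (le_iSup (fun m => F (j m x) x) i)
  rw [e, lintegral_iSup hFj fun m k hmk x => hmax k x _ ((hjm m x).trans hmk)]
  exact iSup_le fun m => h m (j m) (hj m) (hjm m)

lemma sq_integral_mul_le {X : Type*} [MeasurableSpace X] {μ : Measure X} {f h : X → ℝ}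
    (hf0 : ∀ x, 0 ≤ f x) (hh0 : ∀ x, 0 ≤ h x) (hf : MemLp f 2 μ) (hh : MemLp h 2 μ) :
    (∫ x, f x * h x ∂μ) ^ 2 ≤ (∫ x, f x ^ 2 ∂μ) * ∫ x, h x ^ 2 ∂μ := by
  have := integral_mul_le_Lp_mul_Lq_of_nonneg (μ := μ) Real.HolderConjugate.two_two
    (Eventually.of_forall hf0) (Eventually.of_forall hh0) (by simpa using hf) (by simpa using hh)
  have h0 : 0 ≤ ∫ x, f x * h x ∂μ := integral_nonneg fun x => mul_nonneg (hf0 x) (hh0 x)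
  have hF : 0 ≤ ∫ x, f x ^ 2 ∂μ := integral_nonneg fun x => sq_nonneg _
  have hH : 0 ≤ ∫ x, h x ^ 2 ∂μ := integral_nonneg fun x => sq_nonneg _
  simp only [Real.rpow_two, ← Real.sqrt_eq_rpow] at this
  calc _ ≤ (√(∫ x, f x ^ 2 ∂μ) * √(∫ x, h x ^ 2 ∂μ)) ^ 2 := pow_le_pow_left₀ h0 this 2
    _ = _ := by rw [mul_pow, Real.sq_sqrt hF, Real.sq_sqrt hH]

/-! ### Maximal estimate and almost everywhere convergence -/

section Maximal

variable {E : Type*} [NormedAddCommGroup E] [InnerProductSpace ℝ E] [FiniteDimensional ℝ E]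
  [MeasurableSpace E] [BorelSpace E]

/-- The contribution of the frequencies `N < ‖ξ‖ ≤ R` to the superposition of radial waves with
profile `P` and amplitude `g`, at time `εσ²` and at distance `s + Cσ` from the origin.
For `N = -1` the frequencies are those of the whole ball `‖ξ‖ ≤ R`. -/
def radialPropagator (P : ℝ → ℝ) (C ε : ℝ) (g : E → ℂ) (N R σ s : ℝ) : ℂ :=
  ∫ ξ in annulus E N R, (P (2 * Real.pi * (s + C * σ) * ‖ξ‖) : ℂ) *
    quadPhase 0 (ε * (4 * Real.pi ^ 2 * σ ^ 2)) ‖ξ‖ * g ξ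

lemma measurable_radialPropagator {P : ℝ → ℝ} (hP : Continuous P) (C ε : ℝ) {g : E → ℂ}
    (hg : Measurable g) (N : ℝ) {R σ : ℝ → ℝ} (hR : Measurable R) (hσ : Measurable σ) :
    Measurable fun s => radialPropagator P C ε g N (R s) (σ s) s := by
  have e : (fun s => radialPropagator P C ε g N (R s) (σ s) s) = fun s => ∫ ξ : E,
      {p : ℝ × E | N < ‖p.2‖ ∧ ‖p.2‖ ≤ R p.1}.indicator (fun p =>
        (P (2 * Real.pi * (p.1 + C * σ p.1) * ‖p.2‖) : ℂ) *
          quadPhase 0 (ε * (4 * Real.pi ^ 2 * σ p.1 ^ 2)) ‖p.2‖ * g p.2) (s, ξ) := by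
    ext s
    rw [radialPropagator, ← integral_indicator (measurableSet_annulus _ _)]
    rfl
  rw [e]
  have hm : Measurable fun p : ℝ × E => (P (2 * Real.pi * (p.1 + C * σ p.1) * ‖p.2‖) : ℂ) *
          quadPhase 0 (ε * (4 * Real.pi ^ 2 * σ p.1 ^ 2)) ‖p.2‖ * g p.2 := by
    have := hP.measurable
    unfold quadPhase
    fun_prop
  exact (hm.indicator ((measurableSet_lt measurable_const measurable_snd.norm).inter
    (measurableSet_le measurable_snd.norm
      (hR.comp measurable_fst)))).stronglyMeasurable.integral_prod_right'.measurable

/-- The radial waves split into an outgoing and an incoming oscillating part and an error which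
is controlled by the Cauchy–Schwarz inequality. -/
lemma norm_radialPropagator_le {P : ℝ → ℝ} (hP : Continuous P) {z : ℂ} {c : ℝ} (hc : 0 ≤ c)
    (hPz : ∀ u, 1 ≤ u → |P u - u ^ (-(((Module.finrank ℝ E : ℝ) - 1) / 2)) *
      (Complex.exp (u * Complex.I) * z).im| ≤ c * u ^ (-(((Module.finrank ℝ E : ℝ) - 1) / 2) - 1))
    {g : E → ℂ} (hgm : Measurable g) {N R : ℝ} (hg : IntegrableOn g (annulus E N R))
    {a C s σ : ℝ} (ε : ℝ) (ha : 0 < a) (hC : 0 ≤ C) (hs : a ≤ s) (hσ : 0 ≤ σ) (hN : 1 ≤ N)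
    (hNa : 1 ≤ a * N) [Nontrivial E] :
    ‖radialPropagator P C ε g N R σ s‖ ≤
      (2 * Real.pi * a) ^ (-(((Module.finrank ℝ E : ℝ) - 1) / 2)) * ‖z‖ *
      (‖∫ ξ in annulus E N R, ((‖ξ‖ ^ (-(((Module.finrank ℝ E : ℝ) - 1) / 2)) : ℝ) : ℂ) *
        quadPhase (1 * (2 * Real.pi * (s + C * σ))) (ε * (4 * Real.pi ^ 2 * σ ^ 2)) ‖ξ‖ * g ξ‖ +
      ‖∫ ξ in annulus E N R, ((‖ξ‖ ^ (-(((Module.finrank ℝ E : ℝ) - 1) / 2)) : ℝ) : ℂ) *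
        quadPhase (-1 * (2 * Real.pi * (s + C * σ))) (ε * (4 * Real.pi ^ 2 * σ ^ 2)) ‖ξ‖ * g ξ‖) +
      c * (2 * Real.pi * a) ^ (-(((Module.finrank ℝ E : ℝ) - 1) / 2) - 1) *
      ∫ ξ in annulus E N R, ‖ξ‖ ^ (-(((Module.finrank ℝ E : ℝ) - 1) / 2) - 1) * ‖g ξ‖ := by
  set κ := -(((Module.finrank ℝ E : ℝ) - 1) / 2) with hκ
  have hκ0 : κ ≤ 0 := by
    have : (1 : ℝ) ≤ Module.finrank ℝ E := by
      exact_mod_cast (Module.finrank_pos : 0 < Module.finrank ℝ E)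
    rw [hκ]; linarith
  set r := s + C * σ with hr
  have har : a ≤ r := by rw [hr]; nlinarith [mul_nonneg hC hσ]
  have hr0 : 0 < r := ha.trans_le har
  set B := ε * (4 * Real.pi ^ 2 * σ ^ 2) with hB
  have hpi := Real.pi_gt_three
  set I : ℝ → E → ℂ := fun η ξ => ((‖ξ‖ ^ κ : ℝ) : ℂ) * quadPhase (η * (2 * Real.pi * r)) B ‖ξ‖ * g ξ
    with hI
  have hpos : ∀ ξ ∈ annulus E N R, 1 ≤ ‖ξ‖ := fun ξ hξ => hN.trans hξ.1.le
  have hIi : ∀ η, IntegrableOn (I η) (annulus E N R) := fun η => by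
    refine Integrable.mono hg ?_ ?_
    · refine Measurable.aestronglyMeasurable ?_
      simp only [hI, quadPhase]; fun_prop
    · filter_upwards [ae_restrict_mem (measurableSet_annulus N R)] with ξ hξ
      simp only [hI]
      rw [norm_mul, norm_mul, norm_quadPhase, mul_one, Complex.norm_real,
        Real.norm_of_nonneg (Real.rpow_nonneg (norm_nonneg _) _)]
      exact mul_le_of_le_one_left (norm_nonneg _)
        (Real.rpow_le_one_of_one_le_of_nonpos (hpos ξ hξ) hκ0)
  set w : ℝ := (2 * Real.pi * r) ^ κ with hw
  have hw0 : 0 ≤ w := by positivity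
  have hwa : w ≤ (2 * Real.pi * a) ^ κ :=
    Real.rpow_le_rpow_of_nonpos (by positivity) (by gcongr) hκ0
  have hJi : IntegrableOn (fun ξ : E => ‖ξ‖ ^ (κ - 1) * ‖g ξ‖) (annulus E N R) := by
    refine Integrable.mono hg.norm ?_ ?_
    · exact Measurable.aestronglyMeasurable (by fun_prop)
    · filter_upwards [ae_restrict_mem (measurableSet_annulus N R)] with ξ hξ
      rw [norm_mul, Real.norm_of_nonneg (Real.rpow_nonneg (norm_nonneg _) _)]
      exact mul_le_of_le_one_left (norm_nonneg _)
        (Real.rpow_le_one_of_one_le_of_nonpos (hpos ξ hξ) (by linarith))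
  set M : E → ℂ := fun ξ => w * (z / (2 * Complex.I)) * I 1 ξ -
    w * ((starRingEnd ℂ) z / (2 * Complex.I)) * I (-1) ξ with hM
  set F : E → ℂ := fun ξ => (P (2 * Real.pi * r * ‖ξ‖) : ℂ) * quadPhase 0 B ‖ξ‖ * g ξ with hF
  have hMint : IntegrableOn M (annulus E N R) :=
    ((hIi 1).const_mul _).sub ((hIi (-1)).const_mul _)
  -- the pointwise error
  have herr : ∀ ξ ∈ annulus E N R, ‖F ξ - M ξ‖ ≤
      c * (2 * Real.pi * a) ^ (κ - 1) * (‖ξ‖ ^ (κ - 1) * ‖g ξ‖) := fun ξ hξ => by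
    have hξ1 := hpos ξ hξ
    set u := 2 * Real.pi * r * ‖ξ‖ with hu
    have hu1 : 1 ≤ u := by
      have h1 : a * N ≤ r * ‖ξ‖ := mul_le_mul har hξ.1.le (by linarith) hr0.le
      rw [hu, mul_assoc]
      nlinarith
    have hMe : M ξ = ((u ^ κ * (Complex.exp (u * Complex.I) * z).im : ℝ) : ℂ) *
        quadPhase 0 B ‖ξ‖ * g ξ := by
      have h2 : (((Complex.exp (u * Complex.I) * z).im : ℝ) : ℂ) =
          (Complex.exp (u * Complex.I) * z - Complex.exp (-(u * Complex.I)) * (starRingEnd ℂ) z) /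
            (2 * Complex.I) := by
        rw [Complex.im_eq_sub_conj, map_mul, ← Complex.exp_conj, map_mul, Complex.conj_ofReal,
          Complex.conj_I, mul_neg]
      have h3 : quadPhase (1 * (2 * Real.pi * r)) B ‖ξ‖ =
          Complex.exp (u * Complex.I) * quadPhase 0 B ‖ξ‖ := by
        rw [quadPhase, quadPhase, ← Complex.exp_add, hu]; congr 1; push_cast; ring
      have h4 : quadPhase (-1 * (2 * Real.pi * r)) B ‖ξ‖ =
          Complex.exp (-(u * Complex.I)) * quadPhase 0 B ‖ξ‖ := by
        rw [quadPhase, quadPhase, ← Complex.exp_add, hu]; congr 1; push_cast; ring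
      have h5 : u ^ κ = w * ‖ξ‖ ^ κ := by
        rw [hu, Real.mul_rpow (by positivity) (norm_nonneg _)]
      have h6 : ((u ^ κ * (Complex.exp (u * Complex.I) * z).im : ℝ) : ℂ) =
          (w : ℂ) * ((‖ξ‖ ^ κ : ℝ) : ℂ) * ((Complex.exp (u * Complex.I) * z -
            Complex.exp (-(u * Complex.I)) * (starRingEnd ℂ) z) / (2 * Complex.I)) := by
        rw [← h2, h5, Complex.ofReal_mul, Complex.ofReal_mul]
      simp only [hM, hI]
      rw [h3, h4, h6]
      ring
    have h6 : F ξ - M ξ = ((P u - u ^ κ * (Complex.exp (u * Complex.I) * z).im : ℝ) : ℂ) *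
        quadPhase 0 B ‖ξ‖ * g ξ := by
      rw [hMe, Complex.ofReal_sub, sub_mul, sub_mul]
    rw [h6, norm_mul, norm_mul, norm_quadPhase, mul_one, Complex.norm_real, Real.norm_eq_abs]
    have h7 : u ^ (κ - 1) ≤ (2 * Real.pi * a) ^ (κ - 1) * ‖ξ‖ ^ (κ - 1) := by
      rw [hu, Real.mul_rpow (by positivity) (norm_nonneg _)]
      refine mul_le_mul_of_nonneg_right ?_ (Real.rpow_nonneg (norm_nonneg _) _)
      exact Real.rpow_le_rpow_of_nonpos (by positivity) (by gcongr) (by linarith)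
    calc _ ≤ c * u ^ (κ - 1) * ‖g ξ‖ := mul_le_mul_of_nonneg_right (hPz u hu1) (norm_nonneg _)
      _ ≤ c * ((2 * Real.pi * a) ^ (κ - 1) * ‖ξ‖ ^ (κ - 1)) * ‖g ξ‖ := by gcongr
      _ = _ := by ring
  have hdm : Measurable fun ξ => F ξ - M ξ := by
    have := hP.measurable
    simp only [hF, hM, hI, quadPhase]
    fun_prop
  have hdi : IntegrableOn (fun ξ => F ξ - M ξ) (annulus E N R) :=
    (hJi.const_mul _).mono' hdm.aestronglyMeasurable
      ((ae_restrict_mem (measurableSet_annulus N R)).mono herr)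
  have hsplit : radialPropagator P C ε g N R σ s =
      (∫ ξ in annulus E N R, M ξ) + ∫ ξ in annulus E N R, (F ξ - M ξ) := by
    rw [← integral_add hMint hdi]
    simp only [add_sub_cancel]
    rfl
  have hMv : ∫ ξ in annulus E N R, M ξ = w * (z / (2 * Complex.I)) * (∫ ξ in annulus E N R, I 1 ξ) -
      w * ((starRingEnd ℂ) z / (2 * Complex.I)) * ∫ ξ in annulus E N R, I (-1) ξ := by
    rw [hM, integral_sub ((hIi 1).const_mul _) ((hIi (-1)).const_mul _), integral_const_mul,
      integral_const_mul]
  have hcoef : ∀ y : ℂ, ‖y‖ = ‖z‖ → ‖(w : ℂ) * (y / (2 * Complex.I))‖ ≤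
      (2 * Real.pi * a) ^ κ * ‖z‖ := fun y hy => by
    rw [norm_mul, Complex.norm_real, Real.norm_of_nonneg hw0, norm_div, norm_mul, Complex.norm_I,
      Complex.norm_ofNat, hy, mul_one]
    exact mul_le_mul hwa (by linarith [norm_nonneg z]) (by positivity) (by positivity)
  rw [hsplit]
  refine (norm_add_le _ _).trans (add_le_add ?_ ?_)
  · rw [hMv, mul_add]
    refine (norm_sub_le _ _).trans (add_le_add ?_ ?_)
    · rw [norm_mul]
      exact mul_le_mul_of_nonneg_right (hcoef z rfl) (norm_nonneg _)
    · rw [norm_mul]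
      exact mul_le_mul_of_nonneg_right (hcoef _ (RCLike.norm_conj z)) (norm_nonneg _)
  · rw [← integral_const_mul]
    exact norm_integral_le_of_norm_le (hJi.const_mul _)
      ((ae_restrict_mem (measurableSet_annulus N R)).mono herr)

lemma integrableOn_of_memLp_two {g : E → ℂ} (hg : MemLp g 2) {S : Set E} (hS : volume S < ⊤) :
    IntegrableOn g S := by
  have : IsFiniteMeasure (volume.restrict S) := ⟨by rwa [Measure.restrict_apply_univ]⟩
  exact (hg.restrict S).integrable (by norm_num)

/-- The error term of the asymptotics costs no derivatives: its weight is square integrable at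
infinity. -/
lemma exists_sq_integral_annulus_le [Nontrivial E] :
    ∃ V : ℝ, 0 ≤ V ∧ ∀ (N R : ℝ) (g : E → ℂ), 1 ≤ N →
      MemLp g 2 (volume.restrict (annulus E N R)) →
      (∫ ξ in annulus E N R, ‖ξ‖ ^ (-(((Module.finrank ℝ E : ℝ) - 1) / 2) - 1) * ‖g ξ‖) ^ 2 ≤
        V * ∫ ξ in annulus E N R, ‖g ξ‖ ^ 2 := by
  set n := Module.finrank ℝ E with hn
  have hw : Integrable (fun ξ : E => (1 + ‖ξ‖) ^ (-((n : ℝ) + 1))) :=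
    integrable_one_add_norm (by rw [← hn]; linarith)
  have hw0 : 0 ≤ ∫ ξ : E, (1 + ‖ξ‖) ^ (-((n : ℝ) + 1)) :=
    integral_nonneg fun ξ => Real.rpow_nonneg (by positivity) _
  refine ⟨2 ^ ((n : ℝ) + 1) * ∫ ξ : E, (1 + ‖ξ‖) ^ (-((n : ℝ) + 1)), by positivity, ?_⟩
  intro N R g hN hg
  set f : E → ℝ := fun ξ => ‖ξ‖ ^ (-(((n : ℝ) - 1) / 2) - 1) with hf
  have hle : ∀ ξ ∈ annulus E N R, f ξ ^ 2 ≤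
      2 ^ ((n : ℝ) + 1) * (1 + ‖ξ‖) ^ (-((n : ℝ) + 1)) := fun ξ hξ => by
    have h1 : 1 ≤ ‖ξ‖ := hN.trans hξ.1.le
    have h0 : 0 < ‖ξ‖ := by linarith
    have e1 : f ξ ^ 2 = ‖ξ‖ ^ (-((n : ℝ) + 1)) := by
      simp only [hf]
      rw [← Real.rpow_natCast, ← Real.rpow_mul h0.le]
      congr 1; push_cast; ring
    have e2 : 2 ^ ((n : ℝ) + 1) * (1 + ‖ξ‖) ^ (-((n : ℝ) + 1)) =
        ((1 + ‖ξ‖) / 2) ^ (-((n : ℝ) + 1)) := by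
      rw [Real.div_rpow (by positivity) (by norm_num), Real.rpow_neg (by norm_num : (0 : ℝ) ≤ 2),
        div_inv_eq_mul, mul_comm]
    rw [e1, e2]
    exact Real.rpow_le_rpow_of_nonpos (by positivity) (by linarith)
      (by have := Nat.cast_nonneg (α := ℝ) n; linarith)
  have hmem : ∀ᵐ ξ ∂(volume.restrict (annulus E N R)), ξ ∈ annulus E N R :=
    ae_restrict_mem (measurableSet_annulus N R)
  have hfm : Measurable f := by simp only [hf]; fun_prop
  have hf2 : IntegrableOn (fun ξ => f ξ ^ 2) (annulus E N R) := by
    refine (hw.integrableOn.const_mul (2 ^ ((n : ℝ) + 1))).mono'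
      (hfm.pow_const 2).aestronglyMeasurable ?_
    filter_upwards [hmem] with ξ hξ
    rw [Real.norm_of_nonneg (sq_nonneg _)]
    exact hle ξ hξ
  have hfL : MemLp f 2 (volume.restrict (annulus E N R)) :=
    (memLp_two_iff_integrable_sq hfm.aestronglyMeasurable).2 hf2
  refine (sq_integral_mul_le (fun ξ => Real.rpow_nonneg (norm_nonneg _) _)
    (fun ξ => norm_nonneg _) hfL hg.norm).trans ?_
  refine mul_le_mul_of_nonneg_right ?_ (integral_nonneg fun ξ => sq_nonneg _)
  rw [← integral_const_mul]
  calc ∫ ξ in annulus E N R, f ξ ^ 2 ≤ ∫ ξ in annulus E N R,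
        2 ^ ((n : ℝ) + 1) * (1 + ‖ξ‖) ^ (-((n : ℝ) + 1)) :=
        setIntegral_mono_on hf2 (hw.const_mul _).integrableOn (measurableSet_annulus N R) hle
    _ ≤ _ := setIntegral_le_integral (hw.const_mul _) (Eventually.of_forall fun ξ => by positivity)

/-- The maximal estimate, for measurable selections of the radius and of the time. -/
lemma exists_lintegral_radialPropagator_selection_le [Nontrivial E] {P : ℝ → ℝ}
    (hP : Continuous P) {z : ℂ} {c : ℝ} (hc : 0 ≤ c)
    (hPz : ∀ u, 1 ≤ u → |P u - u ^ (-(((Module.finrank ℝ E : ℝ) - 1) / 2)) *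
      (Complex.exp (u * Complex.I) * z).im| ≤ c * u ^ (-(((Module.finrank ℝ E : ℝ) - 1) / 2) - 1))
    {C : ℝ} (hC : 0 ≤ C) {a : ℝ} (ha : 0 < a) (b : ℝ) :
    ∃ c' : ℝ, 0 ≤ c' ∧ ∀ (N Rmax : ℝ) (R σ : ℝ → ℝ) (ε : ℝ) (g : E → ℂ), 1 ≤ N → 1 ≤ a * N →
      |ε| = 1 → Measurable R → Measurable σ → (∀ s, R s ≤ Rmax) → (∀ s, 0 ≤ σ s) →
      Measurable g → MemLp g 2 → MemLp (fun ξ => ((‖ξ‖ ^ (1 / 4 : ℝ) : ℝ) : ℂ) * g ξ) 2 →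
      ∫⁻ s in Set.Icc a b, ENNReal.ofReal (‖radialPropagator P C ε g N (R s) (σ s) s‖ ^ 2) ≤
        ENNReal.ofReal (c' * ∫ ξ in {ξ : E | N < ‖ξ‖}, ‖((‖ξ‖ ^ (1 / 4 : ℝ) : ℝ) : ℂ) * g ξ‖ ^ 2) := by
  obtain ⟨c₁, hc₁0, hc₁⟩ := exists_integral_sq_selection_le (E := E) hC a b
  obtain ⟨V, hV0, hV⟩ := exists_sq_integral_annulus_le (E := E)
  set κ := -(((Module.finrank ℝ E : ℝ) - 1) / 2) with hκ
  set k₁ := (2 * Real.pi * a) ^ κ * ‖z‖ with hk₁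
  set k₂ := c * (2 * Real.pi * a) ^ (κ - 1) with hk₂
  have hpi := Real.pi_pos
  have hk₁0 : 0 ≤ k₁ := by positivity
  have hk₂0 : 0 ≤ k₂ := by positivity
  refine ⟨3 * (k₁ ^ 2 * c₁ + k₁ ^ 2 * c₁ + volume.real (Set.Icc a b) * (k₂ ^ 2 * V)),
    by positivity, ?_⟩
  intro N Rmax R σ ε g hN hNa hε hR hσ hRm hσ0 hgm hg hG
  set G : E → ℂ := fun ξ => ((‖ξ‖ ^ (1 / 4 : ℝ) : ℝ) : ℂ) * g ξ with hGdef
  set τ := ∫ ξ in {ξ : E | N < ‖ξ‖}, ‖G ξ‖ ^ 2 with hτ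
  have hG2 : Integrable (fun ξ => ‖G ξ‖ ^ 2) := hG.integrable_norm_pow (by norm_num)
  have hτ0 : 0 ≤ τ := integral_nonneg fun ξ => by positivity
  have hann : ∀ R : ℝ, ∫ ξ in annulus E N R, ‖G ξ‖ ^ 2 ≤ τ := fun R =>
    setIntegral_mono_set hG2.integrableOn (Eventually.of_forall fun ξ => by positivity)
      (LE.le.eventuallyLE fun ξ hξ => hξ.1)
  have hgG : ∀ R : ℝ, ∫ ξ in annulus E N R, ‖g ξ‖ ^ 2 ≤ τ := fun R => by
    refine le_trans (setIntegral_mono_on (hg.integrable_norm_pow (by norm_num)).integrableOn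
      hG2.integrableOn (measurableSet_annulus N R) fun ξ hξ => ?_) (hann R)
    have h1 : 1 ≤ ‖ξ‖ := hN.trans hξ.1.le
    refine pow_le_pow_left₀ (norm_nonneg _) ?_ 2
    simp only [hGdef]
    rw [norm_mul, Complex.norm_real, Real.norm_of_nonneg (by positivity)]
    exact le_mul_of_one_le_left (norm_nonneg _) (Real.one_le_rpow h1 (by norm_num))
  obtain ⟨i₁, h₁⟩ := hc₁ N Rmax R σ 1 ε g (by linarith) abs_one hε hR hσ hRm hσ0 (hG.restrict _)
  obtain ⟨i₂, h₂⟩ := hc₁ N Rmax R σ (-1) ε g (by linarith) (by simp) hε hR hσ hRm hσ0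
    (hG.restrict _)
  set Φ₁ : ℝ → ℝ := fun s => ‖∫ ξ in annulus E N (R s), ((‖ξ‖ ^ κ : ℝ) : ℂ) *
        quadPhase (1 * (2 * Real.pi * (s + C * σ s))) (ε * (4 * Real.pi ^ 2 * σ s ^ 2)) ‖ξ‖ *
        g ξ‖ with hΦ₁
  set Φ₂ : ℝ → ℝ := fun s => ‖∫ ξ in annulus E N (R s), ((‖ξ‖ ^ κ : ℝ) : ℂ) *
        quadPhase (-1 * (2 * Real.pi * (s + C * σ s))) (ε * (4 * Real.pi ^ 2 * σ s ^ 2)) ‖ξ‖ *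
        g ξ‖ with hΦ₂
  replace i₁ : IntegrableOn (fun s => Φ₁ s ^ 2) (Set.Icc a b) := i₁
  replace i₂ : IntegrableOn (fun s => Φ₂ s ^ 2) (Set.Icc a b) := i₂
  replace h₁ : ∫ s in Set.Icc a b, Φ₁ s ^ 2 ≤ c₁ * τ :=
    h₁.trans (mul_le_mul_of_nonneg_left (hann Rmax) hc₁0)
  replace h₂ : ∫ s in Set.Icc a b, Φ₂ s ^ 2 ≤ c₁ * τ :=
    h₂.trans (mul_le_mul_of_nonneg_left (hann Rmax) hc₁0)
  have hpt : ∀ s ∈ Set.Icc a b, ‖radialPropagator P C ε g N (R s) (σ s) s‖ ^ 2 ≤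
      3 * (k₁ ^ 2 * Φ₁ s ^ 2 + k₁ ^ 2 * Φ₂ s ^ 2 + k₂ ^ 2 * V * τ) := fun s hs => by
    have h3 := norm_radialPropagator_le hP hc hPz hgm (integrableOn_of_memLp_two hg
      (volume_annulus_lt_top N (R s))) ε ha hC hs.1 (hσ0 s) hN hNa
    set e := ∫ ξ in annulus E N (R s), ‖ξ‖ ^ (κ - 1) * ‖g ξ‖ with he
    have h4 : e ^ 2 ≤ V * τ := (hV N (R s) g hN (hg.restrict _)).trans
      (mul_le_mul_of_nonneg_left (hgG _) hV0)
    have h5 : k₂ ^ 2 * e ^ 2 ≤ k₂ ^ 2 * (V * τ) := mul_le_mul_of_nonneg_left h4 (sq_nonneg _)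
    refine (pow_le_pow_left₀ (norm_nonneg _) h3 2).trans ?_
    change (k₁ * (Φ₁ s + Φ₂ s) + k₂ * e) ^ 2 ≤ _
    nlinarith [sq_nonneg (k₁ * Φ₁ s - k₁ * Φ₂ s), sq_nonneg (k₁ * Φ₁ s - k₂ * e),
      sq_nonneg (k₁ * Φ₂ s - k₂ * e)]
  have hint : IntegrableOn (fun s => 3 * (k₁ ^ 2 * Φ₁ s ^ 2 + k₁ ^ 2 * Φ₂ s ^ 2 + k₂ ^ 2 * V * τ))
      (Set.Icc a b) :=
    (((i₁.const_mul _).add (i₂.const_mul _)).add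
      (integrableOn_const (by simp))).const_mul 3
  calc _ ≤ ∫⁻ s in Set.Icc a b, ENNReal.ofReal
        (3 * (k₁ ^ 2 * Φ₁ s ^ 2 + k₁ ^ 2 * Φ₂ s ^ 2 + k₂ ^ 2 * V * τ)) :=
        setLIntegral_mono' measurableSet_Icc fun s hs => ENNReal.ofReal_le_ofReal (hpt s hs)
    _ = ENNReal.ofReal (∫ s in Set.Icc a b,
        3 * (k₁ ^ 2 * Φ₁ s ^ 2 + k₁ ^ 2 * Φ₂ s ^ 2 + k₂ ^ 2 * V * τ)) :=
        (ofReal_integral_eq_lintegral_ofReal hint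
          (Eventually.of_forall fun s => by positivity)).symm
    _ ≤ _ := by
        refine ENNReal.ofReal_le_ofReal ?_
        have h3 := mul_le_mul_of_nonneg_left h₁ (sq_nonneg k₁)
        have h4 := mul_le_mul_of_nonneg_left h₂ (sq_nonneg k₁)
        have e1 : ∫ s in Set.Icc a b, (k₁ ^ 2 * Φ₁ s ^ 2 + k₁ ^ 2 * Φ₂ s ^ 2 + k₂ ^ 2 * V * τ) =
            (∫ s in Set.Icc a b, (k₁ ^ 2 * Φ₁ s ^ 2 + k₁ ^ 2 * Φ₂ s ^ 2)) +
              ∫ s in Set.Icc a b, k₂ ^ 2 * V * τ :=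
          integral_add ((i₁.const_mul _).add (i₂.const_mul _)) (integrableOn_const (by simp))
        have e2 : ∫ s in Set.Icc a b, (k₁ ^ 2 * Φ₁ s ^ 2 + k₁ ^ 2 * Φ₂ s ^ 2) =
            k₁ ^ 2 * (∫ s in Set.Icc a b, Φ₁ s ^ 2) + k₁ ^ 2 * ∫ s in Set.Icc a b, Φ₂ s ^ 2 := by
          rw [← integral_const_mul, ← integral_const_mul]
          exact integral_add (i₁.const_mul _) (i₂.const_mul _)
        rw [integral_const_mul, e1, e2, setIntegral_const, smul_eq_mul]
        linarith

/-- Continuity in the radius and the time; the radius causes no jumps, as spheres are null sets. -/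
lemma continuous_radialPropagator {P : ℝ → ℝ} (hP : Continuous P) {M : ℝ}
    (hPM : ∀ u, |P u| ≤ M) (C ε : ℝ) {g : E → ℂ} (hgm : Measurable g) (hg : MemLp g 2)
    (N s : ℝ) [Nontrivial E] :
    Continuous fun p : ℝ × ℝ => radialPropagator P C ε g N p.1 p.2 s := by
  have e : (fun p : ℝ × ℝ => radialPropagator P C ε g N p.1 p.2 s) = fun p => ∫ ξ : E,
      (annulus E N p.1).indicator (fun ξ => (P (2 * Real.pi * (s + C * p.2) * ‖ξ‖) : ℂ) *
        quadPhase 0 (ε * (4 * Real.pi ^ 2 * p.2 ^ 2)) ‖ξ‖ * g ξ) ξ := by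
    ext p
    rw [radialPropagator, ← integral_indicator (measurableSet_annulus _ _)]
  rw [e, continuous_iff_continuousAt]
  intro p₀
  have hM0 : 0 ≤ M := (abs_nonneg _).trans (hPM 0)
  refine continuousAt_of_dominated
    (bound := (annulus E N (p₀.1 + 1)).indicator fun ξ => M * ‖g ξ‖) ?_ ?_ ?_ ?_
  · refine Eventually.of_forall fun p => Measurable.aestronglyMeasurable ?_
    have := hP.measurable
    refine Measurable.indicator ?_ (measurableSet_annulus _ _)
    unfold quadPhase
    fun_prop
  · have : ∀ᶠ p : ℝ × ℝ in 𝓝 p₀, p.1 < p₀.1 + 1 :=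
      continuous_fst.continuousAt.eventually_lt continuousAt_const (by simp)
    filter_upwards [this] with p hp
    refine Eventually.of_forall fun ξ => ?_
    by_cases hξ : ξ ∈ annulus E N p.1
    · have hξ' : ξ ∈ annulus E N (p₀.1 + 1) := ⟨hξ.1, hξ.2.trans hp.le⟩
      rw [Set.indicator_of_mem hξ, Set.indicator_of_mem hξ', norm_mul, norm_mul, norm_quadPhase,
        mul_one, Complex.norm_real]
      exact mul_le_mul_of_nonneg_right (hPM _) (norm_nonneg _)
    · rw [Set.indicator_of_notMem hξ, norm_zero]
      exact Set.indicator_nonneg (fun ξ _ => by positivity) _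
  · rw [integrable_indicator_iff (measurableSet_annulus _ _)]
    exact (integrableOn_of_memLp_two hg (volume_annulus_lt_top _ _)).norm.const_mul M
  · have hs : ∀ᵐ ξ : E, ξ ∉ Metric.sphere (0 : E) p₀.1 :=
      measure_eq_zero_iff_ae_notMem.1 (Measure.addHaar_sphere _ _ _)
    filter_upwards [hs] with ξ hξ
    have hξ' : ‖ξ‖ ≠ p₀.1 := fun h => hξ (by simpa using h)
    have hc : Continuous fun p : ℝ × ℝ => (P (2 * Real.pi * (s + C * p.2) * ‖ξ‖) : ℂ) *
        quadPhase 0 (ε * (4 * Real.pi ^ 2 * p.2 ^ 2)) ‖ξ‖ * g ξ := by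
      unfold quadPhase; fun_prop
    rcases lt_or_gt_of_ne hξ' with h | h
    · have hev : ∀ᶠ p : ℝ × ℝ in 𝓝 p₀, ‖ξ‖ < p.1 :=
        continuousAt_const.eventually_lt continuous_fst.continuousAt h
      by_cases hN : N < ‖ξ‖
      · refine hc.continuousAt.congr ?_
        filter_upwards [hev] with p hp
        rw [Set.indicator_of_mem (show ξ ∈ annulus E N p.1 from ⟨hN, hp.le⟩)]
      · refine (continuousAt_const (y := (0 : ℂ))).congr (Eventually.of_forall fun p => ?_)
        beta_reduce
        rw [Set.indicator_of_notMem (show ξ ∉ annulus E N p.1 from fun h => hN h.1)]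
    · have hev : ∀ᶠ p : ℝ × ℝ in 𝓝 p₀, p.1 < ‖ξ‖ :=
        continuous_fst.continuousAt.eventually_lt continuousAt_const h
      refine (continuousAt_const (y := (0 : ℂ))).congr ?_
      filter_upwards [hev] with p hp
      rw [Set.indicator_of_notMem (show ξ ∉ annulus E N p.1 from fun h => not_lt.2 h.2 hp)]

lemma tendsto_setIntegral_norm_gt {F : E → ℝ} (hF : Integrable F) :
    Tendsto (fun N : ℕ => ∫ ξ in {ξ : E | (N : ℝ) < ‖ξ‖}, F ξ) atTop (𝓝 0) := by
  have h := tendsto_setIntegral_of_antitone (μ := volume) (f := F)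
    (s := fun N : ℕ => {ξ : E | (N : ℝ) < ‖ξ‖})
    (fun N => measurableSet_lt measurable_const measurable_norm)
    (fun N m hNm ξ hξ => show (N : ℝ) < ‖ξ‖ from lt_of_le_of_lt (Nat.cast_le.2 hNm) hξ) ⟨0, hF.integrableOn⟩
  have e : (⋂ N : ℕ, {ξ : E | (N : ℝ) < ‖ξ‖}) = ∅ := by
    refine Set.eq_empty_of_forall_notMem fun ξ hξ => ?_
    obtain ⟨N, hN⟩ := exists_nat_ge ‖ξ‖
    exact not_lt.2 hN (Set.mem_iInter.1 hξ N)
  rwa [e, setIntegral_empty] at h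

lemma radialPropagator_sub {P : ℝ → ℝ} (hP : Continuous P) {M : ℝ}
    (hPM : ∀ u, |P u| ≤ M) (C ε : ℝ) {g : E → ℂ} (hgm : Measurable g) (hg : MemLp g 2)
    {N R : ℝ} (hN : 0 ≤ N) (hNR : N ≤ R) (σ s : ℝ) :
    radialPropagator P C ε g (-1) R σ s - radialPropagator P C ε g (-1) N σ s =
      radialPropagator P C ε g N R σ s := by
  have hi : ∀ N R : ℝ, IntegrableOn (fun ξ : E => (P (2 * Real.pi * (s + C * σ) * ‖ξ‖) : ℂ) *
      quadPhase 0 (ε * (4 * Real.pi ^ 2 * σ ^ 2)) ‖ξ‖ * g ξ) (annulus E N R) := fun N R => by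
    have := hP.measurable
    refine ((integrableOn_of_memLp_two hg (volume_annulus_lt_top N R)).norm.const_mul M).mono'
      (Measurable.aestronglyMeasurable (by unfold quadPhase; fun_prop))
      (Eventually.of_forall fun ξ => ?_)
    rw [norm_mul, norm_mul, norm_quadPhase, mul_one, Complex.norm_real]
    exact mul_le_mul_of_nonneg_right (hPM _) (norm_nonneg _)
  have e : annulus E (-1) R = annulus E (-1) N ∪ annulus E N R := by
    ext ξ
    simp only [annulus, Set.mem_union, Set.mem_ofPred_eq]
    have := norm_nonneg ξ
    constructor
    · rintro ⟨h1, h2⟩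
      rcases le_or_gt ‖ξ‖ N with h | h
      · exact Or.inl ⟨h1, h⟩
      · exact Or.inr ⟨h, h2⟩
    · rintro (⟨h1, h2⟩ | ⟨h1, h2⟩)
      · exact ⟨h1, h2.trans hNR⟩
      · exact ⟨by linarith, h2⟩
  have hd : Disjoint (annulus E (-1) N) (annulus E N R) :=
    Set.disjoint_left.2 fun ξ h1 h2 => not_lt.2 h1.2 h2.1
  simp only [radialPropagator]
  rw [e, setIntegral_union hd (measurableSet_annulus N R) (hi _ _) (hi _ _), add_sub_cancel_left]

/-- If the frequencies beyond `N` contribute little, uniformly along the curve through `s`, then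
the truncated superpositions converge to a limit which is continuous along the curve. -/
lemma exists_limit_of_oscillation [Nontrivial E] {P : ℝ → ℝ}
    (hP : Continuous P) {M : ℝ} (hPM : ∀ u, |P u| ≤ M)
    {C ε : ℝ} {g : E → ℂ} (hgm : Measurable g) (hg : MemLp g 2) {s : ℝ}
    (hosc : ∀ δ > 0, ∃ N : ℕ, ∀ R : ℝ, ∀ σ ∈ Set.Icc (0 : ℝ) 1,
      ‖radialPropagator P C ε g N R σ s‖ ≤ δ) :
    ∃ L : ℝ → ℂ, ContinuousOn L (Set.Icc 0 1) ∧ ∀ σ ∈ Set.Icc (0 : ℝ) 1,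
        Tendsto (fun R => radialPropagator P C ε g (-1) R σ s) atTop (𝓝 (L σ)) := by
  have hcauchy : UniformCauchySeqOn (fun R σ => radialPropagator P C ε g (-1) R σ s) atTop
      (Set.Icc (0 : ℝ) 1) := by
    rw [Metric.uniformCauchySeqOn_iff]
    intro δ hδ
    obtain ⟨N, hN⟩ := hosc (δ / 3) (by positivity)
    have h1 : ∀ R ≥ (N : ℝ), ∀ σ ∈ Set.Icc (0 : ℝ) 1,
        dist (radialPropagator P C ε g (-1) R σ s) (radialPropagator P C ε g (-1) N σ s) ≤
          δ / 3 := fun R hR σ hσ => by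
      rw [dist_eq_norm, radialPropagator_sub hP hPM C ε hgm hg N.cast_nonneg hR]
      exact hN R σ hσ
    refine ⟨N, fun R hR R' hR' σ hσ => ?_⟩
    have := dist_triangle_right (radialPropagator P C ε g (-1) R σ s)
      (radialPropagator P C ε g (-1) R' σ s) (radialPropagator P C ε g (-1) N σ s)
    linarith [h1 R hR σ hσ, h1 R' hR' σ hσ]
  have hpt : ∀ σ ∈ Set.Icc (0 : ℝ) 1, ∃ l,
      Tendsto (fun R => radialPropagator P C ε g (-1) R σ s) atTop (𝓝 l) := fun σ hσ =>
    cauchy_map_iff_exists_tendsto.1 (hcauchy.cauchy_map hσ)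
  choose! L hL using hpt
  refine ⟨L, ?_, hL⟩
  refine (hcauchy.tendstoUniformlyOn_of_tendsto hL).continuousOn
    (Eventually.of_forall fun R => Continuous.continuousOn ?_).frequently
  exact (continuous_radialPropagator hP hPM C ε hgm hg (-1) s).comp
    (continuous_const.prodMk continuous_id)

/-- Suprema whose integrals tend to `0` are small somewhere along the sequence, almost everywhere. -/
lemma ae_exists_forall_lt_of_lintegral_iSup_le {X : Type*} [MeasurableSpace X] {μ : Measure X}
    {F : ℕ → ℕ → X → ENNReal} (hF : ∀ N j, Measurable (F N j)) {b : ℕ → ℝ}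
    (hb : Tendsto b atTop (𝓝 0)) {m : ℕ}
    (hFb : ∀ N, m ≤ N → ∫⁻ x, ⨆ j, F N j x ∂μ ≤ ENNReal.ofReal (b N)) :
    ∀ᵐ x ∂μ, ∀ δ > 0, ∃ N, ∀ j, F N j x < δ := by
  have hm' : Measurable fun x => ⨅ k : ℕ, ⨆ j, F (k + m) j x :=
    Measurable.iInf fun k => Measurable.iSup fun j => hF _ j
  have hlim : Tendsto (fun k : ℕ => ENNReal.ofReal (b (k + m))) atTop (𝓝 0) := by
    simpa using ENNReal.tendsto_ofReal (hb.comp (tendsto_add_atTop_nat m))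
  have hzero : ∫⁻ x, ⨅ k : ℕ, ⨆ j, F (k + m) j x ∂μ = 0 := by
    refine le_antisymm (ge_of_tendsto hlim (Eventually.of_forall fun k => ?_)) zero_le
    exact (lintegral_mono fun x => iInf_le _ k).trans (hFb _ (by omega))
  filter_upwards [(lintegral_eq_zero_iff hm').1 hzero] with x hx δ hδ
  have hlt : ⨅ k : ℕ, ⨆ j, F (k + m) j x < δ := by
    rw [show ⨅ k : ℕ, ⨆ j, F (k + m) j x = 0 from hx]; exact hδ
  obtain ⟨k, hk⟩ := iInf_lt_iff.1 hlt
  exact ⟨k + m, fun j => (le_iSup (fun j => F (k + m) j x) j).trans_lt hk⟩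

/-- A countable dense set of radii and times suffices to control the superpositions. -/
lemma norm_radialPropagator_le_of_dense [Nontrivial E] {P : ℝ → ℝ} (hP : Continuous P) {M : ℝ}
    (hPM : ∀ u, |P u| ≤ M) {C ε : ℝ} {g : E → ℂ} (hgm : Measurable g) (hg : MemLp g 2)
    {q : ℕ → ℝ × Set.Icc (0 : ℝ) 1} (hq : DenseRange q) {N s δ : ℝ}
    (h : ∀ j, ‖radialPropagator P C ε g N (q j).1 (q j).2 s‖ ≤ δ) (R : ℝ) {σ : ℝ}
    (hσ : σ ∈ Set.Icc (0 : ℝ) 1) : ‖radialPropagator P C ε g N R σ s‖ ≤ δ := by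
  have hcont : Continuous fun p : ℝ × Set.Icc (0 : ℝ) 1 =>
      ‖radialPropagator P C ε g N p.1 p.2 s‖ :=
    (((continuous_radialPropagator hP hPM C ε hgm hg N s).comp
      (continuous_fst.prodMk (continuous_subtype_val.comp continuous_snd)))).norm
  exact hq.induction_on (p := fun p => ‖radialPropagator P C ε g N p.1 p.2 s‖ ≤ δ)
    (R, ⟨σ, hσ⟩) (isClosed_le hcont continuous_const) h

/-- For almost every `s ∈ [a, b]` the frequencies beyond `N` contribute little, uniformly along the
curve through `s`. -/
lemma ae_oscillation_radialPropagator [Nontrivial E] {P : ℝ → ℝ}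
    (hP : Continuous P) {M : ℝ} (hPM : ∀ u, |P u| ≤ M) {z : ℂ} {c : ℝ} (hc : 0 ≤ c)
    (hPz : ∀ u, 1 ≤ u → |P u - u ^ (-(((Module.finrank ℝ E : ℝ) - 1) / 2)) *
      (Complex.exp (u * Complex.I) * z).im| ≤ c * u ^ (-(((Module.finrank ℝ E : ℝ) - 1) / 2) - 1))
    {C : ℝ} (hC : 0 ≤ C) {ε : ℝ} (hε : |ε| = 1) {g : E → ℂ} (hgm : Measurable g) (hg : MemLp g 2)
    (hG : MemLp (fun ξ => ((‖ξ‖ ^ (1 / 4 : ℝ) : ℝ) : ℂ) * g ξ) 2)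
    {a : ℝ} (ha0 : 0 < a) (b : ℝ) :
    ∀ᵐ s : ℝ ∂(volume.restrict (Set.Icc a b)), ∀ δ > 0, ∃ N : ℕ, ∀ R : ℝ,
      ∀ σ ∈ Set.Icc (0 : ℝ) 1, ‖radialPropagator P C ε g N R σ s‖ ≤ δ := by
  -- from the frequency `m` on, the asymptotics of the profile hold at all distances `s ≥ a`
  obtain ⟨m, hm⟩ := exists_nat_ge (max 1 (1 / a))
  have ham : 1 ≤ a * m := by
    have := (le_max_right _ _).trans hm
    rwa [div_le_iff₀' ha0] at this
  replace hm : 1 ≤ (m : ℝ) := (le_max_left _ _).trans hm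
  obtain ⟨c', hc'0, hc'⟩ := exists_lintegral_radialPropagator_selection_le hP hc hPz hC ha0 b
  set τ : ℕ → ℝ := fun N => ∫ ξ in {ξ : E | (N : ℝ) < ‖ξ‖},
    ‖((‖ξ‖ ^ (1 / 4 : ℝ) : ℝ) : ℂ) * g ξ‖ ^ 2 with hτ
  have hτ0 : Tendsto τ atTop (𝓝 0) := tendsto_setIntegral_norm_gt
    (hG.integrable_norm_pow (by norm_num))
  -- the oscillation beyond frequency `N`, as a countable supremum
  obtain ⟨q, hq⟩ : ∃ q : ℕ → ℝ × Set.Icc (0 : ℝ) 1, DenseRange q :=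
    TopologicalSpace.exists_dense_seq _
  have hFm : ∀ N j : ℕ, Measurable fun s : ℝ =>
      ENNReal.ofReal (‖radialPropagator P C ε g N (q j).1 (q j).2 s‖ ^ 2) := fun N j =>
    ((measurable_radialPropagator hP C ε hgm N (measurable_const (a := (q j).1))
      (measurable_const (a := ((q j).2 : ℝ)))).norm.pow_const 2).ennreal_ofReal
  have hbound : ∀ N : ℕ, m ≤ N → ∫⁻ s in Set.Icc a b, ⨆ j : ℕ,
      ENNReal.ofReal (‖radialPropagator P C ε g N (q j).1 (q j).2 s‖ ^ 2) ≤
      ENNReal.ofReal (c' * τ N) := fun N hN => by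
    have hmN : (m : ℝ) ≤ N := Nat.cast_le.2 hN
    have haN : a * m ≤ a * N := mul_le_mul_of_nonneg_left hmN ha0.le
    refine lintegral_iSup_le_of_selection (hFm N) fun k j hj hjk => ?_
    obtain ⟨Rmax, hRmax⟩ : ∃ Rmax, ∀ i ≤ k, (q i).1 ≤ Rmax := by
      obtain ⟨Rmax, h⟩ := ((Finset.range (k + 1)).image fun i => (q i).1).bddAbove
      exact ⟨Rmax, fun i hi => h (by simpa using ⟨i, by omega, rfl⟩)⟩
    exact hc' N Rmax (fun s => (q (j s)).1) (fun s => (q (j s)).2) ε g (hm.trans hmN) (ham.trans haN) hε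
      ((measurable_from_top (f := fun i => (q i).1)).comp hj)
      ((measurable_from_top (f := fun i => ((q i).2 : ℝ))).comp hj)
      (fun s => hRmax _ (hjk s)) (fun s => (q (j s)).2.2.1) hgm hg hG
  filter_upwards [ae_exists_forall_lt_of_lintegral_iSup_le hFm
    (by simpa using hτ0.const_mul c') hbound] with s hs
  intro δ hδ
  obtain ⟨N, hN⟩ := hs (ENNReal.ofReal (δ ^ 2)) (ENNReal.ofReal_pos.2 (by positivity))
  refine ⟨N, fun R σ hσ => norm_radialPropagator_le_of_dense hP hPM hgm hg hq (fun j => ?_) R hσ⟩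
  exact (lt_of_pow_lt_pow_left₀ 2 hδ.le
    ((ENNReal.ofReal_lt_ofReal_iff (by positivity)).1 (hN j))).le

/-- For almost every `s` the truncated superpositions of radial waves converge, uniformly along
the curve through `s`, so that the limit is continuous along the curve up to the time `0`. -/
theorem ae_exists_limit_radialPropagator [Nontrivial E] {P : ℝ → ℝ}
    (hP : Continuous P) {M : ℝ} (hPM : ∀ u, |P u| ≤ M) {z : ℂ} {c : ℝ} (hc : 0 ≤ c)
    (hPz : ∀ u, 1 ≤ u → |P u - u ^ (-(((Module.finrank ℝ E : ℝ) - 1) / 2)) *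
      (Complex.exp (u * Complex.I) * z).im| ≤ c * u ^ (-(((Module.finrank ℝ E : ℝ) - 1) / 2) - 1))
    {C : ℝ} (hC : 0 ≤ C) {ε : ℝ} (hε : |ε| = 1) {g : E → ℂ} (hgm : Measurable g) (hg : MemLp g 2)
    (hG : MemLp (fun ξ => ((‖ξ‖ ^ (1 / 4 : ℝ) : ℝ) : ℂ) * g ξ) 2) :
    ∀ᵐ s : ℝ ∂(volume.restrict (Set.Ioi 0)), ∃ L : ℝ → ℂ, ContinuousOn L (Set.Icc 0 1) ∧
      ∀ σ ∈ Set.Icc (0 : ℝ) 1,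
        Tendsto (fun R => radialPropagator P C ε g (-1) R σ s) atTop (𝓝 (L σ)) := by
  have hcover : Set.Ioi (0 : ℝ) ⊆ ⋃ m : ℕ, Set.Icc (1 / ((m : ℝ) + 1)) ((m : ℝ) + 1) := by
    intro s hs
    have hs0 : (0 : ℝ) < s := hs
    obtain ⟨m, hm⟩ := exists_nat_ge (max s (1 / s))
    refine Set.mem_iUnion.2 ⟨m, ?_, ?_⟩
    · have h1 : 1 / s ≤ (m : ℝ) + 1 := by linarith [(le_max_right s (1 / s)).trans hm]
      rw [div_le_iff₀ (by positivity)]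
      rw [div_le_iff₀ hs0] at h1
      linarith
    · linarith [(le_max_left s (1 / s)).trans hm]
  refine ae_restrict_of_ae_restrict_of_subset hcover ?_
  rw [ae_restrict_iUnion_iff]
  intro m
  filter_upwards [ae_oscillation_radialPropagator hP hPM hc hPz hC hε hgm hg hG
    (by positivity : (0 : ℝ) < 1 / ((m : ℝ) + 1)) ((m : ℝ) + 1)] with s hs
  exact exists_limit_of_oscillation hP hPM hgm hg hs

end Maximal

/-! ### Fourier transforms of square integrable functions -/

section Fourier

variable {E : Type*} [NormedAddCommGroup E] [InnerProductSpace ℝ E] [FiniteDimensional ℝ E]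
  [MeasurableSpace E] [BorelSpace E]

lemma SchwartzMap.compMeasurePreserving_toLp (A : E ≃ₗᵢ[ℝ] E) (g : 𝓢(E, ℂ)) :
    Lp.compMeasurePreserving A A.measurePreserving (g.toLp 2 (volume : Measure E)) =
      (SchwartzMap.compCLMOfContinuousLinearEquiv ℂ A.toContinuousLinearEquiv g).toLp 2 := by
  apply Lp.ext
  filter_upwards [Lp.coeFn_compMeasurePreserving (g.toLp 2 (volume : Measure E))
      A.measurePreserving,
    (SchwartzMap.compCLMOfContinuousLinearEquiv ℂ A.toContinuousLinearEquiv g).coeFn_toLp 2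
      (volume : Measure E),
    A.measurePreserving.quasiMeasurePreserving.ae (g.coeFn_toLp 2 (volume : Measure E))]
    with x h1 h2 h3
  rw [h1, h2, Function.comp_apply, h3]
  rfl

lemma SchwartzMap.fourier_comp_linearIsometryEquiv (A : E ≃ₗᵢ[ℝ] E) (g : 𝓢(E, ℂ)) :
    𝓕 (SchwartzMap.compCLMOfContinuousLinearEquiv ℂ A.toContinuousLinearEquiv g) =
      SchwartzMap.compCLMOfContinuousLinearEquiv ℂ A.toContinuousLinearEquiv (𝓕 g) := by
  ext w
  exact Real.fourier_comp_linearIsometry A g w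

/-- The Fourier transform of `L²` commutes with linear isometries; this passes from Schwartz functions
to `L²` by density. -/
lemma fourier_compMeasurePreserving (A : E ≃ₗᵢ[ℝ] E) (f : Lp ℂ 2 (volume : Measure E)) :
    𝓕 (Lp.compMeasurePreserving A A.measurePreserving f) =
      Lp.compMeasurePreserving A A.measurePreserving (𝓕 f) := by
  have hiso := Lp.isometry_compMeasurePreserving (E := ℂ) (p := 2) A.measurePreserving
  refine DenseRange.induction_on
    (p := fun f : Lp ℂ 2 (volume : Measure E) =>
      𝓕 (Lp.compMeasurePreserving A A.measurePreserving f) =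
      Lp.compMeasurePreserving A A.measurePreserving (𝓕 f))
    (SchwartzMap.denseRange_toLpCLM (p := 2) ENNReal.ofNat_ne_top) f ?_ fun g => ?_
  · exact isClosed_eq ((Lp.fourierTransformₗᵢ E ℂ).continuous.comp hiso.continuous)
      (hiso.continuous.comp (Lp.fourierTransformₗᵢ E ℂ).continuous)
  · rw [SchwartzMap.toLpCLM_apply, SchwartzMap.compMeasurePreserving_toLp,
      SchwartzMap.toLp_fourier_eq, SchwartzMap.toLp_fourier_eq,
      SchwartzMap.compMeasurePreserving_toLp, SchwartzMap.fourier_comp_linearIsometryEquiv]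

/-- The Fourier transform of a radial function is invariant under linear isometries. -/
lemma fourier_comp_ae_eq_of_radial {f : Lp ℂ 2 (volume : Measure E)} {f₀ : ℝ → ℂ}
    (hf : ∀ᵐ x, f x = f₀ ‖x‖) (A : E ≃ₗᵢ[ℝ] E) :
    ∀ᵐ ξ, (𝓕 f : Lp ℂ 2 (volume : Measure E)) (A ξ) =
      (𝓕 f : Lp ℂ 2 (volume : Measure E)) ξ := by
  have h : Lp.compMeasurePreserving A A.measurePreserving f = f := by
    apply Lp.ext
    filter_upwards [Lp.coeFn_compMeasurePreserving f A.measurePreserving, hf,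
      A.measurePreserving.quasiMeasurePreserving.ae hf] with x h1 h2 h3
    rw [h1, Function.comp_apply, h3, h2, A.norm_map]
  have h2 := fourier_compMeasurePreserving A f
  rw [h] at h2
  filter_upwards [Lp.coeFn_compMeasurePreserving (𝓕 f : Lp ℂ 2 (volume : Measure E))
    A.measurePreserving] with ξ h1
  rw [← h2] at h1
  exact h1.symm

/-- Locally integrable functions which define the same distribution are equal. -/
lemma ae_eq_of_forall_integral_schwartz_smul {u v : E → ℂ} (hu : LocallyIntegrable u)
    (hv : LocallyIntegrable v) (h : ∀ g : 𝓢(E, ℂ), ∫ x, g x • u x = ∫ x, g x • v x) :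
    ∀ᵐ x, u x = v x := by
  refine ae_eq_of_integral_contDiff_smul_eq hu hv fun g g_smooth g_cpt => ?_
  have hg₁ : HasCompactSupport (Complex.ofRealCLM ∘ g) := g_cpt.comp_left rfl
  have hg₂ : ContDiff ℝ (⊤ : ℕ∞) (Complex.ofRealCLM ∘ g) :=
    Complex.ofRealCLM.contDiff.comp g_smooth
  simpa using h (hg₁.toSchwartzMap hg₂)

/-- On integrable functions the inverse Fourier transform of `L²` is given by the integral. -/
lemma fourierInv_toLp_ae_eq {h : E → ℂ} (h1 : Integrable h) (h2 : MemLp h 2) :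
    ∀ᵐ x, (𝓕⁻ (h2.toLp h) : Lp ℂ 2 (volume : Measure E)) x = 𝓕⁻ h x := by
  have hcont : Continuous (𝓕⁻ h) :=
    VectorFourier.fourierIntegral_continuous Real.continuous_fourierChar
      (continuous_inner (𝕜 := ℝ) (E := E)).neg h1
  refine ae_eq_of_forall_integral_schwartz_smul
    ((Lp.memLp _).locallyIntegrable one_le_two) hcont.locallyIntegrable fun g => ?_
  rw [← Lp.toTemperedDistribution_apply, ← Lp.fourierInv_toTemperedDistribution_eq,
    TemperedDistribution.fourierInv_apply, Lp.toTemperedDistribution_apply]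
  calc ∫ x, (𝓕⁻ g) x • (h2.toLp h) x = ∫ x, (𝓕⁻ (g : E → ℂ)) x • h x := by
        refine integral_congr_ae ?_
        filter_upwards [h2.coeFn_toLp] with x hx
        rw [hx, SchwartzMap.fourierInv_coe]
    _ = ∫ x, g x • 𝓕⁻ h x := by
        have := VectorFourier.integral_fourierIntegral_smul_eq_flip (μ := (volume : Measure E))
          (ν := (volume : Measure E)) (L := -innerₗ E)
          Real.continuous_fourierChar (continuous_inner (𝕜 := ℝ) (E := E)).neg g.integrable h1
        rw [show (-innerₗ E).flip = -innerₗ E by ext; simp [real_inner_comm]] at this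
        exact this

/-- A property of the norm holds almost everywhere in the space if and only if it holds almost
everywhere on the half-line. -/
lemma ae_norm_iff [Nontrivial E] {p : ℝ → Prop} :
    (∀ᵐ x : E, p ‖x‖) ↔ ∀ᵐ s ∂(volume.restrict (Set.Ioi (0 : ℝ))), p s := by
  set k := Module.finrank ℝ E - 1 with hk
  have hmp := (volume : Measure E).measurePreserving_homeomorphUnitSphereProd
  have hL : (∀ᵐ x : E, p ‖x‖) ↔ ∀ᵐ x : ({0}ᶜ : Set E) ∂((volume : Measure E).comap (↑)), p ‖(x : E)‖ := by
    rw [← ae_restrict_iff_subtype (measurableSet_singleton (0 : E)).compl (p := fun x => p ‖x‖),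
      restrict_compl_singleton]
  have hR : (∀ᵐ s ∂(volume.restrict (Set.Ioi (0 : ℝ))), p s) ↔
      ∀ᵐ s : Set.Ioi (0 : ℝ) ∂(Measure.volumeIoiPow k), p (s : ℝ) := by
    rw [ae_restrict_iff_subtype measurableSet_Ioi, Measure.volumeIoiPow,
      ae_withDensity_iff (by fun_prop)]
    refine eventually_congr (Eventually.of_forall fun s => ?_)
    have : ENNReal.ofReal ((s : ℝ) ^ k) ≠ 0 := by
      simpa using pow_pos s.2 k
    simp [this]
  rw [hL, hR]
  constructor
  · intro h
    have h1 : ∀ᵐ q ∂((volume : Measure E).toSphere.prod (Measure.volumeIoiPow k)),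
        p (q.2 : ℝ) := by
      filter_upwards [(hmp.symm
        (homeomorphUnitSphereProd E).toMeasurableEquiv).quasiMeasurePreserving.ae h] with q hq
      have e : ‖(((homeomorphUnitSphereProd E).symm q : ({0}ᶜ : Set E)) : E)‖ = q.2 := by
        rw [← homeomorphUnitSphereProd_apply_snd_coe, Homeomorph.apply_symm_apply]
      rwa [← e]
    have h2 := Measure.ae_ae_of_ae_prod h1
    have : NeZero (volume : Measure E).toSphere := ⟨Measure.toSphere_ne_zero _⟩
    exact h2.exists.choose_spec
  · intro h
    have h1 := (hmp.quasiMeasurePreserving.ae (Measure.quasiMeasurePreserving_snd.ae h))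
    filter_upwards [h1] with x hx
    simpa using hx

/-- A square integrable function is the limit almost everywhere of the inverse Fourier integrals
over balls wherever these converge. -/
lemma ae_eq_of_tendsto_fourierInv_indicator (f : Lp ℂ 2 (volume : Measure E)) :
    ∀ᵐ x, ∀ l : ℂ, Tendsto (fun R : ℝ => 𝓕⁻ ((Metric.closedBall (0 : E) R).indicator
      (𝓕 f : Lp ℂ 2 (volume : Measure E))) x) atTop (𝓝 l) → l = f x := by
  set G : Lp ℂ 2 (volume : Measure E) := 𝓕 f with hG
  have hGm : MemLp G 2 := Lp.memLp G
  have h2 : ∀ N : ℕ, MemLp ((Metric.closedBall (0 : E) N).indicator G) 2 := fun N =>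
    hGm.indicator measurableSet_closedBall
  have h1 : ∀ N : ℕ, Integrable ((Metric.closedBall (0 : E) N).indicator G) := fun N =>
    (integrable_indicator_iff measurableSet_closedBall).2
      (integrableOn_of_memLp_two hGm measure_closedBall_lt_top)
  have hlim : Tendsto (fun N => (h2 N).toLp) atTop (𝓝 (hGm.toLp G)) := by
    rw [Lp.tendsto_Lp_iff_tendsto_eLpNorm'' _ h2]
    have e : ∀ N : ℕ, eLpNorm ((Metric.closedBall (0 : E) N).indicator G - ⇑G) 2 volume =
        ENNReal.ofReal ((∫ ξ in {ξ : E | (N : ℝ) < ‖ξ‖}, ‖G ξ‖ ^ 2) ^ (2⁻¹ : ℝ)) := fun N => by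
      rw [((h2 N).sub hGm).eLpNorm_eq_integral_rpow_norm (by norm_num) (by norm_num),
        ← integral_indicator (measurableSet_lt measurable_const measurable_norm)]
      congr 2
      refine integral_congr_ae (Eventually.of_forall fun ξ => ?_)
      by_cases hξ : ‖ξ‖ ≤ N
      · simp [hξ, not_lt.2 hξ]
      · simp [hξ, not_le.1 hξ]
    simp only [e]
    have h3 := tendsto_setIntegral_norm_gt (hGm.integrable_norm_pow (by norm_num))
    have h4 := ENNReal.tendsto_ofReal (h3.rpow_const (p := (2⁻¹ : ℝ)) (Or.inr (by norm_num)))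
    simpa using h4
  rw [Lp.toLp_coeFn] at hlim
  have hlim' : Tendsto (fun N => 𝓕⁻ ((h2 N).toLp)) atTop (𝓝 f) := by
    have h := ((Lp.fourierTransformₗᵢ E ℂ).symm.continuous.tendsto G).comp hlim
    have h5 : (Lp.fourierTransformₗᵢ E ℂ).symm G = f :=
      (Lp.fourierTransformₗᵢ E ℂ).symm_apply_apply f
    rwa [h5] at h
  obtain ⟨ns, hns, hae⟩ := (tendstoInMeasure_of_tendsto_Lp hlim').exists_seq_tendsto_ae
  filter_upwards [hae, ae_all_iff.2 fun N => fourierInv_toLp_ae_eq (h1 N) (h2 N)] with x hx hx' l hl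
  refine tendsto_nhds_unique (hl.comp (tendsto_natCast_atTop_atTop.comp hns.tendsto_atTop)) ?_
  refine hx.congr fun i => ?_
  rw [hx' (ns i)]
  rfl

/-- In `H^{1/4}` the weight `‖ξ‖^{1/4}` is dominated by the weight `(1 + ‖ξ‖²)^{1/8}`. -/
lemma memLp_of_memSobolev {f : Lp ℂ 2 (volume : Measure E)}
    (hf : TemperedDistribution.MemSobolev (1 / 4) 2 (f : 𝓢'(E, ℂ))) :
    MemLp (fun ξ => ((‖ξ‖ ^ (1 / 4 : ℝ) : ℝ) : ℂ) * (𝓕 f : Lp ℂ 2 (volume : Measure E)) ξ) 2 := by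
  obtain ⟨f', hf'⟩ := TemperedDistribution.memSobolev_iff_exists_smulLeftCLM_fourier.1 hf
  rw [Lp.fourier_toTemperedDistribution_eq] at hf'
  set G : Lp ℂ 2 (volume : Measure E) := 𝓕 f with hG
  set w : E → ℂ := fun x => (((1 + ‖x‖ ^ 2) ^ ((1 / 4 : ℝ) / 2) : ℝ) : ℂ) with hw
  have hwt : w.HasTemperateGrowth := by rw [hw]; fun_prop
  have hae : ∀ᵐ ξ, w ξ * G ξ = f' ξ := by
    refine ae_eq_of_forall_integral_schwartz_smul
      (((Lp.memLp G).locallyIntegrable one_le_two).continuous_mul hwt.1.continuous)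
      ((Lp.memLp f').locallyIntegrable one_le_two) fun g => ?_
    rw [← Lp.toTemperedDistribution_apply, ← hf', TemperedDistribution.smulLeftCLM_apply_apply,
      Lp.toTemperedDistribution_apply]
    refine integral_congr_ae (Eventually.of_forall fun ξ => ?_)
    simp only [SchwartzMap.smulLeftCLM_apply_apply hwt, smul_eq_mul]
    ring
  refine (Lp.memLp f').mono ?_ ?_
  · exact (Continuous.aestronglyMeasurable (by fun_prop (disch := norm_num))).mul
      (Lp.aestronglyMeasurable G)
  · filter_upwards [hae] with ξ hξ
    rw [← hξ, norm_mul, norm_mul, hw, Complex.norm_real, Complex.norm_real, Real.norm_eq_abs,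
      Real.norm_eq_abs, abs_of_nonneg (by positivity), abs_of_nonneg (by positivity)]
    refine mul_le_mul_of_nonneg_right ?_ (norm_nonneg _)
    calc ‖ξ‖ ^ (1 / 4 : ℝ) = (‖ξ‖ ^ 2) ^ ((1 / 4 : ℝ) / 2) := by
          rw [← Real.rpow_natCast, ← Real.rpow_mul (norm_nonneg _)]; norm_num
      _ ≤ _ := Real.rpow_le_rpow (by positivity) (by linarith) (by norm_num)

lemma memLp_of_memHomogeneousSobolev {n : ℕ}
    {f : Lp ℂ 2 (volume : Measure (EuclideanSpace ℝ (Fin n)))}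
    (hf : MemHomogeneousSobolev (1 / 4) f) :
    MemLp (fun ξ => ((‖ξ‖ ^ (1 / 4 : ℝ) : ℝ) : ℂ) *
      (𝓕 f : Lp ℂ 2 (volume : Measure (EuclideanSpace ℝ (Fin n)))) ξ) 2 := by
  refine ⟨(Continuous.aestronglyMeasurable (by fun_prop (disch := norm_num))).mul
      (Lp.aestronglyMeasurable _), ?_⟩
  rw [eLpNorm_lt_top_iff_lintegral_rpow_enorm_lt_top (by norm_num) (by norm_num)]
  refine lt_of_le_of_lt (lintegral_mono fun ξ => ?_) hf
  simp only [ENNReal.toReal_ofNat, ENNReal.rpow_ofNat]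
  rw [← ofReal_norm, ← ENNReal.ofReal_pow (norm_nonneg _)]
  refine ENNReal.ofReal_le_ofReal ?_
  rw [norm_mul, mul_pow, Complex.norm_real, Real.norm_eq_abs, abs_of_nonneg (by positivity)]
  refine mul_le_mul_of_nonneg_right ?_ (by positivity)
  rw [← Real.rpow_natCast, ← Real.rpow_mul (norm_nonneg _)]
  norm_num
  refine Real.rpow_le_rpow (norm_nonneg _) ?_ (by norm_num)
  nlinarith [Real.pi_gt_three, norm_nonneg ξ]

/-- Waves of frequencies distributed uniformly on a sphere superpose to a radial wave. -/
lemma integral_exp_inner_unitSphereMeasure [Nontrivial E] (y : E) :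
    ∫ θ, Complex.exp ((inner ℝ θ y : ℝ) * Complex.I) ∂(unitSphereMeasure E) = sphereCos y := by
  have hint : ∀ y : E, Integrable (fun θ => Complex.exp ((inner ℝ θ y : ℝ) * Complex.I))
      (unitSphereMeasure E) := fun y =>
    (integrable_const (1 : ℝ)).mono' (Continuous.aestronglyMeasurable (by fun_prop))
      (Eventually.of_forall fun θ => by rw [Complex.norm_exp_ofReal_mul_I])
  have hneg : ∫ θ, Complex.exp ((inner ℝ θ y : ℝ) * Complex.I) ∂(unitSphereMeasure E) =
      ∫ θ, Complex.exp ((inner ℝ θ (-y) : ℝ) * Complex.I) ∂(unitSphereMeasure E) := by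
    rw [← (measurePreserving_unitSphereMeasure (LinearIsometryEquiv.neg ℝ)).integral_comp
      (LinearIsometryEquiv.neg ℝ : E ≃ₗᵢ[ℝ] E).toHomeomorph.measurableEmbedding
      fun θ => Complex.exp ((inner ℝ θ y : ℝ) * Complex.I)]
    simp
  have hsum : ∫ θ, Complex.exp ((inner ℝ θ y : ℝ) * Complex.I) ∂(unitSphereMeasure E) +
      ∫ θ, Complex.exp ((inner ℝ θ (-y) : ℝ) * Complex.I) ∂(unitSphereMeasure E) =
      2 * sphereCos y := by
    rw [← integral_add (hint _) (hint _), sphereCos, ← integral_complex_ofReal,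
      ← integral_const_mul]
    refine integral_congr_ae (Eventually.of_forall fun θ => ?_)
    simp [Complex.two_cos]
  rw [← hneg, ← two_mul] at hsum
  exact mul_left_cancel₀ two_ne_zero hsum

/-- The inverse Fourier integral over a ball of a function with rotation invariant values is a
superposition of radial waves. -/
lemma setIntegral_exp_inner_mul_eq [Nontrivial E] {e : E} (he : ‖e‖ = 1) {g : E → ℂ}
    (hgm : Measurable g) {R : ℝ} (hg : IntegrableOn g (Metric.closedBall 0 R))
    (hrot : ∀ A : E ≃ₗᵢ[ℝ] E, ∀ᵐ ξ, g (A ξ) = g ξ) (x : E) :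
    ((unitSphereMeasure E).real Set.univ : ℂ) * ∫ ξ in Metric.closedBall (0 : E) R,
        Complex.exp (2 * Real.pi * Complex.I * (inner ℝ ξ x : ℝ)) * g ξ =
      ∫ ξ in Metric.closedBall (0 : E) R, (sphereProfile e (2 * Real.pi * ‖x‖ * ‖ξ‖) : ℂ) * g ξ := by
  set T : E → ℂ := fun x => ∫ ξ in Metric.closedBall (0 : E) R,
        Complex.exp (2 * Real.pi * Complex.I * (inner ℝ ξ x : ℝ)) * g ξ with hT
  have hTrot : ∀ y : E, ‖y‖ = ‖x‖ → T y = T x := fun y hy => by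
    obtain ⟨A, rfl⟩ := exists_linearIsometryEquiv_apply_eq hy.symm
    simp only [hT]
    rw [← A.measurePreserving.setIntegral_preimage_emb A.toHomeomorph.measurableEmbedding]
    have hpre : A ⁻¹' Metric.closedBall (0 : E) R = Metric.closedBall 0 R := by ext; simp
    rw [hpre]
    refine integral_congr_ae (ae_restrict_of_ae ?_)
    filter_upwards [hrot A] with ξ hξ
    rw [hξ, A.inner_map_map]
  have hav : ∫ θ, T (‖x‖ • θ) ∂(unitSphereMeasure E) =
      ((unitSphereMeasure E).real Set.univ : ℂ) * T x := by
    rw [integral_congr_ae (g := fun _ => T x)]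
    · simp
    · filter_upwards [ae_norm_eq_one (E := E)] with θ hθ
      exact hTrot _ (by rw [norm_smul, hθ, norm_norm, mul_one])
  rw [← hav]
  simp only [hT]
  rw [integral_integral_swap]
  · refine integral_congr_ae (Eventually.of_forall fun ξ => ?_)
    simp only
    rw [integral_mul_const]
    congr 1
    have h := integral_exp_inner_unitSphereMeasure ((2 * Real.pi * ‖x‖) • ξ)
    rw [sphereCos_eq_sphereProfile he, norm_smul, Real.norm_eq_abs,
      abs_of_nonneg (by positivity)] at h
    rw [← h]
    refine integral_congr_ae (Eventually.of_forall fun θ => ?_)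
    simp only [inner_smul_right, real_inner_comm ξ θ]
    congr 1
    push_cast
    ring
  · have hg' : Integrable (fun p : E × E => g p.2)
        ((unitSphereMeasure E).prod (volume.restrict (Metric.closedBall 0 R))) :=
      Integrable.comp_snd hg _
    refine hg'.norm.mono' (Measurable.aestronglyMeasurable
      (by unfold Function.uncurry; fun_prop)) (Eventually.of_forall fun p => ?_)
    simp only [Function.uncurry, norm_mul]
    rw [show 2 * Real.pi * Complex.I * ((inner ℝ p.2 (‖x‖ • p.1) : ℝ) : ℂ) =
      ((2 * Real.pi * inner ℝ p.2 (‖x‖ • p.1) : ℝ) : ℂ) * Complex.I by push_cast; ring,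
      Complex.norm_exp_ofReal_mul_I, one_mul]

end Fourier

/-! ### Radial solutions along curves -/

section Radial

variable {E : Type*} [NormedAddCommGroup E] [InnerProductSpace ℝ E] [FiniteDimensional ℝ E]
  [MeasurableSpace E] [BorelSpace E]

lemma continuous_sphereProfile [Nontrivial E] (e : E) : Continuous (sphereProfile e) :=
  continuous_iff_continuousAt.2 fun u => (hasDerivAt_sphereProfile e u).continuousAt

lemma abs_sphereProfile_le (e : E) (u : ℝ) :
    |sphereProfile e u| ≤ (unitSphereMeasure E).real Set.univ := by
  have := norm_integral_le_of_norm_le_const (μ := unitSphereMeasure E) (C := 1)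
    (f := fun θ : E => Real.cos (inner ℝ θ (u • e)))
    (Eventually.of_forall fun θ => Real.abs_cos_le_one _)
  simpa [sphereProfile, sphereCos] using this

/-- The profile of the radial waves behaves at infinity as a Bessel function: it is a damped
harmonic oscillation up to an error of lower order. -/
lemma exists_asymptotic_sphereProfile [Nontrivial E] {ι : Type*} [Fintype ι]
    (b : OrthonormalBasis ι ℝ E) (i : ι) :
    ∃ (z : ℂ) (c : ℝ), 0 ≤ c ∧ ∀ u : ℝ, 1 ≤ u → |sphereProfile (b i) u -
      u ^ (-(((Module.finrank ℝ E : ℝ) - 1) / 2)) * (Complex.exp (u * Complex.I) * z).im| ≤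
        c * u ^ (-(((Module.finrank ℝ E : ℝ) - 1) / 2) - 1) := by
  refine exists_asymptotic_of_bessel (fun u _ => hasDerivAt_sphereProfile (b i) u)
    (fun u _ => hasDerivAt_sphereProfileDeriv (b i) u) fun u hu => ?_
  rw [sphereProfileDeriv₂_eq b i (by linarith), Module.finrank_eq_card_basis b.toBasis]

end Radial

section Curves

variable {n : ℕ}

/-- The solution with radial data is a superposition of radial waves, as its Fourier transform is
rotation invariant. -/
lemma schrodingerTrunc_eq_radialPropagator [Nontrivial (EuclideanSpace ℝ (Fin n))]
    {f : Lp ℂ 2 (volume : Measure (EuclideanSpace ℝ (Fin n)))} {f₀ : ℝ → ℂ}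
    (hrad : ∀ᵐ x : EuclideanSpace ℝ (Fin n), f x = f₀ ‖x‖) {e : EuclideanSpace ℝ (Fin n)}
    (he : ‖e‖ = 1) (C ε R : ℝ) {σ s : ℝ} {x : EuclideanSpace ℝ (Fin n)} (hx : ‖x‖ = s + C * σ) :
    schrodingerTrunc f R (ε * σ ^ 2) x = radialPropagator (sphereProfile e) C ε
      (fun ξ => ((unitSphereMeasure (EuclideanSpace ℝ (Fin n))).real Set.univ : ℂ)⁻¹ *
        (𝓕 f : Lp ℂ 2 (volume : Measure (EuclideanSpace ℝ (Fin n)))) ξ) (-1) R σ s := by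
  set c : ℂ := ((unitSphereMeasure (EuclideanSpace ℝ (Fin n))).real Set.univ : ℂ) with hc
  have hc0 : c ≠ 0 := Complex.ofReal_ne_zero.2 unitSphereMeasure_univ_ne_zero
  set G : Lp ℂ 2 (volume : Measure (EuclideanSpace ℝ (Fin n))) := 𝓕 f with hG
  have hGm : Measurable G := (Lp.stronglyMeasurable G).measurable
  set q : EuclideanSpace ℝ (Fin n) → ℂ :=
    fun ξ => quadPhase 0 (ε * (4 * Real.pi ^ 2 * σ ^ 2)) ‖ξ‖ with hq
  have hqm : Measurable q := by rw [hq]; unfold quadPhase; fun_prop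
  have hint : IntegrableOn (fun ξ => q ξ * G ξ) (Metric.closedBall 0 R) := by
    refine (integrableOn_of_memLp_two (Lp.memLp G) measure_closedBall_lt_top).norm.mono'
      (hqm.mul hGm).aestronglyMeasurable (Eventually.of_forall fun ξ => ?_)
    rw [norm_mul, hq, norm_quadPhase, one_mul]
  have key := setIntegral_exp_inner_mul_eq he (hqm.mul hGm) hint (fun A => by
    filter_upwards [fourier_comp_ae_eq_of_radial hrad A] with ξ hξ
    simp only [hq, A.norm_map, Pi.mul_apply]
    rw [hξ]) x
  have hann : annulus (EuclideanSpace ℝ (Fin n)) (-1) R = Metric.closedBall 0 R := by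
    ext ξ
    have := norm_nonneg ξ
    simp only [annulus, Set.mem_ofPred_eq, mem_closedBall_zero_iff, and_iff_right_iff_imp]
    intro _
    linarith
  have h1 : schrodingerTrunc f R (ε * σ ^ 2) x = ∫ ξ in Metric.closedBall 0 R,
      Complex.exp (2 * Real.pi * Complex.I * (inner ℝ ξ x : ℝ)) * (q ξ * G ξ) := by
    refine integral_congr_ae (Eventually.of_forall fun ξ => ?_)
    simp only [hq, quadPhase]
    rw [mul_assoc]
    congr 3
    push_cast
    ring
  have h2 : radialPropagator (sphereProfile e) C ε (fun ξ => c⁻¹ * G ξ) (-1) R σ s =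
      c⁻¹ * ∫ ξ in Metric.closedBall 0 R,
        (sphereProfile e (2 * Real.pi * ‖x‖ * ‖ξ‖) : ℂ) * (q ξ * G ξ) := by
    rw [radialPropagator, hann, ← integral_const_mul, ← hx]
    refine integral_congr_ae (Eventually.of_forall fun ξ => ?_)
    simp only [hq]
    ring
  rw [h1, h2, eq_inv_mul_iff_mul_eq₀ hc0]
  exact key

/-- At time `0` the truncated inverse Fourier integrals of a radial function can only converge to
the value of the function, for almost every distance from the origin. -/
lemma ae_eq_of_tendsto_radialPropagator_zero [Nontrivial (EuclideanSpace ℝ (Fin n))]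
    {f : Lp ℂ 2 (volume : Measure (EuclideanSpace ℝ (Fin n)))} {f₀ : ℝ → ℂ}
    (hrad : ∀ᵐ x : EuclideanSpace ℝ (Fin n), f x = f₀ ‖x‖) {e : EuclideanSpace ℝ (Fin n)}
    (he : ‖e‖ = 1) (C ε : ℝ) :
    ∀ᵐ s ∂(volume.restrict (Set.Ioi (0 : ℝ))), ∀ l : ℂ, Tendsto (fun R =>
      radialPropagator (sphereProfile e) C ε
        (fun ξ => ((unitSphereMeasure (EuclideanSpace ℝ (Fin n))).real Set.univ : ℂ)⁻¹ *
          (𝓕 f : Lp ℂ 2 (volume : Measure (EuclideanSpace ℝ (Fin n)))) ξ) (-1) R 0 s)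
        atTop (𝓝 l) → l = f₀ s := by
  rw [← ae_norm_iff (E := EuclideanSpace ℝ (Fin n))]
  filter_upwards [ae_eq_of_tendsto_fourierInv_indicator f, hrad] with x hx hfx l hl
  rw [← hfx]
  refine hx l (hl.congr fun R => ?_)
  rw [← schrodingerTrunc_eq_radialPropagator hrad he C ε R (x := x) (by simp), schrodingerTrunc,
    Real.fourierInv_eq', ← integral_indicator measurableSet_closedBall]
  refine integral_congr_ae (Eventually.of_forall fun ξ => ?_)
  by_cases hξ : ξ ∈ Metric.closedBall (0 : EuclideanSpace ℝ (Fin n)) R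
  · simp only [Set.indicator_of_mem hξ, smul_eq_mul]
    simp only [ne_eq, OfNat.ofNat_ne_zero, not_false_eq_true, zero_pow, mul_zero,
      Complex.ofReal_zero, zero_mul, Complex.exp_zero, mul_one]
    congr 2
    push_cast
    ring
  · simp only [Set.indicator_of_notMem hξ, smul_zero]

/-- For a fixed point `x` the norm of the curve is known for all times of `J` near `0`: the condition at
`s₀ = ‖x‖` is restricted to `s = ‖x‖`. -/
lemma CurveNormCondition.eventually_norm_eq {C : ℝ} {J : Set ℝ}
    {γ : EuclideanSpace ℝ (Fin n) → ℝ → EuclideanSpace ℝ (Fin n)} (hγ : CurveNormCondition C J γ)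
    (x : EuclideanSpace ℝ (Fin n)) :
    ∀ᶠ t in 𝓝[J \ {0}] (0 : ℝ), ‖γ x t‖ = ‖x‖ + C * |t| ^ (1 / 2 : ℝ) := by
  obtain ⟨V, hV, h⟩ := hγ ‖x‖ (norm_nonneg x)
  have ht : Tendsto (fun t : ℝ => (‖x‖, t)) (𝓝[J \ {0}] 0)
      (𝓝[Set.Ici (0 : ℝ) ×ˢ (Set.univ : Set ℝ)] (‖x‖, 0)) :=
    tendsto_nhdsWithin_iff.2 ⟨(Continuous.tendsto (by fun_prop) _).mono_left nhdsWithin_le_nhds,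
      Eventually.of_forall fun t => ⟨norm_nonneg x, Set.mem_univ _⟩⟩
  filter_upwards [ht hV, self_mem_nhdsWithin] with t h1 h2
  exact h x t h2.1 h1

lemma tendsto_abs_rpow_half_nhdsWithin (S : Set ℝ) :
    Tendsto (fun t : ℝ => |t| ^ (1 / 2 : ℝ)) (𝓝[S] 0) (𝓝[Set.Icc 0 1] 0) := by
  refine tendsto_nhdsWithin_iff.2 ⟨?_, ?_⟩
  · have : Continuous fun t : ℝ => |t| ^ (1 / 2 : ℝ) :=
      continuous_abs.rpow_const fun _ => Or.inr (by norm_num)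
    simpa using (this.tendsto 0).mono_left nhdsWithin_le_nhds
  · have : ∀ᶠ t in 𝓝[S] (0 : ℝ), |t| ≤ 1 := nhdsWithin_le_nhds <| by
      filter_upwards [Metric.ball_mem_nhds (0 : ℝ) one_pos] with t ht
      simpa using (Metric.mem_ball.1 ht).le
    filter_upwards [this] with t ht
    exact ⟨by positivity, Real.rpow_le_one (abs_nonneg t) ht (by norm_num)⟩

/-- The two time directions: limits which exist along the curve for positive and for negative
times and are continuous up to the time `0` give the convergence of the solution. -/
lemma schrodingerTendstoAlong_of_limits {f : Lp ℂ 2 (volume : Measure (EuclideanSpace ℝ (Fin n)))}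
    {J : Set ℝ} {c : ℝ → EuclideanSpace ℝ (Fin n)} {a : ℂ} {Q : ℝ → ℝ → ℝ → ℂ} {L : ℝ → ℝ → ℂ}
    (hL : ∀ ε : ℝ, |ε| = 1 → ContinuousOn (L ε) (Set.Icc 0 1) ∧ L ε 0 = a ∧
      ∀ σ ∈ Set.Icc (0 : ℝ) 1, Tendsto (fun R => Q ε R σ) atTop (𝓝 (L ε σ)))
    (hc : ∀ᶠ t in 𝓝[J \ {0}] (0 : ℝ), ∀ ε R : ℝ, ε * (|t| ^ (1 / 2 : ℝ)) ^ 2 = t →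
      schrodingerTrunc f R t (c t) = Q ε R (|t| ^ (1 / 2 : ℝ))) :
    SchrodingerTendstoAlong f J c a := by
  have hσ := tendsto_abs_rpow_half_nhdsWithin (J \ {0})
  have hconv : ∀ᶠ t in 𝓝[J \ {0}] (0 : ℝ), Tendsto (fun R => schrodingerTrunc f R t (c t)) atTop
      (𝓝 (L (if 0 ≤ t then 1 else -1) (|t| ^ (1 / 2 : ℝ)))) := by
    filter_upwards [hc, hσ self_mem_nhdsWithin] with t ht hmem
    set ε : ℝ := if 0 ≤ t then 1 else -1 with hε
    have hε1 : |ε| = 1 := by rw [hε]; split_ifs <;> simp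
    have hsq : ε * (|t| ^ (1 / 2 : ℝ)) ^ 2 = t := by
      rw [← Real.rpow_natCast, ← Real.rpow_mul (abs_nonneg t)]
      norm_num
      rw [hε]
      split_ifs with h
      · rw [abs_of_nonneg h, one_mul]
      · rw [abs_of_neg (not_le.1 h)]; ring
    simp only [ht ε _ hsq]
    exact (hL ε hε1).2.2 _ hmem
  have hlim : ∀ ε : ℝ, |ε| = 1 → Tendsto (fun t : ℝ => L ε (|t| ^ (1 / 2 : ℝ)))
      (𝓝[J \ {0}] 0) (𝓝 a) := fun ε hε => by
    have h := (hL ε hε).1 0 ⟨le_rfl, zero_le_one⟩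
    rw [ContinuousWithinAt, (hL ε hε).2.1] at h
    exact h.comp hσ
  refine ⟨hconv.mono fun t ht => ⟨_, ht⟩, ?_⟩
  have h1 : Tendsto (fun t : ℝ => L (if 0 ≤ t then 1 else -1) (|t| ^ (1 / 2 : ℝ)))
      (𝓝[J \ {0}] 0) (𝓝 a) := by
    refine ((hlim 1 (by simp)).if' (p := fun t => 0 ≤ t) (hlim (-1) (by simp))).congr fun t => ?_
    split_ifs <;> rfl
  exact h1.congr' (hconv.mono fun t ht => ht.limUnder_eq.symm)

end Curves

end

theorem mainTheorem5 (n : ℕ) (hn : 2 ≤ n) (C : ℝ) (hC : 0 ≤ C) (J : Set ℝ)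
    (γ : EuclideanSpace ℝ (Fin n) → ℝ → EuclideanSpace ℝ (Fin n))
    (hγ : CurveNormCondition C J γ)
    (f : Lp ℂ 2 (volume : Measure (EuclideanSpace ℝ (Fin n)))) (f₀ : ℝ → ℂ)
    (hrad : ∀ᵐ x : EuclideanSpace ℝ (Fin n), f x = f₀ ‖x‖)
    (hf : MemHomogeneousSobolev (1 / 4) f ∨ ∃ β : ℝ, 1 / 4 ≤ β ∧ MemInhomogeneousSobolev β f) :
    (∀ᵐ s : ℝ ∂(volume.restrict (Set.Ici (0 : ℝ))),
      ∀ x : EuclideanSpace ℝ (Fin n), ‖x‖ = s → SchrodingerTendstoAlong f J (γ x) (f₀ s)) ∧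
    (∀ᵐ x : EuclideanSpace ℝ (Fin n), SchrodingerTendstoAlong f J (γ x) (f x)) := by
  have hfin : Module.finrank ℝ (EuclideanSpace ℝ (Fin n)) = n := finrank_euclideanSpace_fin
  have hnt : Nontrivial (EuclideanSpace ℝ (Fin n)) :=
    Module.nontrivial_of_finrank_pos (R := ℝ) (by omega)
  have hF : MemLp (fun ξ => ((‖ξ‖ ^ (1 / 4 : ℝ) : ℝ) : ℂ) *
      (𝓕 f : Lp ℂ 2 (volume : Measure (EuclideanSpace ℝ (Fin n)))) ξ) 2 := by
    rcases hf with hf | ⟨β, hβ, hf⟩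
    · exact memLp_of_memHomogeneousSobolev hf
    · exact memLp_of_memSobolev (TemperedDistribution.MemSobolev.mono hβ hf)
  set b := EuclideanSpace.basisFun (Fin n) ℝ with hb
  set e := b ⟨0, by omega⟩ with he'
  have he : ‖e‖ = 1 := b.norm_eq_one _
  obtain ⟨z, c, hc, hz⟩ := exists_asymptotic_sphereProfile b ⟨0, by omega⟩
  -- the normalisation of the spherical average
  set κ : ℂ := ((unitSphereMeasure (EuclideanSpace ℝ (Fin n))).real Set.univ : ℂ)⁻¹ with hκ
  set g : EuclideanSpace ℝ (Fin n) → ℂ :=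
    fun ξ => κ * (𝓕 f : Lp ℂ 2 (volume : Measure (EuclideanSpace ℝ (Fin n)))) ξ with hg
  have hgm : Measurable g := (Lp.stronglyMeasurable _).measurable.const_mul κ
  have hg2 : MemLp g 2 := (Lp.memLp _).const_mul κ
  have hgF : MemLp (fun ξ => ((‖ξ‖ ^ (1 / 4 : ℝ) : ℝ) : ℂ) * g ξ) 2 := by
    refine (hF.const_mul κ).congr_norm (Continuous.aestronglyMeasurable
      (by fun_prop (disch := norm_num)) |>.mul hgm.aestronglyMeasurable) ?_
    refine Eventually.of_forall fun ξ => ?_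
    simp only [hg]
    congr 1
    ring
  have hlim : ∀ ε : ℝ, |ε| = 1 → ∀ᵐ s : ℝ ∂(volume.restrict (Set.Ioi 0)),
      ∃ L : ℝ → ℂ, ContinuousOn L (Set.Icc 0 1) ∧ L 0 = f₀ s ∧ ∀ σ ∈ Set.Icc (0 : ℝ) 1,
        Tendsto (fun R => radialPropagator (sphereProfile e) C ε g (-1) R σ s) atTop
          (𝓝 (L σ)) := fun ε hε => by
    filter_upwards [ae_exists_limit_radialPropagator (continuous_sphereProfile e)
        (abs_sphereProfile_le e) hc hz hC hε hgm hg2 hgF,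
      ae_eq_of_tendsto_radialPropagator_zero hrad he C ε] with s ⟨L, hL, hLt⟩ hs
    exact ⟨L, hL, hs _ (hLt 0 ⟨le_rfl, zero_le_one⟩), hLt⟩
  have hmain : ∀ᵐ s : ℝ ∂(volume.restrict (Set.Ioi (0 : ℝ))),
      ∀ x : EuclideanSpace ℝ (Fin n), ‖x‖ = s → SchrodingerTendstoAlong f J (γ x) (f₀ s) := by
    filter_upwards [hlim 1 (by simp), hlim (-1) (by simp)] with s ⟨L₁, h₁⟩ ⟨L₂, h₂⟩ x hx
    refine schrodingerTendstoAlong_of_limits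
      (Q := fun ε R σ => radialPropagator (sphereProfile e) C ε g (-1) R σ s)
      (L := fun ε => if ε = 1 then L₁ else L₂) (fun ε hε => ?_) ?_
    · rcases (abs_eq zero_le_one).1 hε with rfl | rfl
      · simpa using h₁
      · have : ¬ (-1 : ℝ) = 1 := by norm_num
        simpa [this] using h₂
    · -- the time `t` is `εσ²` with `σ = |t|^{1/2}`
      filter_upwards [hγ.eventually_norm_eq x] with t ht ε R hε
      rw [hx] at ht
      have h3 := schrodingerTrunc_eq_radialPropagator hrad he C ε R ht
      rwa [hε] at h3
  refine ⟨?_, ?_⟩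
  · rwa [← Measure.restrict_congr_set (Ioi_ae_eq_Ici (a := (0 : ℝ)))]
  · filter_upwards [(ae_norm_iff (E := EuclideanSpace ℝ (Fin n))).2 hmain, hrad] with x h1 h2
    rw [h2]
    exact h1 x rfl
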